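/- Let $m>p$ be nonnegative integers, and let $\mathbf Z$ be a random $m\times p$ complex matrix with independent entries $z_{ij}\sim\mathbb CN(\xi_{ij},1)$, i.e. $z_{ij}$ has density $\pi^{-1}e^{-|z-\xi_{ij}|^2}$ on $\mathbb C$; the mean matrix $\boldsymbol\Xi=(\xi_{ij})\in\mathbb C^{m\times p}$ is unknown. An estimator $\widehat{\boldsymbol\Xi}$ is a measurable map $\mathbb C^{m\times p}\to\mathbb C^{m\times p}$ applied to $\mathbf Z$; its risk is $$\mathcal R_0(\widehat{\boldsymbol\Xi},\boldsymbol\Xi)=\mathbb E\big[\operatorname{Tr}\{(\widehat{\boldsymbol\Xi}(\mathbf Z)-\boldsymbol\Xi)^*(\widehat{\boldsymbol\Xi}(\mathbf Z)-\boldsymbol\Xi)\}\big]\in[0,\infty],$$ and it is called minimax if $\sup_{\boldsymbol\Xi}\mathcal R_0(\widehat{\boldsymbol\Xi},\boldsymbol\Xi)\le\sup_{\boldsymbol\Xi}\mathcal R_0(\widehat{\boldsymbol\Xi}',\boldsymbol\Xi)$ for every estimator $\widehat{\boldsymbol\Xi}'$, the suprema being over all $\boldsymbol\Xi\in\mathbb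 C^{m\times p}$. Let $\mathbb R^p_>=\{\ell\in\mathbb R^p:\ell_1>\cdots>\ell_p>0\}$, and let $\gamma_1,\dots,\gamma_p:\mathbb R^p_>\to\mathbb R$ be measurable functions such that, on $\mathbb R^p_>$, (i) $0\le\gamma_k\le 2(m-p)$ for $k=1,\dots,p$; (ii) for $k=1,\dots,p$, $\gamma_k$ is nondecreasing in $\ell_k$ when the other coordinates are held fixed (this holds in particular if $\partial\gamma_k/\partial\ell_k$ exists and is $\ge0$ everywhere on $\mathbb R^p_>$); (iii) $\gamma_1\ge\gamma_2\ge\cdots\ge\gamma_p$. When $\mathbf Z^*\mathbf Z$ has distinct positive eigenvalues (which happens with probability one), write $\mathbf Z^*\mathbf Z=\mathbf U\mathbf L\mathbf U^*$ with $\mathbf U$ unitary, $\mathbf L=\operatorname{Diag}(\ell_1,\dots,\ell_p)$, $\ell\in\mathbb R^p_>$. Then the estimator $$\mathbf Z\,[\mathbf I_p+\mathbf U\mathbf H(\mathbf L)\mathbf U^*],\qquad \mathbf H(\mathbf L)=-\operatorname{Diag}\Big(\frac{\gamma_1(\ell)}{\ell_1},\dots,\frac{\gamma_p(\ell)}{\ell_p}\Big),$$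 (taken to be $\mathbf Z$ on the exceptional null set) is minimax. In particular, the crude complex Efron–Morris estimator $\mathbf Z\,[\mathbf I_p-(m-p)(\mathbf Z^*\mathbf Z)^{-1}]$ (taken to be $\mathbf Z$ on the null set where $\mathbf Z^*\mathbf Z$ is singular) is minimax. -/

import Mathlib

open MeasureTheory Matrix

noncomputable section

namespace ComplexShrinkage

/-- The product (Borel) σ-algebra on `ℂ^{m × p}`. -/
instance instMeasurableSpaceMatrix {m p : ℕ} : MeasurableSpace (Matrix (Fin m) (Fin p) ℂ) :=
  inferInstanceAs (MeasurableSpace (Fin m → Fin p → ℂ))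

/-- The one-dimensional complex normal distribution `ℂN(ξ, 1)`, with density
`π⁻¹ exp (-|z - ξ|²)` with respect to Lebesgue measure on `ℂ`. -/
def complexNormal (ξ : ℂ) : Measure ℂ :=
  volume.withDensity fun z => ENNReal.ofReal (Real.pi⁻¹ * Real.exp (-‖z - ξ‖ ^ 2))

/-- The matrix-variate complex normal distribution `ℂN_{m × p}(Ξ, I_m ⊗ I_p)`: the entries are
independent and the `(i, j)` entry has distribution `ℂN(ξ_{ij}, 1)`. -/
def matrixNormal {m p : ℕ} (Ξ : Matrix (Fin m) (Fin p) ℂ) : Measure (Matrix (Fin m) (Fin p) ℂ) :=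
  Measure.map Matrix.of (Measure.pi fun i => Measure.pi fun j => complexNormal (Ξ i j))

/-- The loss `Tr {(A - Ξ)* (A - Ξ)}` (the trace is a nonnegative real number). -/
def loss {m p : ℕ} (A Ξ : Matrix (Fin m) (Fin p) ℂ) : ℝ :=
  (((A - Ξ)ᴴ * (A - Ξ)).trace).re

/-- The risk of the estimator `δ` at the mean matrix `Ξ`, with values in `[0, ∞]`. -/
def risk {m p : ℕ} (δ : Matrix (Fin m) (Fin p) ℂ → Matrix (Fin m) (Fin p) ℂ)
    (Ξ : Matrix (Fin m) (Fin p) ℂ) : ENNReal :=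
  ∫⁻ Z, ENNReal.ofReal (loss (δ Z) Ξ) ∂(matrixNormal Ξ)

/-- `δ` is a minimax estimator: it is a (measurable) estimator, and its maximal risk does not
exceed that of any other estimator. -/
def IsMinimax {m p : ℕ} (δ : Matrix (Fin m) (Fin p) ℂ → Matrix (Fin m) (Fin p) ℂ) : Prop :=
  Measurable δ ∧
    ∀ δ' : Matrix (Fin m) (Fin p) ℂ → Matrix (Fin m) (Fin p) ℂ, Measurable δ' →
      (⨆ Ξ, risk δ Ξ) ≤ ⨆ Ξ, risk δ' Ξ

/-- The set `{ℓ ∈ ℝ^p : ℓ_1 > ℓ_2 > ⋯ > ℓ_p > 0}`. -/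
def orderedCone (p : ℕ) : Set (Fin p → ℝ) :=
  {l | StrictAnti l ∧ ∀ k, 0 < l k}

/-- `Z* Z = U L U*` with `U` unitary and `L = Diag(ℓ_1, …, ℓ_p)`. -/
def IsSpectralDecomp {m p : ℕ} (Z : Matrix (Fin m) (Fin p) ℂ) (U : Matrix (Fin p) (Fin p) ℂ)
    (l : Fin p → ℝ) : Prop :=
  U ∈ Matrix.unitaryGroup (Fin p) ℂ ∧
    Zᴴ * Z = U * Matrix.diagonal (fun k => (l k : ℂ)) * Uᴴ

open Classical in
/-- The estimator `Z (I + U H(L) U*)`, where `Z* Z = U L U*` is a spectral decomposition with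
eigenvalues in decreasing order and `H = Diag(h_1, …, h_p)` with `h_k` defined on the ordered cone.
On the null set where the eigenvalues of `Z* Z` are not distinct and positive, `H(L)` is undefined
and the value is taken to be `Z`. The value does not depend on the choice of the decomposition:
see `spectralEstimator_eq`. -/
def spectralEstimator {m p : ℕ} (h : Fin p → orderedCone p → ℝ) (Z : Matrix (Fin m) (Fin p) ℂ) :
    Matrix (Fin m) (Fin p) ℂ :=
  if H : ∃ x : Matrix (Fin p) (Fin p) ℂ × orderedCone p, IsSpectralDecomp Z x.1 x.2 then
    Z * (1 + H.choose.1 * Matrix.diagonal (fun k => (h k H.choose.2 : ℂ)) * H.choose.1ᴴ)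
  else Z

theorem spectralDecomp_unique {m p : ℕ} {Z : Matrix (Fin m) (Fin p) ℂ}
    {U V : Matrix (Fin p) (Fin p) ℂ} {l l' : orderedCone p}
    (hU : IsSpectralDecomp Z U l) (hV : IsSpectralDecomp Z V l') :
    l = l' ∧ ∀ d : Fin p → ℂ,
      U * Matrix.diagonal d * Uᴴ = V * Matrix.diagonal d * Vᴴ := by
  obtain ⟨hU, eU⟩ := hU
  obtain ⟨hV, eV⟩ := hV
  have hU1 : Uᴴ * U = 1 := (Matrix.mem_unitaryGroup_iff').1 hU
  have hU2 : U * Uᴴ = 1 := (Matrix.mem_unitaryGroup_iff).1 hU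
  have hV1 : Vᴴ * V = 1 := (Matrix.mem_unitaryGroup_iff').1 hV
  have hV2 : V * Vᴴ = 1 := (Matrix.mem_unitaryGroup_iff).1 hV
  set Q := Vᴴ * U with hQ
  have key : ∀ d d' : Fin p → ℂ, (U * Matrix.diagonal d * Uᴴ = V * Matrix.diagonal d' * Vᴴ) ↔
      ∀ i j, Q i j * d j = d' i * Q i j := by
    intro d d'
    have h1 : (U * Matrix.diagonal d * Uᴴ = V * Matrix.diagonal d' * Vᴴ) ↔
        Q * Matrix.diagonal d = Matrix.diagonal d' * Q := by
      constructor
      · intro h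
        calc Q * Matrix.diagonal d = Vᴴ * (U * Matrix.diagonal d * Uᴴ) * U := by
              rw [hQ]; simp only [Matrix.mul_assoc, hU1, Matrix.mul_one]
          _ = Vᴴ * (V * Matrix.diagonal d' * Vᴴ) * U := by rw [h]
          _ = (Vᴴ * V) * Matrix.diagonal d' * (Vᴴ * U) := by simp only [Matrix.mul_assoc]
          _ = Matrix.diagonal d' * Q := by rw [hV1, Matrix.one_mul]
      · intro h
        calc U * Matrix.diagonal d * Uᴴ = (V * Vᴴ) * U * Matrix.diagonal d * Uᴴ := by
              rw [hV2, Matrix.one_mul]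
          _ = V * (Q * Matrix.diagonal d) * Uᴴ := by rw [hQ]; simp only [Matrix.mul_assoc]
          _ = V * (Matrix.diagonal d' * Q) * Uᴴ := by rw [h]
          _ = V * Matrix.diagonal d' * Vᴴ * (U * Uᴴ) := by
              rw [hQ]; simp only [Matrix.mul_assoc]
          _ = V * Matrix.diagonal d' * Vᴴ := by rw [hU2, Matrix.mul_one]
    rw [h1]
    constructor
    · intro h i j
      have := congrFun (congrFun h i) j
      simpa [Matrix.mul_diagonal, Matrix.diagonal_mul] using this
    · intro h
      ext i j
      simpa [Matrix.mul_diagonal, Matrix.diagonal_mul] using h i j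
  have hl := (key _ _).1 (eU.symm.trans eV)
  have hne : ∀ i j, Q i j ≠ 0 → l.1 j = l'.1 i := by
    intro i j hij
    have h := hl i j
    rw [mul_comm] at h
    exact_mod_cast mul_right_cancel₀ hij h
  have hQ1 : Qᴴ * Q = 1 := by
    calc Qᴴ * Q = Uᴴ * (V * Vᴴ) * U := by
          rw [hQ, Matrix.conjTranspose_mul, Matrix.conjTranspose_conjTranspose]
          simp only [Matrix.mul_assoc]
      _ = 1 := by rw [hV2, Matrix.mul_one, hU1]
  have hQ2 : Q * Qᴴ = 1 := mul_eq_one_comm.1 hQ1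
  have hcol : ∀ j, ∃ i, Q i j ≠ 0 := by
    intro j
    by_contra hc
    push Not at hc
    have h := congrFun (congrFun hQ1 j) j
    simp [Matrix.mul_apply, hc] at h
  have hrow : ∀ i, ∃ j, Q i j ≠ 0 := by
    intro i
    by_contra hc
    push Not at hc
    have h := congrFun (congrFun hQ2 i) i
    simp [Matrix.mul_apply, hc] at h
  have hr : Set.range l.1 = Set.range l'.1 := by
    ext t
    constructor
    · rintro ⟨j, rfl⟩
      obtain ⟨i, hi⟩ := hcol j
      exact ⟨i, (hne i j hi).symm⟩
    · rintro ⟨i, rfl⟩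
      obtain ⟨j, hj⟩ := hrow i
      exact ⟨j, hne i j hj⟩
  have hll : l.1 = l'.1 := (StrictAnti.range_inj l.2.1 l'.2.1).1 hr
  refine ⟨Subtype.ext hll, fun d => (key d d).2 fun i j => ?_⟩
  by_cases hij : Q i j = 0
  · simp [hij]
  · have h := hne i j hij
    rw [hll] at h
    rw [l'.2.1.injective h, mul_comm]

/-- The estimator is `Z (I + U H(L) U*)` for every ordered spectral decomposition of `Z* Z`. -/
theorem spectralEstimator_eq {m p : ℕ} (h : Fin p → orderedCone p → ℝ)
    {Z : Matrix (Fin m) (Fin p) ℂ} {U : Matrix (Fin p) (Fin p) ℂ} {l : orderedCone p}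
    (hU : IsSpectralDecomp Z U l) :
    spectralEstimator h Z =
      Z * (1 + U * Matrix.diagonal (fun k => (h k l : ℂ)) * Uᴴ) := by
  have H : ∃ x : Matrix (Fin p) (Fin p) ℂ × orderedCone p, IsSpectralDecomp Z x.1 x.2 :=
    ⟨(U, l), hU⟩
  obtain ⟨e1, e2⟩ := spectralDecomp_unique H.choose_spec hU
  unfold spectralEstimator
  rw [dif_pos H, e2, e1]

/-- The crude complex Efron–Morris estimator `Z (I - (m - p) (Z* Z)⁻¹)`. -/
def crudeEfronMorris {m p : ℕ} (Z : Matrix (Fin m) (Fin p) ℂ) : Matrix (Fin m) (Fin p) ℂ :=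
  Z * (1 - ((m : ℂ) - (p : ℂ)) • (Zᴴ * Z)⁻¹)

end ComplexShrinkage

end

/-!
The constant risk of `Z` itself is `m p`, and it is a lower bound for the maximal risk of every
estimator: under the prior `Ξ ∼ ℂN(0, T)` the posterior is normal with variance `T / (1 + T)`, so the
Bayes risk is at least `m p T / (1 + T)`, and `T → ∞` (`le_iSup_risk`). An estimator is therefore
minimax as soon as its risk never exceeds `m p` (`isMinimax_of_risk_le`).

The risk of a shrinkage estimator is compared with that of `Z` in the coordinates of the singular
value decomposition `Z = V Σ(x) U`. Up to constants, the Gaussian measure `exp (-|Z|²) dZ` becomes the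
product of the Haar measures in `V` and `U` and of the density
`∏ⱼ xⱼ^{2(m-p)+1} ∏_{i<j} (xᵢ² - xⱼ²)² exp (-|x|²)` of the singular values on the cone
`x₁ > ⋯ > xₚ > 0`. No Jacobian is computed. The joint moments of the traces `tr (Z* Z)ᵃ` satisfy the
recursion `TraceRecursion`, by Stein's identity applied to the vector fields `Z (Z* Z)ᵃ`
(`traceRecursion_entryMoment`); the joint moments of the power sums of `xₖ²` under the density above
satisfy the same one, by integration by parts on the cone (`traceRecursion_svIntegral`). The recursion
has only one solution up to a factor, hence the law of the singular values is the one claimed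
(`exists_map_sv_gaussMeasure`), power sums damped by a Gaussian factor being enough test functions.
Averaging over the unitary groups, under which the Gaussian measure is invariant, gives the
disintegration (`exists_lintegral_gaussMeasure_eq`).

For fixed `V` and `U` the weight `exp (-|V Σ(x) U - Ξ|²)` is a constant times
`exp (∑ₖ (bₖ xₖ - xₖ²))`, where `bₖ` is twice the real part of the `k`-th diagonal entry of
`V* Ξ U*`. An estimator replacing `xₖ` by `xₖ - γₖ / xₖ` changes the loss by
`∑ₖ γₖ (γₖ / xₖ² - 2 + bₖ / xₖ)`, which is at most `2 ∑ₖ γₖ ((m - p) / xₖ² + bₖ / (2 xₖ) - 1)` because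
`γₖ ≤ 2 (m - p)`. Writing `w` for the density times the weight, one has
`((m - p) / xₖ² + bₖ / (2 xₖ) - 1 + ∑_{j ≠ k} 2 / (xₖ² - xⱼ²)) w = ∂ₖ (w / (2 xₖ))`. The integral of
`γₖ ∂ₖ (w / (2 xₖ))` is nonpositive since `γₖ` is nondecreasing in `xₖ` and `w / (2 xₖ)` is nonnegative
and vanishes at the boundary, and the pair terms contribute
`∑_{i<j} 2 (γᵢ - γⱼ) / (xᵢ² - xⱼ²) ≥ 0` because the `γₖ` are nonincreasing in `k`. So the excess risk is
nonpositive (`setIntegral_shrinkage_nonpos`, `lintegral_svMeasure_loss_le`). The monotonicity of `γₖ`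
in `xₖ` enters only through the one-dimensional lemma `setIntegral_mul_deriv_nonpos`, proved by the
layer-cake formula without differentiating `γₖ`.
-/

open MeasureTheory Matrix

noncomputable section

namespace ComplexShrinkage

/-! ### Complex normal distributions -/

theorem lintegral_fin_prod_eq_prod {n : ℕ} {E : Type*} {mE : MeasurableSpace E}
    {μ : Fin n → Measure E} [∀ i, SigmaFinite (μ i)]
    {f : Fin n → E → ENNReal} (hf : ∀ i, Measurable (f i)) :
    ∫⁻ x : Fin n → E, ∏ i, f i (x i) ∂(Measure.pi μ) = ∏ i, ∫⁻ x, f i x ∂(μ i) := by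
  induction n with
  | zero => simp
  | succ n ih =>
    have hm : Measurable fun x : Fin n → E => ∏ i : Fin n, f i.succ (x i) :=
      Finset.measurable_prod _ fun i _ => (hf i.succ).comp (measurable_pi_apply i)
    have h := (measurePreserving_piFinSuccAbove μ 0).lintegral_comp
      (f := fun x => f 0 x.1 * ∏ i : Fin n, f i.succ (x.2 i))
      (((hf 0).comp measurable_fst).mul (hm.comp measurable_snd))
    have e : ∀ x : Fin (n + 1) → E, ∏ i, f i (x i) =
        (fun x : E × (Fin n → E) => f 0 x.1 * ∏ i : Fin n, f i.succ (x.2 i))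
          (MeasurableEquiv.piFinSuccAbove (fun _ => E) 0 x) := by
      intro x
      rw [Fin.prod_univ_succ]
      rfl
    simp_rw [e]
    rw [h, Fin.prod_univ_succ, ← ih fun i : Fin n => hf i.succ]
    exact lintegral_prod_mul (hf 0).aemeasurable hm.aemeasurable

theorem pi_withDensity {n : ℕ} {E : Type*} {mE : MeasurableSpace E}
    {μ : Fin n → Measure E} [∀ i, SigmaFinite (μ i)]
    {f : Fin n → E → ENNReal} (hf : ∀ i, Measurable (f i))
    [∀ i, SigmaFinite ((μ i).withDensity (f i))] :
    Measure.pi (fun i => (μ i).withDensity (f i)) =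
      (Measure.pi μ).withDensity fun x => ∏ i, f i (x i) := by
  refine Measure.pi_eq fun s hs => ?_
  rw [withDensity_apply _ (MeasurableSet.univ_pi hs), ← lintegral_indicator (MeasurableSet.univ_pi hs)]
  have : ∀ x : Fin n → E, (Set.univ.pi s).indicator (fun x => ∏ i, f i (x i)) x =
      ∏ i, (s i).indicator (f i) (x i) := by
    intro x
    by_cases hx : x ∈ Set.univ.pi s
    · rw [Set.indicator_of_mem hx]
      exact Finset.prod_congr rfl fun i _ => (Set.indicator_of_mem (hx i trivial) _).symm
    · rw [Set.indicator_of_notMem hx]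
      simp only [Set.mem_univ_pi, not_forall] at hx
      obtain ⟨i, hi⟩ := hx
      exact (Finset.prod_eq_zero (Finset.mem_univ i) (Set.indicator_of_notMem hi _)).symm
  simp_rw [this]
  rw [lintegral_fin_prod_eq_prod fun i => (hf i).indicator (hs i)]
  exact Finset.prod_congr rfl fun i _ => by
    rw [lintegral_indicator (hs i), withDensity_apply _ (hs i)]

/-- The density of the complex normal distribution with mean `c` and variance `a`. -/
def gaussDensity (a : ℝ) (c z : ℂ) : ENNReal :=
  ENNReal.ofReal ((Real.pi * a)⁻¹ * Real.exp (-(‖z - c‖ ^ 2 / a)))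

/-- The complex normal distribution with mean `c` and variance `a`. -/
def complexNormalVar (a : ℝ) (c : ℂ) : Measure ℂ := volume.withDensity (gaussDensity a c)

theorem measurable_gaussDensity (a : ℝ) : Measurable fun x : ℂ × ℂ => gaussDensity a x.1 x.2 := by
  unfold gaussDensity
  fun_prop

theorem measurable_gaussDensity_right (a : ℝ) (c : ℂ) : Measurable (gaussDensity a c) := by
  unfold gaussDensity
  fun_prop

theorem complexNormal_eq (ξ : ℂ) : complexNormal ξ = complexNormalVar 1 ξ := by
  unfold complexNormal complexNormalVar gaussDensity
  simp

/-- Gaussian moments of the modulus, from the polar-coordinate formula. Since the Bochner integral is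
positive, the integrand is integrable. -/
theorem lintegral_norm_rpow_gaussian {a : ℝ} (ha : 0 < a) (q : ℝ) (hq : 0 ≤ q) :
    ∫⁻ z : ℂ, ENNReal.ofReal (‖z‖ ^ q * Real.exp (-a⁻¹ * ‖z‖ ^ (2 : ℝ))) =
      ENNReal.ofReal (Real.pi * (a⁻¹) ^ (-(q + 2) / 2) * Real.Gamma ((q + 2) / 2)) := by
  have h := Complex.integral_rpow_mul_exp_neg_mul_rpow (p := 2) (q := q) (b := a⁻¹) (by norm_num)
    (by linarith) (by positivity)
  have hpos : 0 < Real.pi * (a⁻¹) ^ (-(q + 2) / 2) * Real.Gamma ((q + 2) / 2) :=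
    mul_pos (mul_pos Real.pi_pos (Real.rpow_pos_of_pos (by positivity) _))
      (Real.Gamma_pos_of_pos (by linarith))
  rw [mul_div_cancel_left₀ _ (two_ne_zero)] at h
  rw [← h]
  refine (ofReal_integral_eq_lintegral_ofReal ?_ (.of_forall fun z => by positivity)).symm
  by_contra hni
  rw [integral_undef hni] at h
  exact hpos.ne h

theorem lintegral_gaussDensity {a : ℝ} (ha : 0 < a) (c : ℂ) :
    ∫⁻ z, gaussDensity a c z = 1 := by
  unfold gaussDensity
  have h1 := lintegral_sub_right_eq_self
    (fun z : ℂ => ENNReal.ofReal ((Real.pi * a)⁻¹ * Real.exp (-(‖z‖ ^ 2 / a)))) (μ := volume) c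
  rw [h1]
  have h := lintegral_norm_rpow_gaussian ha 0 le_rfl
  have e : ∀ z : ℂ, ENNReal.ofReal ((Real.pi * a)⁻¹ * Real.exp (-(‖z‖ ^ 2 / a))) =
      ENNReal.ofReal (Real.pi * a)⁻¹ *
        ENNReal.ofReal (‖z‖ ^ (0 : ℝ) * Real.exp (-a⁻¹ * ‖z‖ ^ (2 : ℝ))) := by
    intro z
    rw [← ENNReal.ofReal_mul (by positivity), Real.rpow_zero, one_mul, Real.rpow_two]
    congr 3
    field_simp
  simp_rw [e]
  rw [lintegral_const_mul' _ _ ENNReal.ofReal_ne_top, h, ← ENNReal.ofReal_mul (by positivity)]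
  have : (-(0 + 2) / 2 : ℝ) = -1 := by norm_num
  rw [this, Real.rpow_neg_one]
  norm_num
  have := Real.pi_pos.ne'
  field_simp

instance (a : ℝ) (c : ℂ) : SigmaFinite (complexNormalVar a c) := by
  unfold complexNormalVar
  exact SigmaFinite.withDensity_of_ne_top (.of_forall fun z => ENNReal.ofReal_ne_top)

theorem isProbabilityMeasure_complexNormalVar {a : ℝ} (ha : 0 < a) (c : ℂ) :
    IsProbabilityMeasure (complexNormalVar a c) :=
  ⟨by rw [complexNormalVar, withDensity_apply _ MeasurableSet.univ, setLIntegral_univ,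
    lintegral_gaussDensity ha]⟩

theorem lintegral_norm_sub_mean_sq {a : ℝ} (ha : 0 < a) (c : ℂ) :
    ∫⁻ z, ENNReal.ofReal (‖z - c‖ ^ 2) ∂(complexNormalVar a c) = ENNReal.ofReal a := by
  rw [complexNormalVar, lintegral_withDensity_eq_lintegral_mul _
    (measurable_gaussDensity_right a c) (by fun_prop)]
  have h := lintegral_norm_rpow_gaussian ha 2 (by norm_num)
  have e : ∀ z : ℂ, (gaussDensity a c * fun z => ENNReal.ofReal (‖z - c‖ ^ 2)) z =
      ENNReal.ofReal (Real.pi * a)⁻¹ *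
        ENNReal.ofReal (‖z - c‖ ^ (2 : ℝ) * Real.exp (-a⁻¹ * ‖z - c‖ ^ (2 : ℝ))) := by
    intro z
    rw [Pi.mul_apply, gaussDensity, ← ENNReal.ofReal_mul (by positivity),
      ← ENNReal.ofReal_mul (by positivity), Real.rpow_two]
    congr 1
    rw [mul_assoc, mul_comm (Real.exp _)]
    congr 4
    field_simp
  simp_rw [e]
  rw [lintegral_const_mul' _ _ ENNReal.ofReal_ne_top,
    lintegral_sub_right_eq_self (fun z : ℂ => ENNReal.ofReal (‖z‖ ^ (2 : ℝ) *
      Real.exp (-a⁻¹ * ‖z‖ ^ (2 : ℝ)))), h, ← ENNReal.ofReal_mul (by positivity)]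
  have : (-(2 + 2) / 2 : ℝ) = -(2 : ℕ) := by norm_num
  rw [this, Real.rpow_neg (by positivity), Real.rpow_natCast]
  have := Real.pi_pos.ne'
  norm_num
  field_simp

/-- Among all constants, the mean is the best predictor: the reflection `z ↦ 2c - z` preserves the
normal law, and the average of `‖d - z‖²` and `‖d - (2c - z)‖²` is at least `‖z - c‖²`. -/
theorem le_lintegral_norm_sub_sq {a : ℝ} (ha : 0 < a) (c d : ℂ) :
    ENNReal.ofReal a ≤ ∫⁻ z, ENNReal.ofReal (‖d - z‖ ^ 2) ∂(complexNormalVar a c) := by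
  have hm := measurable_gaussDensity_right a c
  have hrefl : ∫⁻ z, ENNReal.ofReal (‖d - (2 * c - z)‖ ^ 2) ∂(complexNormalVar a c) =
      ∫⁻ z, ENNReal.ofReal (‖d - z‖ ^ 2) ∂(complexNormalVar a c) := by
    rw [complexNormalVar, lintegral_withDensity_eq_lintegral_mul _ hm (by fun_prop),
      lintegral_withDensity_eq_lintegral_mul _ hm (by fun_prop),
      ← lintegral_sub_left_eq_self _ (2 * c)]
    refine lintegral_congr fun z => ?_
    simp only [Pi.mul_apply, gaussDensity]
    rw [show 2 * c - z - c = -(z - c) by ring, norm_neg, sub_sub_cancel]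
  have h2 : 2 * ENNReal.ofReal a ≤
      2 * ∫⁻ z, ENNReal.ofReal (‖d - z‖ ^ 2) ∂(complexNormalVar a c) := by
    calc 2 * ENNReal.ofReal a
        = ∫⁻ z, 2 * ENNReal.ofReal (‖z - c‖ ^ 2) ∂(complexNormalVar a c) := by
          rw [lintegral_const_mul _ (by fun_prop), lintegral_norm_sub_mean_sq ha]
      _ ≤ ∫⁻ z, (ENNReal.ofReal (‖d - z‖ ^ 2) + ENNReal.ofReal (‖d - (2 * c - z)‖ ^ 2))
            ∂(complexNormalVar a c) := by
          refine lintegral_mono fun z => ?_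
          rw [← ENNReal.ofReal_add (by positivity) (by positivity),
            ← ENNReal.ofReal_ofNat, ← ENNReal.ofReal_mul (by norm_num)]
          refine ENNReal.ofReal_le_ofReal ?_
          have h := parallelogram_law_with_norm ℝ (d - c) (z - c)
          rw [show d - c + (z - c) = d - (2 * c - z) by ring,
            show d - c - (z - c) = d - z by ring] at h
          nlinarith [norm_nonneg (d - c)]
      _ = _ := by
          rw [lintegral_add_left (by fun_prop), hrefl, two_mul]
  exact (ENNReal.mul_le_mul_iff_right (by norm_num) (by norm_num)).1 h2

/-- Completing the square: the joint density of `(z, ξ)` with `z ∣ ξ ∼ ℂN(ξ, 1)` and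
`ξ ∼ ℂN(0, T)`, factored the other way round. -/
theorem gaussDensity_mul {T : ℝ} (hT : 0 < T) (z ξ : ℂ) :
    gaussDensity T 0 ξ * gaussDensity 1 ξ z =
      gaussDensity (1 + T) 0 z * gaussDensity (T / (1 + T)) ((T / (1 + T) : ℝ) * z) ξ := by
  unfold gaussDensity
  rw [← ENNReal.ofReal_mul (by positivity), ← ENNReal.ofReal_mul (by positivity)]
  have e : ‖ξ - 0‖ ^ 2 / T + ‖z - ξ‖ ^ 2 / 1 =
      ‖z - 0‖ ^ 2 / (1 + T) + ‖ξ - (T / (1 + T) : ℝ) * z‖ ^ 2 / (T / (1 + T)) := by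
    simp only [Complex.sq_norm, Complex.normSq_apply, Complex.sub_re, Complex.sub_im,
      Complex.mul_re, Complex.mul_im, Complex.ofReal_re, Complex.ofReal_im, Complex.zero_re,
      Complex.zero_im]
    have : (1 + T) ≠ 0 := by positivity
    field_simp
    ring
  congr 1
  rw [mul_mul_mul_comm, ← Real.exp_add, mul_mul_mul_comm, ← Real.exp_add, ← neg_add, ← neg_add, e]
  congr 1
  field_simp

section Bayes
variable {m p : ℕ}

/-- Lebesgue measure on `ℂ^{m × p}`. -/
def matrixLebesgue (m p : ℕ) : Measure (Matrix (Fin m) (Fin p) ℂ) :=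
  Measure.map Matrix.of (volume : Measure (Fin m → Fin p → ℂ))

/-- The matrix of independent complex normal variables of variance `a` and mean matrix `C`. -/
def matrixNormalVar (a : ℝ) (C : Matrix (Fin m) (Fin p) ℂ) : Measure (Matrix (Fin m) (Fin p) ℂ) :=
  Measure.map Matrix.of (Measure.pi fun i => Measure.pi fun j => complexNormalVar a (C i j))

theorem matrixNormal_eq (Ξ : Matrix (Fin m) (Fin p) ℂ) :
    matrixNormal Ξ = matrixNormalVar 1 Ξ := by
  unfold matrixNormal matrixNormalVar
  simp_rw [complexNormal_eq]

/-- The density of `matrixNormalVar` with respect to Lebesgue measure. -/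
def matrixDensity (a : ℝ) (C Z : Matrix (Fin m) (Fin p) ℂ) : ENNReal :=
  ∏ i, ∏ j, gaussDensity a (C i j) (Z i j)

theorem measurable_of : Measurable (Matrix.of : (Fin m → Fin p → ℂ) → Matrix (Fin m) (Fin p) ℂ) :=
  measurable_id

theorem measurable_entry (i : Fin m) (j : Fin p) :
    Measurable fun Z : Matrix (Fin m) (Fin p) ℂ => Z i j :=
  (measurable_pi_apply j).comp (measurable_pi_apply (X := fun _ : Fin m => Fin p → ℂ) i)

theorem measurable_matrix {α : Type*} [MeasurableSpace α] {f : α → Matrix (Fin m) (Fin p) ℂ}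
    (h : ∀ i j, Measurable fun x => f x i j) : Measurable f :=
  measurable_pi_iff.2 fun i => measurable_pi_iff.2 fun j => h i j

theorem measurable_matrixDensity (a : ℝ) :
    Measurable fun x : Matrix (Fin m) (Fin p) ℂ × Matrix (Fin m) (Fin p) ℂ =>
      matrixDensity a x.1 x.2 := by
  have h : ∀ i j, Measurable fun x : Matrix (Fin m) (Fin p) ℂ × Matrix (Fin m) (Fin p) ℂ =>
      gaussDensity a (x.1 i j) (x.2 i j) := by
    intro i j
    have h1 : Measurable fun x : Matrix (Fin m) (Fin p) ℂ × Matrix (Fin m) (Fin p) ℂ =>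
      x.1 i j := (measurable_entry i j).comp measurable_fst
    have h2 : Measurable fun x : Matrix (Fin m) (Fin p) ℂ × Matrix (Fin m) (Fin p) ℂ =>
      x.2 i j := (measurable_entry i j).comp measurable_snd
    have h3 := (measurable_gaussDensity a).comp (h1.prodMk h2)
    exact h3
  unfold matrixDensity
  refine Finset.measurable_prod _ fun i _ => Finset.measurable_prod _ fun j _ => h i j

theorem matrixNormalVar_eq_withDensity (a : ℝ) (C : Matrix (Fin m) (Fin p) ℂ) :
    matrixNormalVar a C = (matrixLebesgue m p).withDensity (matrixDensity a C) := by
  have hrow : ∀ i, Measure.pi (fun j => complexNormalVar a (C i j)) =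
      (volume : Measure (Fin p → ℂ)).withDensity
        fun z => ∏ j, gaussDensity a (C i j) (z j) := by
    intro i
    have : ∀ j, SigmaFinite ((volume : Measure ℂ).withDensity (gaussDensity a (C i j))) :=
      fun j => inferInstanceAs (SigmaFinite (complexNormalVar a (C i j)))
    exact pi_withDensity fun j => measurable_gaussDensity_right a (C i j)
  have hm : ∀ i, Measurable fun z : Fin p → ℂ => ∏ j, gaussDensity a (C i j) (z j) := fun i =>
    Finset.measurable_prod _ fun j _ =>
      (measurable_gaussDensity_right a (C i j)).comp (measurable_pi_apply j)
  have : ∀ i, SigmaFinite ((volume : Measure (Fin p → ℂ)).withDensity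
      fun z => ∏ j, gaussDensity a (C i j) (z j)) := fun i => by
    rw [← hrow i]; infer_instance
  unfold matrixNormalVar
  simp_rw [hrow]
  rw [pi_withDensity hm]
  exact Measure.map_id.trans (congrArg (fun μ => Measure.withDensity μ _) Measure.map_id.symm)

/-! ### The Bayes lower bound for the maximal risk -/

theorem loss_eq_sum (A Ξ : Matrix (Fin m) (Fin p) ℂ) :
    loss A Ξ = ∑ i, ∑ j, ‖A i j - Ξ i j‖ ^ 2 := by
  simp only [loss, trace, diag_apply, mul_apply, conjTranspose_apply, Matrix.sub_apply, Complex.re_sum]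
  rw [Finset.sum_comm]
  refine Finset.sum_congr rfl fun i _ => Finset.sum_congr rfl fun j _ => ?_
  rw [Complex.sq_norm, Complex.normSq_apply]
  simp [Complex.mul_re]
  ring

theorem ofReal_loss (A Ξ : Matrix (Fin m) (Fin p) ℂ) :
    ENNReal.ofReal (loss A Ξ) = ∑ i, ∑ j, ENNReal.ofReal (‖A i j - Ξ i j‖ ^ 2) := by
  rw [loss_eq_sum, ENNReal.ofReal_sum_of_nonneg fun i _ => Finset.sum_nonneg fun j _ => by positivity]
  exact Finset.sum_congr rfl fun i _ => ENNReal.ofReal_sum_of_nonneg fun j _ => by positivity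

theorem isProbabilityMeasure_matrixNormalVar {a : ℝ} (ha : 0 < a) (C : Matrix (Fin m) (Fin p) ℂ) :
    IsProbabilityMeasure (matrixNormalVar a C) := by
  have := fun i j => isProbabilityMeasure_complexNormalVar ha (C i j)
  exact Measure.isProbabilityMeasure_map measurable_of.aemeasurable

theorem lintegral_entry_matrixNormalVar {a : ℝ} (ha : 0 < a) (C : Matrix (Fin m) (Fin p) ℂ)
    (i : Fin m) (j : Fin p) {f : ℂ → ENNReal} (hf : Measurable f) :
    ∫⁻ Z, f (Z i j) ∂(matrixNormalVar a C) = ∫⁻ z, f z ∂(complexNormalVar a (C i j)) := by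
  have := fun i j => isProbabilityMeasure_complexNormalVar ha (C i j)
  have h1 : Measurable fun z : Fin p → ℂ => f (z j) := hf.comp (measurable_pi_apply j)
  have h2 : Measurable fun Z : Matrix (Fin m) (Fin p) ℂ => f (Z i j) :=
    hf.comp (measurable_entry i j)
  refine (lintegral_map h2 measurable_of).trans ?_
  exact ((measurePreserving_eval (fun i => Measure.pi fun j => complexNormalVar a (C i j))
    i).lintegral_comp h1).trans
    ((measurePreserving_eval (fun j => complexNormalVar a (C i j)) j).lintegral_comp hf)

theorem lintegral_loss_mean {a : ℝ} (ha : 0 < a) (C : Matrix (Fin m) (Fin p) ℂ) :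
    ∫⁻ Z, ENNReal.ofReal (loss Z C) ∂(matrixNormalVar a C) = m * p * ENNReal.ofReal a := by
  have hm : ∀ i j, Measurable fun Z : Matrix (Fin m) (Fin p) ℂ =>
      ENNReal.ofReal (‖Z i j - C i j‖ ^ 2) := fun i j =>
    (((measurable_entry i j).sub_const _).norm.pow_const 2).ennreal_ofReal
  simp_rw [ofReal_loss]
  rw [lintegral_finsetSum _ fun i _ => Finset.measurable_sum _ fun j _ => hm i j]
  simp_rw [lintegral_finsetSum _ fun j _ => hm _ j]
  have : ∀ i j, ∫⁻ Z, ENNReal.ofReal (‖Z i j - C i j‖ ^ 2) ∂(matrixNormalVar a C) =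
      ENNReal.ofReal a := fun i j =>
    (lintegral_entry_matrixNormalVar ha C i j
      (f := fun z => ENNReal.ofReal (‖z - C i j‖ ^ 2)) (by fun_prop)).trans
      (lintegral_norm_sub_mean_sq ha _)
  simp only [this, Finset.sum_const, Finset.card_univ, Fintype.card_fin, nsmul_eq_mul, mul_assoc]

theorem le_lintegral_loss {a : ℝ} (ha : 0 < a) (C D : Matrix (Fin m) (Fin p) ℂ) :
    m * p * ENNReal.ofReal a ≤ ∫⁻ X, ENNReal.ofReal (loss D X) ∂(matrixNormalVar a C) := by
  have hm : ∀ i j, Measurable fun Z : Matrix (Fin m) (Fin p) ℂ =>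
      ENNReal.ofReal (‖D i j - Z i j‖ ^ 2) := fun i j =>
    (((measurable_entry i j).const_sub _).norm.pow_const 2).ennreal_ofReal
  simp_rw [ofReal_loss]
  rw [lintegral_finsetSum _ fun i _ => Finset.measurable_sum _ fun j _ => hm i j]
  simp_rw [lintegral_finsetSum _ fun j _ => hm _ j]
  have : ∀ i j, ENNReal.ofReal a ≤
      ∫⁻ Z, ENNReal.ofReal (‖D i j - Z i j‖ ^ 2) ∂(matrixNormalVar a C) := fun i j =>
    (le_lintegral_norm_sub_sq ha _ _).trans_eq (lintegral_entry_matrixNormalVar ha C i j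
      (f := fun z => ENNReal.ofReal (‖D i j - z‖ ^ 2)) (by fun_prop)).symm
  calc (m * p * ENNReal.ofReal a : ENNReal) = ∑ _i : Fin m, ∑ _j : Fin p, ENNReal.ofReal a := by
        simp [mul_assoc]
    _ ≤ _ := Finset.sum_le_sum fun i _ => Finset.sum_le_sum fun j _ => this i j

theorem risk_id (Ξ : Matrix (Fin m) (Fin p) ℂ) : risk id Ξ = m * p := by
  rw [risk, matrixNormal_eq]
  simpa using lintegral_loss_mean one_pos Ξ

theorem measurable_loss {α : Type*} [MeasurableSpace α] {f g : α → Matrix (Fin m) (Fin p) ℂ}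
    (hf : Measurable f) (hg : Measurable g) :
    Measurable fun x => ENNReal.ofReal (loss (f x) (g x)) := by
  simp_rw [ofReal_loss]
  refine Finset.measurable_sum _ fun i _ => Finset.measurable_sum _ fun j _ => ?_
  have h1 : Measurable fun x => f x i j := (measurable_entry i j).comp hf
  have h2 : Measurable fun x => g x i j := (measurable_entry i j).comp hg
  exact ((h1.sub h2).norm.pow_const 2).ennreal_ofReal

instance : SigmaFinite (matrixLebesgue m p) :=
  (MeasurableEquiv.refl (Fin m → Fin p → ℂ)).sigmaFinite_map

/-- Exchanging the two conditionings of a joint law given by densities. -/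
theorem lintegral_withDensity_swap {X Y : Type*} [MeasurableSpace X] [MeasurableSpace Y]
    {μ : Measure X} {ν : Measure Y} [SFinite μ] [SFinite ν] {f₀ : X → ENNReal}
    {f₁ : X → Y → ENNReal} {g₀ : Y → ENNReal} {g₁ : Y → X → ENNReal} {L : X → Y → ENNReal}
    (hf₀ : Measurable f₀) (hf₁ : Measurable fun x : X × Y => f₁ x.1 x.2) (hg₀ : Measurable g₀)
    (hg₁ : Measurable fun y : Y × X => g₁ y.1 y.2) (hL : Measurable fun x : X × Y => L x.1 x.2)
    (h : ∀ x y, f₀ x * f₁ x y = g₀ y * g₁ y x) :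
    ∫⁻ x, ∫⁻ y, L x y ∂(ν.withDensity (f₁ x)) ∂(μ.withDensity f₀) =
      ∫⁻ y, ∫⁻ x, L x y ∂(μ.withDensity (g₁ y)) ∂(ν.withDensity g₀) := by
  have hf : ∀ x, Measurable (f₁ x) := fun x => hf₁.comp measurable_prodMk_left
  have hg : ∀ y, Measurable (g₁ y) := fun y => hg₁.comp measurable_prodMk_left
  have hLx : ∀ x, Measurable (L x) := fun x => hL.comp measurable_prodMk_left
  have hLy : ∀ y, Measurable (fun x => L x y) := fun y => hL.comp measurable_prodMk_right
  have e1 : ∀ x, ∫⁻ y, L x y ∂(ν.withDensity (f₁ x)) = ∫⁻ y, f₁ x y * L x y ∂ν := fun x =>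
    lintegral_withDensity_eq_lintegral_mul _ (hf x) (hLx x)
  have e2 : ∀ y, ∫⁻ x, L x y ∂(μ.withDensity (g₁ y)) = ∫⁻ x, g₁ y x * L x y ∂μ := fun y =>
    lintegral_withDensity_eq_lintegral_mul _ (hg y) (hLy y)
  simp_rw [e1, e2]
  have m1 : Measurable fun x => ∫⁻ y, f₁ x y * L x y ∂ν := (hf₁.mul hL).lintegral_prod_right'
  have m2 : Measurable fun y => ∫⁻ x, g₁ y x * L x y ∂μ :=
    (hg₁.mul (hL.comp measurable_swap)).lintegral_prod_right'
  rw [lintegral_withDensity_eq_lintegral_mul _ hf₀ m1,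
    lintegral_withDensity_eq_lintegral_mul _ hg₀ m2]
  simp only [Pi.mul_apply]
  have e3 : ∀ x, f₀ x * ∫⁻ y, f₁ x y * L x y ∂ν = ∫⁻ y, g₀ y * g₁ y x * L x y ∂ν := fun x => by
    refine (lintegral_const_mul _ ((hf x).mul (hLx x))).symm.trans ?_
    exact lintegral_congr fun y => by rw [Pi.mul_apply, ← mul_assoc, h]
  have e4 : ∀ y, g₀ y * ∫⁻ x, g₁ y x * L x y ∂μ = ∫⁻ x, g₀ y * g₁ y x * L x y ∂μ := fun y => by
    refine (lintegral_const_mul _ ((hg y).mul (hLy y))).symm.trans ?_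
    exact lintegral_congr fun x => by rw [Pi.mul_apply, ← mul_assoc]
  simp_rw [e3, e4]
  refine lintegral_lintegral_swap (Measurable.aemeasurable ?_)
  exact ((hg₀.comp measurable_snd).mul (hg₁.comp measurable_swap)).mul hL

/-- The joint density of mean and observation under a normal prior, factored the other way round. -/
theorem matrixDensity_mul {T : ℝ} (hT : 0 < T) (Z X : Matrix (Fin m) (Fin p) ℂ) :
    matrixDensity T 0 X * matrixDensity 1 X Z =
      matrixDensity (1 + T) 0 Z * matrixDensity (T / (1 + T)) (((T / (1 + T) : ℝ) : ℂ) • Z) X := by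
  simp only [matrixDensity, ← Finset.prod_mul_distrib]
  exact Finset.prod_congr rfl fun i _ => Finset.prod_congr rfl fun j _ => gaussDensity_mul hT _ _

/-- The Bayes risk under the prior `ℂN(0, T)` is at least `m p T / (1 + T)`, the posterior being
normal with variance `T / (1 + T)`. -/
theorem le_bayes_risk {T : ℝ} (hT : 0 < T)
    {δ : Matrix (Fin m) (Fin p) ℂ → Matrix (Fin m) (Fin p) ℂ} (hδ : Measurable δ) :
    m * p * ENNReal.ofReal (T / (1 + T)) ≤ ∫⁻ X, risk δ X ∂(matrixNormalVar T 0) := by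
  have hm := measurable_matrixDensity (m := m) (p := p)
  have hl : Measurable fun x : Matrix (Fin m) (Fin p) ℂ × Matrix (Fin m) (Fin p) ℂ =>
    ENNReal.ofReal (loss (δ x.2) x.1) := measurable_loss (hδ.comp measurable_snd) measurable_fst
  have hm0 : ∀ a, Measurable (matrixDensity a (0 : Matrix (Fin m) (Fin p) ℂ)) := by
    intro a
    have h := (hm a).comp (measurable_prodMk_left (x := (0 : Matrix (Fin m) (Fin p) ℂ)))
    exact h
  have hsmul : Measurable fun x : Matrix (Fin m) (Fin p) ℂ × Matrix (Fin m) (Fin p) ℂ =>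
      matrixDensity (T / (1 + T)) (((T / (1 + T) : ℝ) : ℂ) • x.1) x.2 := by
    have h1 : Measurable fun x : Matrix (Fin m) (Fin p) ℂ × Matrix (Fin m) (Fin p) ℂ =>
        ((((T / (1 + T) : ℝ) : ℂ) • x.1 : Matrix (Fin m) (Fin p) ℂ), x.2) := by
      refine Measurable.prodMk (measurable_matrix fun i j => ?_) measurable_snd
      have h2 : Measurable fun x : Matrix (Fin m) (Fin p) ℂ × Matrix (Fin m) (Fin p) ℂ =>
        x.1 i j := (measurable_entry i j).comp measurable_fst
      exact h2.const_mul _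
    have h3 := (hm (T / (1 + T))).comp h1
    exact h3
  have := isProbabilityMeasure_matrixNormalVar (m := m) (p := p) (a := 1 + T) (by positivity) 0
  have key := lintegral_withDensity_swap (μ := matrixLebesgue m p) (ν := matrixLebesgue m p)
    (f₁ := matrixDensity 1)
    (g₁ := fun Z X => matrixDensity (T / (1 + T)) (((T / (1 + T) : ℝ) : ℂ) • Z) X)
    (L := fun X Z => ENNReal.ofReal (loss (δ Z) X))
    (hm0 T) (hm 1) (hm0 (1 + T)) hsmul hl (fun X Z => matrixDensity_mul hT Z X)
  simp_rw [← matrixNormalVar_eq_withDensity] at key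
  simp_rw [risk, matrixNormal_eq]
  rw [key]
  calc (m * p * ENNReal.ofReal (T / (1 + T)) : ENNReal)
      = ∫⁻ _Z, m * p * ENNReal.ofReal (T / (1 + T)) ∂(matrixNormalVar (1 + T)
          (0 : Matrix (Fin m) (Fin p) ℂ)) := by simp
    _ ≤ _ := lintegral_mono fun Z => le_lintegral_loss (by positivity) _ _

/-- Let the variance of the prior tend to infinity in `le_bayes_risk`. -/
theorem le_iSup_risk {δ : Matrix (Fin m) (Fin p) ℂ → Matrix (Fin m) (Fin p) ℂ}
    (hδ : Measurable δ) : (m * p : ENNReal) ≤ ⨆ Ξ, risk δ Ξ := by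
  have h : ∀ T : ℝ, 0 < T → m * p * ENNReal.ofReal (T / (1 + T)) ≤ ⨆ Ξ, risk δ Ξ := by
    intro T hT
    have := isProbabilityMeasure_matrixNormalVar (m := m) (p := p) hT 0
    calc _ ≤ ∫⁻ X, risk δ X ∂(matrixNormalVar T 0) := le_bayes_risk hT hδ
      _ ≤ ∫⁻ _X, ⨆ Ξ, risk δ Ξ ∂(matrixNormalVar T (0 : Matrix (Fin m) (Fin p) ℂ)) :=
        lintegral_mono fun X => le_iSup _ X
      _ = _ := by simp
  have lim : Filter.Tendsto (fun T : ℝ => (m * p : ENNReal) * ENNReal.ofReal (T / (1 + T)))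
      Filter.atTop (nhds (m * p * ENNReal.ofReal 1)) := by
    refine ENNReal.Tendsto.const_mul (ENNReal.tendsto_ofReal ?_) (.inr ?_)
    · have h1 : Filter.Tendsto (fun T : ℝ => 1 - (1 + T)⁻¹) Filter.atTop (nhds (1 - 0)) :=
        tendsto_const_nhds.sub (tendsto_inv_atTop_zero.comp
          (Filter.tendsto_atTop_add_const_left _ _ Filter.tendsto_id))
      rw [sub_zero] at h1
      refine h1.congr' ?_
      filter_upwards [Filter.eventually_gt_atTop 0] with T hT
      have : 1 + T ≠ 0 := by positivity
      field_simp
      ring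
    · exact ENNReal.mul_ne_top (ENNReal.natCast_ne_top _) (ENNReal.natCast_ne_top _)
  rw [ENNReal.ofReal_one, mul_one] at lim
  refine le_of_tendsto lim ?_
  filter_upwards [Filter.eventually_gt_atTop 0] with T hT using h T hT

theorem isMinimax_of_risk_le {δ : Matrix (Fin m) (Fin p) ℂ → Matrix (Fin m) (Fin p) ℂ}
    (hδ : Measurable δ) (h : ∀ Ξ, risk δ Ξ ≤ m * p) : IsMinimax δ :=
  ⟨hδ, fun _ hδ' => (iSup_le h).trans (le_iSup_risk hδ')⟩

end Bayes

/-! ### The moment recursion and Gaussian moments -/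

/-- A recursion for the joint moments `Λ {a₁, …, aₙ}` of the power sums `p_{a₁} ⋯ p_{aₙ}` of `p`
nonnegative numbers. It expresses every moment through moments of lower total degree. -/
structure TraceRecursion (d p β : ℂ) (Λ : Multiset ℕ → ℂ) : Prop where
  zero_cons : ∀ L, Λ (0 ::ₘ L) = p * Λ L
  succ_cons : ∀ a L, β * Λ ((a + 1) ::ₘ L) = d * Λ (a ::ₘ L) +
    ∑ k ∈ Finset.range (a + 1), Λ (k ::ₘ (a - k) ::ₘ L) +
    (L.map fun b : ℕ => (b : ℂ) * Λ ((a + b) ::ₘ L.erase b)).sum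

/-- The recursion determines `Λ` up to the factor `Λ 0`, by induction on the total degree. -/
theorem TraceRecursion.eq_mul {d p β c : ℂ} (hβ : β ≠ 0) {Λ Λ' : Multiset ℕ → ℂ}
    (h : TraceRecursion d p β Λ) (h' : TraceRecursion d p β Λ') (h0 : Λ 0 = c * Λ' 0)
    (L : Multiset ℕ) : Λ L = c * Λ' L := by
  induction hn : L.sum using Nat.strong_induction_on generalizing L with
  | _ n ih =>
    by_cases hL : ∃ a, a + 1 ∈ L
    · obtain ⟨a, ha⟩ := hL
      obtain ⟨K, rfl⟩ := Multiset.exists_cons_of_mem ha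
      rw [Multiset.sum_cons] at hn
      refine mul_left_cancel₀ hβ ?_
      rw [h.succ_cons, mul_left_comm, h'.succ_cons, mul_add, mul_add, Finset.mul_sum,
        ← Multiset.sum_map_mul_left]
      congr 1
      · congr 1
        · rw [ih (a + K.sum) (by omega) _ (by simp), mul_left_comm]
        · refine Finset.sum_congr rfl fun k hk => ih (a + K.sum) (by omega) _ ?_
          have := Finset.mem_range.1 hk
          rw [Multiset.sum_cons, Multiset.sum_cons]
          omega
      · congr 1
        refine Multiset.map_congr rfl fun b hb => ?_
        have e : b + (K.erase b).sum = K.sum := Multiset.sum_erase hb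
        rw [ih (a + K.sum) (by omega) _ (by rw [Multiset.sum_cons]; omega), mul_left_comm]
    · push Not at hL
      have hz : ∀ b ∈ L, b = 0 := fun b hb => by
        rcases b with _ | b
        · rfl
        · exact absurd hb (hL b)
      rw [Multiset.eq_replicate_card.2 hz]
      induction L.card with
      | zero => simpa using h0
      | succ k ihk =>
        rw [Multiset.replicate_succ, h.zero_cons, h'.zero_cons, ihk, mul_left_comm]

/-- A function that is not integrable would have integral `0`, whereas the integral is positive. -/
theorem integrable_norm_pow_gaussian {β : ℝ} (hβ : 0 < β) (k : ℕ) :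
    Integrable fun z : ℂ => ‖z‖ ^ k * Real.exp (-β * ‖z‖ ^ 2) := by
  by_contra hni
  have h := Complex.integral_rpow_mul_exp_neg_mul_rpow (p := 2) (q := k) (b := β) (by norm_num)
    (by linarith [k.cast_nonneg (α := ℝ)]) hβ
  simp only [Real.rpow_natCast, Real.rpow_two] at h
  rw [integral_undef hni] at h
  have : 0 < (2 * Real.pi / 2) * β ^ (-(k + 2 : ℝ) / 2) * Real.Gamma ((k + 2) / 2) :=
    mul_pos (mul_pos (by positivity) (Real.rpow_pos_of_pos hβ _))
      (Real.Gamma_pos_of_pos (by positivity))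
  exact this.ne h

theorem integrable_pow_mul_conj_pow_gaussian {β : ℝ} (hβ : 0 < β) (a b : ℕ) :
    Integrable fun z : ℂ => z ^ a * (starRingEnd ℂ z) ^ b * (Real.exp (-β * ‖z‖ ^ 2) : ℂ) := by
  refine (integrable_norm_pow_gaussian hβ (a + b)).mono' ?_ (.of_forall fun z => ?_)
  · refine Continuous.aestronglyMeasurable ?_
    fun_prop
  · rw [norm_mul, norm_mul, norm_pow, norm_pow, RCLike.norm_conj, Complex.norm_real,
      Real.norm_of_nonneg (Real.exp_pos _).le, pow_add]

/-- Moments of the complex normal distribution; the off-diagonal ones vanish by rotation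
invariance. -/
theorem integral_pow_mul_conj_pow_gaussian {β : ℝ} (hβ : 0 < β) (a b : ℕ) :
    ∫ z : ℂ, z ^ a * (starRingEnd ℂ z) ^ b * (Real.exp (-β * ‖z‖ ^ 2) : ℂ) =
      if a = b then (Real.pi * (β ^ (a + 1))⁻¹ * a.factorial : ℂ) else 0 := by
  split_ifs with hab
  · subst hab
    have h := Complex.integral_rpow_mul_exp_neg_mul_rpow (p := 2) (q := (2 * a : ℕ)) (b := β)
      (by norm_num) (by linarith [(2 * a).cast_nonneg (α := ℝ)]) hβ
    simp only [Real.rpow_natCast, Real.rpow_two] at h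
    have e : ∀ z : ℂ, z ^ a * (starRingEnd ℂ z) ^ a * (Real.exp (-β * ‖z‖ ^ 2) : ℂ) =
        ((‖z‖ ^ (2 * a) * Real.exp (-β * ‖z‖ ^ 2) : ℝ) : ℂ) := by
      intro z
      rw [← mul_pow, Complex.mul_conj, Complex.normSq_eq_norm_sq]
      push_cast
      rw [pow_mul]
    simp_rw [e]
    rw [integral_complex_ofReal, h]
    have e1 : (((2 * a : ℕ) : ℝ) + 2) / 2 = (a : ℝ) + 1 := by push_cast; ring
    have e2 : -(((2 * a : ℕ) : ℝ) + 2) / 2 = -((a + 1 : ℕ) : ℝ) := by push_cast; ring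
    rw [e1, e2, Real.Gamma_nat_eq_factorial, Real.rpow_neg hβ.le, Real.rpow_natCast]
    push_cast
    ring
  · -- a rotation under which the integrand changes sign
    set n : ℤ := (a : ℤ) - b with hn
    have hn0 : (n : ℂ) ≠ 0 := by
      rw [Int.cast_ne_zero]; omega
    set c : ℂ := Complex.exp (Real.pi * Complex.I / n) with hc
    have hcn : c ^ n = -1 := by
      rw [hc, ← Complex.exp_int_mul, mul_div_cancel₀ _ hn0, Complex.exp_pi_mul_I]
    have hnorm : ‖c‖ = 1 := by
      have : (Real.pi * Complex.I / n : ℂ) = ((Real.pi / n : ℝ) : ℂ) * Complex.I := by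
        push_cast; ring
      rw [hc, this, Complex.norm_exp_ofReal_mul_I]
    have hc0 : c ≠ 0 := Complex.exp_ne_zero _
    have hconj : starRingEnd ℂ c = c⁻¹ := by
      rw [Complex.inv_def, Complex.normSq_eq_norm_sq, hnorm]; simp
    have hcc : c ^ a * (starRingEnd ℂ c) ^ b = -1 := by
      rw [hconj, ← hcn, hn, zpow_sub₀ hc0, zpow_natCast, zpow_natCast, inv_pow, div_eq_mul_inv]
    have hmp := (rotation ⟨c, by simp [Submonoid.unitSphere, hnorm]⟩).measurePreserving
    have h := hmp.integral_comp
      (rotation ⟨c, by simp [Submonoid.unitSphere, hnorm]⟩).toHomeomorph.measurableEmbedding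
      (fun z : ℂ => z ^ a * (starRingEnd ℂ z) ^ b * (Real.exp (-β * ‖z‖ ^ 2) : ℂ))
    have e : ∀ z : ℂ, (c * z) ^ a * (starRingEnd ℂ (c * z)) ^ b *
        (Real.exp (-β * ‖c * z‖ ^ 2) : ℂ) =
        -(z ^ a * (starRingEnd ℂ z) ^ b * (Real.exp (-β * ‖z‖ ^ 2) : ℂ)) := by
      intro z
      rw [norm_mul, hnorm, one_mul, map_mul, mul_pow, mul_pow, mul_mul_mul_comm, hcc]
      ring
    have h' := (integral_congr_ae (.of_forall e)).symm.trans h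
    rw [integral_neg] at h'
    exact self_eq_neg.1 h'.symm

/-- One-dimensional complex Stein identity for monomials. -/
theorem stein_monomial {β : ℝ} (hβ : 0 < β) (a b : ℕ) :
    β * ∫ z : ℂ, z ^ a * (starRingEnd ℂ z) ^ (b + 1) * (Real.exp (-β * ‖z‖ ^ 2) : ℂ) =
      a * ∫ z : ℂ, z ^ (a - 1) * (starRingEnd ℂ z) ^ b * (Real.exp (-β * ‖z‖ ^ 2) : ℂ) := by
  rw [integral_pow_mul_conj_pow_gaussian hβ, integral_pow_mul_conj_pow_gaussian hβ]
  have : (β : ℂ) ≠ 0 := by exact_mod_cast hβ.ne'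
  rcases a with _ | a
  · simp
  · simp only [Nat.add_right_cancel_iff, Nat.add_sub_cancel]
    split_ifs with h
    · rw [Nat.factorial_succ]
      push_cast
      field_simp
      ring
    · simp

/-! ### Stein's identity for polynomials in the entries -/

/-- The variables `z_{ij}` (left summand) and their formal conjugates (right summand). -/
abbrev EntryVar (m p : ℕ) := (Fin m × Fin p) ⊕ (Fin m × Fin p)

section EntryMoments
variable {m p : ℕ}

/-- The value of a polynomial in the entries and their conjugates at a matrix. -/
def evalEntries (z : Fin m → Fin p → ℂ) : MvPolynomial (EntryVar m p) ℂ →+* ℂ :=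
  MvPolynomial.eval (Sum.elim (fun q => z q.1 q.2) fun q => starRingEnd ℂ (z q.1 q.2))

/-- The unnormalised Gaussian weight `exp (-β ∑ |z_{ij}|²)`. -/
def entryWeight (β : ℝ) (z : Fin m → Fin p → ℂ) : ℂ :=
  ∏ i, ∏ j, (Real.exp (-β * ‖z i j‖ ^ 2) : ℂ)

theorem evalEntries_monomial_mul_weight (β : ℝ) (s : EntryVar m p →₀ ℕ) (z : Fin m → Fin p → ℂ) :
    evalEntries z (MvPolynomial.monomial s 1) * entryWeight β z =
      ∏ i, ∏ j, (z i j ^ s (.inl (i, j)) * (starRingEnd ℂ (z i j)) ^ s (.inr (i, j)) *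
        (Real.exp (-β * ‖z i j‖ ^ 2) : ℂ)) := by
  rw [evalEntries, MvPolynomial.eval_monomial, one_mul, Finsupp.prod_fintype _ _ (by simp),
    Fintype.prod_sum_type, Fintype.prod_prod_type, Fintype.prod_prod_type, entryWeight]
  simp only [Sum.elim_inl, Sum.elim_inr, Finset.prod_mul_distrib]

theorem integrable_evalEntries {β : ℝ} (hβ : 0 < β) (P : MvPolynomial (EntryVar m p) ℂ) :
    Integrable fun z : Fin m → Fin p → ℂ => evalEntries z P * entryWeight β z := by
  induction P using MvPolynomial.induction_on' with
  | monomial s c =>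
    have h : Integrable fun z : Fin m → Fin p → ℂ =>
        evalEntries z (MvPolynomial.monomial s 1) * entryWeight β z := by
      simp_rw [evalEntries_monomial_mul_weight]
      exact Integrable.fintype_prod (f := fun i (y : Fin p → ℂ) =>
          ∏ j, (y j ^ s (.inl (i, j)) * (starRingEnd ℂ (y j)) ^ s (.inr (i, j)) *
            (Real.exp (-β * ‖y j‖ ^ 2) : ℂ))) fun i =>
        Integrable.fintype_prod (f := fun j (y : ℂ) => y ^ s (.inl (i, j)) *
          (starRingEnd ℂ y) ^ s (.inr (i, j)) * (Real.exp (-β * ‖y‖ ^ 2) : ℂ)) fun j =>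
          integrable_pow_mul_conj_pow_gaussian hβ _ _
    have e : MvPolynomial.monomial s c = MvPolynomial.C c * MvPolynomial.monomial s 1 := by
      rw [MvPolynomial.C_mul_monomial, mul_one]
    refine (h.const_mul c).congr (.of_forall fun z => ?_)
    simp only [e, map_mul]
    rw [mul_assoc]
    congr 1
    simp [evalEntries]
  | add P Q hP hQ =>
    refine (hP.add hQ).congr (.of_forall fun z => ?_)
    simp [add_mul]

/-- The Gaussian integral of a polynomial in the entries and their conjugates. -/
def entryMoment (m p : ℕ) (β : ℝ) (P : MvPolynomial (EntryVar m p) ℂ) : ℂ :=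
  ∫ z : Fin m → Fin p → ℂ, evalEntries z P * entryWeight β z

theorem entryMoment_add {β : ℝ} (hβ : 0 < β) (P Q : MvPolynomial (EntryVar m p) ℂ) :
    entryMoment m p β (P + Q) = entryMoment m p β P + entryMoment m p β Q := by
  unfold entryMoment
  rw [← integral_add (integrable_evalEntries hβ P) (integrable_evalEntries hβ Q)]
  simp only [map_add, add_mul]

theorem entryMoment_C_mul {β : ℝ} (c : ℂ) (P : MvPolynomial (EntryVar m p) ℂ) :
    entryMoment m p β (MvPolynomial.C c * P) = c * entryMoment m p β P := by
  unfold entryMoment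
  rw [← integral_const_mul]
  congr 1 with z
  rw [map_mul, mul_assoc]
  simp [evalEntries]

theorem entryMoment_natCast_mul {β : ℝ} (c : ℕ) (P : MvPolynomial (EntryVar m p) ℂ) :
    entryMoment m p β (c * P) = c * entryMoment m p β P := by
  rw [← entryMoment_C_mul]; simp

theorem entryMoment_zero {β : ℝ} : entryMoment m p β 0 = 0 := by simp [entryMoment]

theorem entryMoment_sum {ι : Type*} {β : ℝ} (hβ : 0 < β) (s : Finset ι)
    (f : ι → MvPolynomial (EntryVar m p) ℂ) :
    entryMoment m p β (∑ i ∈ s, f i) = ∑ i ∈ s, entryMoment m p β (f i) :=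
  map_sum (⟨⟨entryMoment m p β, entryMoment_zero⟩, entryMoment_add hβ⟩ :
    MvPolynomial (EntryVar m p) ℂ →+ ℂ) f s

theorem entryMoment_multiset_sum {β : ℝ} (hβ : 0 < β)
    (s : Multiset (MvPolynomial (EntryVar m p) ℂ)) :
    entryMoment m p β s.sum = (s.map (entryMoment m p β)).sum :=
  map_multiset_sum (⟨⟨entryMoment m p β, entryMoment_zero⟩, entryMoment_add hβ⟩ :
    MvPolynomial (EntryVar m p) ℂ →+ ℂ) s

theorem entryMoment_monomial (β : ℝ) (s : EntryVar m p →₀ ℕ) :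
    entryMoment m p β (MvPolynomial.monomial s 1) =
      ∏ q : Fin m × Fin p, ∫ z : ℂ, z ^ s (.inl q) * (starRingEnd ℂ z) ^ s (.inr q) *
        (Real.exp (-β * ‖z‖ ^ 2) : ℂ) := by
  unfold entryMoment
  simp_rw [evalEntries_monomial_mul_weight]
  rw [Fintype.prod_prod_type]
  refine (integral_fintype_prod_volume_eq_prod (fun i (y : Fin p → ℂ) =>
    ∏ j, (y j ^ s (.inl (i, j)) * (starRingEnd ℂ (y j)) ^ s (.inr (i, j)) *
            (Real.exp (-β * ‖y j‖ ^ 2) : ℂ)))).trans (Finset.prod_congr rfl fun i _ => ?_)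
  exact integral_fintype_prod_volume_eq_prod (fun j (y : ℂ) => y ^ s (.inl (i, j)) *
          (starRingEnd ℂ y) ^ s (.inr (i, j)) * (Real.exp (-β * ‖y‖ ^ 2) : ℂ))

/-- Stein's identity: multiplication by `conj z_{ij}` is adjoint to the holomorphic derivative. -/
theorem stein_identity {β : ℝ} (hβ : 0 < β) (q : Fin m × Fin p)
    (P : MvPolynomial (EntryVar m p) ℂ) :
    β * entryMoment m p β (MvPolynomial.X (.inr q) * P) =
      entryMoment m p β (MvPolynomial.pderiv (.inl q) P) := by
  induction P using MvPolynomial.induction_on' with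
  | monomial s c =>
    have e : MvPolynomial.monomial s c = MvPolynomial.C c * MvPolynomial.monomial s 1 := by
      rw [MvPolynomial.C_mul_monomial, mul_one]
    have e1 : MvPolynomial.X (R := ℂ) (.inr q) * MvPolynomial.monomial s 1 =
        MvPolynomial.monomial (Finsupp.single (.inr q) 1 + s) 1 := by
      rw [MvPolynomial.X, MvPolynomial.monomial_mul, one_mul]
    have e2 : MvPolynomial.pderiv (.inl q) (MvPolynomial.monomial s (1 : ℂ)) =
        MvPolynomial.C (s (.inl q) : ℂ) *
          MvPolynomial.monomial (s - Finsupp.single (.inl q) 1) 1 := by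
      rw [MvPolynomial.pderiv_monomial, MvPolynomial.C_mul_monomial, one_mul, mul_one]
    rw [e, mul_left_comm, e1, MvPolynomial.pderiv_C_mul, e2,
      entryMoment_C_mul, entryMoment_C_mul, entryMoment_C_mul, mul_left_comm]
    congr 1
    rw [entryMoment_monomial, entryMoment_monomial, ← Finset.mul_prod_erase _ _ (Finset.mem_univ q),
      ← Finset.mul_prod_erase _ _ (Finset.mem_univ q), ← mul_assoc, ← mul_assoc]
    congr 1
    · have h := stein_monomial hβ (s (.inl q)) (s (.inr q))
      simpa [add_comm] using h
    · refine Finset.prod_congr rfl fun r hr => ?_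
      have hr' : q ≠ r := (Finset.ne_of_mem_erase hr).symm
      simp [hr']
  | add P Q hP hQ => rw [mul_add, entryMoment_add hβ, mul_add, hP, hQ, map_add, entryMoment_add hβ]

end EntryMoments

/-! ### The recursion for the traces of a Gaussian matrix -/

section Derivation
variable {R A : Type*} [CommRing R] [CommRing A] [Algebra R A] (D : Derivation R A A)
variable {k l n : Type*} [Fintype l]

theorem map_derivation_mul (M : Matrix k l A) (N : Matrix l n A) :
    (M * N).map D = M.map D * N + M * N.map D := by
  ext i j
  simp only [map_apply, mul_apply, map_sum, D.leibniz, smul_eq_mul, Matrix.add_apply,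
    Finset.sum_add_distrib]
  rw [add_comm]
  congr 1
  exact Finset.sum_congr rfl fun x _ => mul_comm _ _

theorem map_derivation_pow [Fintype n] [DecidableEq n] (M : Matrix n n A) (a : ℕ) :
    (M ^ a).map D = ∑ r ∈ Finset.range a, M ^ r * M.map D * M ^ (a - 1 - r) := by
  induction a with
  | zero =>
    ext i j
    by_cases h : i = j <;> simp [h]
  | succ a ih =>
    rw [pow_succ, map_derivation_mul, ih, Finset.sum_range_succ, Finset.sum_mul]
    congr 1
    · refine Finset.sum_congr rfl fun r hr => ?_
      have : a + 1 - 1 - r = a - 1 - r + 1 := by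
        have := Finset.mem_range.1 hr; omega
      rw [this, pow_succ]
      simp only [Matrix.mul_assoc]
    · simp

/-- The Leibniz rule for a product over a multiset; `L.erase b` removes one occurrence of `b`. -/
theorem derivation_multiset_prod (t d : ℕ → A) (h : ∀ b, D (t b) = d b) (L : Multiset ℕ) :
    D (L.map t).prod = (L.map fun b => d b * ((L.erase b).map t).prod).sum := by
  induction L using Multiset.induction_on with
  | empty => simp
  | cons a L ih =>
    rw [Multiset.map_cons, Multiset.prod_cons, D.leibniz, ih, h, Multiset.map_cons,
      Multiset.sum_cons, Multiset.erase_cons_head, smul_eq_mul, smul_eq_mul, mul_comm (d a),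
      add_comm, mul_comm _ (d a), ← Multiset.sum_map_mul_left]
    congr 2
    refine Multiset.map_congr rfl fun b hb => ?_
    by_cases hba : b = a
    · subst hba
      rw [Multiset.erase_cons_head, mul_left_comm]
      congr 1
      rw [← Multiset.prod_cons, ← Multiset.map_cons, Multiset.cons_erase hb]
    · rw [Multiset.erase_cons_tail _ (Ne.symm hba), Multiset.map_cons, Multiset.prod_cons]
      ring

end Derivation

section Traces
variable {m p : ℕ}

/-- The generic matrix `Z`. -/
def genZ (m p : ℕ) : Matrix (Fin m) (Fin p) (MvPolynomial (EntryVar m p) ℂ) :=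
  of fun i j => MvPolynomial.X (.inl (i, j))

/-- The generic matrix `Z*`. -/
def genZs (m p : ℕ) : Matrix (Fin p) (Fin m) (MvPolynomial (EntryVar m p) ℂ) :=
  of fun j i => MvPolynomial.X (.inr (i, j))

/-- The generic matrix `Z* Z`. -/
def genW (m p : ℕ) : Matrix (Fin p) (Fin p) (MvPolynomial (EntryVar m p) ℂ) := genZs m p * genZ m p

/-- The generic trace `tr (Z* Z)ᵃ`. -/
def genTrace (m p : ℕ) (a : ℕ) : MvPolynomial (EntryVar m p) ℂ := (genW m p ^ a).trace

/-- The holomorphic partial derivative with respect to `z_{ij}`. -/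
def entryDeriv (i : Fin m) (j : Fin p) :
    Derivation ℂ (MvPolynomial (EntryVar m p) ℂ) (MvPolynomial (EntryVar m p) ℂ) :=
  MvPolynomial.pderiv (.inl (i, j))

/-- The matrix unit at `(i, j)`, as a matrix of polynomials. -/
abbrev genUnit (i : Fin m) (j : Fin p) : Matrix (Fin m) (Fin p) (MvPolynomial (EntryVar m p) ℂ) :=
  single i j 1

theorem genZ_map_entryDeriv (i : Fin m) (j : Fin p) :
    (genZ m p).map (entryDeriv i j) = genUnit i j := by
  ext k l
  simp only [genZ, entryDeriv, map_apply, of_apply, MvPolynomial.pderiv_X, single_apply,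
    Pi.single_apply, Sum.inl.injEq, Prod.mk.injEq]
  simp only [eq_comm]

theorem genZs_map_entryDeriv (i : Fin m) (j : Fin p) :
    (genZs m p).map (entryDeriv i j) = 0 := by
  ext k l
  simp [genZs, entryDeriv, MvPolynomial.pderiv_X]

theorem genW_map_entryDeriv (i : Fin m) (j : Fin p) :
    (genW m p).map (entryDeriv i j) = genZs m p * genUnit i j := by
  rw [genW, map_derivation_mul, genZ_map_entryDeriv, genZs_map_entryDeriv, Matrix.zero_mul, zero_add]

/-- The divergence of the vector field `Z (Z* Z)ᵃ`. -/
theorem sum_entryDeriv_mul_pow (a : ℕ) :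
    ∑ i, ∑ j, entryDeriv i j ((genZ m p * genW m p ^ a) i j) =
      m * genTrace m p a + ∑ r ∈ Finset.range a, genTrace m p (r + 1) * genTrace m p (a - 1 - r) := by
  have key : ∀ (B : Matrix (Fin m) (Fin m) (MvPolynomial (EntryVar m p) ℂ))
      (C : Matrix (Fin p) (Fin p) (MvPolynomial (EntryVar m p) ℂ)),
      ∑ i : Fin m, ∑ j : Fin p, (B * genUnit i j * C) i j = B.trace * C.trace := by
    intro B C
    have : ∀ (i : Fin m) (j : Fin p), (B * genUnit i j * C) i j = B i i * C j j := by
      intro i j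
      rw [Matrix.mul_assoc, mul_apply, Finset.sum_eq_single i]
      · simp [single_mul_apply_same]
      · intro k _ hk
        rw [single_mul_apply_of_ne _ _ _ _ _ hk, mul_zero]
      · simp
    simp_rw [this, trace, diag_apply, Finset.sum_mul_sum]
  have e : ∀ (i : Fin m) (j : Fin p), entryDeriv i j ((genZ m p * genW m p ^ a) i j) =
      ((1 : Matrix (Fin m) (Fin m) (MvPolynomial (EntryVar m p) ℂ)) * genUnit i j *
        genW m p ^ a) i j + ∑ r ∈ Finset.range a,
        ((genZ m p * genW m p ^ r * genZs m p) * genUnit i j * genW m p ^ (a - 1 - r)) i j := by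
    intro i j
    have h := congrFun (congrFun (map_derivation_mul (entryDeriv i j) (genZ m p) (genW m p ^ a)) i) j
    rw [map_apply] at h
    rw [h, genZ_map_entryDeriv, map_derivation_pow, genW_map_entryDeriv, Matrix.one_mul,
      Matrix.mul_sum, Matrix.add_apply, Matrix.sum_apply]
    simp only [Matrix.mul_assoc]
  have t1 : ∀ r, (genZ m p * genW m p ^ r * genZs m p).trace = genTrace m p (r + 1) := by
    intro r
    rw [trace_mul_comm, ← Matrix.mul_assoc, ← genW, ← pow_succ', genTrace]
  simp_rw [e, Finset.sum_add_distrib]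
  congr 1
  · rw [key, trace_one, Fintype.card_fin, genTrace]
  · simp_rw [Finset.sum_comm (t := Finset.range a)]
    exact Finset.sum_congr rfl fun r _ => by rw [key, t1]; rfl

/-- The vector field `Z (Z* Z)ᵃ`, as a derivation. -/
def powField (m p a : ℕ) :
    Derivation ℂ (MvPolynomial (EntryVar m p) ℂ) (MvPolynomial (EntryVar m p) ℂ) :=
  ∑ i, ∑ j, (genZ m p * genW m p ^ a) i j • entryDeriv i j

theorem powField_apply (a : ℕ) (P : MvPolynomial (EntryVar m p) ℂ) :
    powField m p a P = ∑ i, ∑ j, (genZ m p * genW m p ^ a) i j * entryDeriv i j P := by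
  have h : powField m p a P = (Derivation.coeFnAddMonoidHom (powField m p a)) P := rfl
  rw [h, powField]
  simp [map_sum, Finset.sum_apply, Derivation.coeFnAddMonoidHom_apply]

/-- Along the vector field `Z (Z* Z)ᵃ` the Gram matrix `W` has derivative `W ^ (a + 1)`. -/
theorem powField_genTrace (a b : ℕ) :
    powField m p a (genTrace m p b) = b * genTrace m p (a + b) := by
  have hZ : (genZ m p).map (powField m p a) = genZ m p * genW m p ^ a := by
    ext1 k l
    rw [map_apply, powField_apply]
    have : ∀ i j, entryDeriv i j (genZ m p k l) =
        genUnit i j k l := fun i j =>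
      congrFun (congrFun (genZ_map_entryDeriv i j) k) l
    simp only [this, single_apply]
    simp [ite_and]
  have hZs : (genZs m p).map (powField m p a) = 0 := by
    ext1 k l
    rw [map_apply, powField_apply]
    have : ∀ i j, entryDeriv i j (genZs m p k l) = 0 := fun i j =>
      congrFun (congrFun (genZs_map_entryDeriv i j) k) l
    simp [this]
  have hW : (genW m p).map (powField m p a) = genW m p ^ (a + 1) := by
    rw [genW, map_derivation_mul, hZ, hZs, Matrix.zero_mul, zero_add, ← Matrix.mul_assoc, ← genW,
      pow_succ']
  have h : powField m p a (genTrace m p b) = ((genW m p ^ b).map (powField m p a)).trace := by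
    simp [genTrace, trace, map_sum]
  rw [h, map_derivation_pow, hW, trace_sum]
  have : ∀ r ∈ Finset.range b, (genW m p ^ r * genW m p ^ (a + 1) * genW m p ^ (b - 1 - r)).trace =
      genTrace m p (a + b) := by
    intro r hr
    have := Finset.mem_range.1 hr
    rw [← pow_add, ← pow_add, genTrace]
    congr 2
    omega
  rw [Finset.sum_congr rfl this, Finset.sum_const, Finset.card_range, nsmul_eq_mul]

theorem genTrace_zero : genTrace m p 0 = p := by
  simp [genTrace, trace_one]

theorem genTrace_succ (a : ℕ) : genTrace m p (a + 1) =
    ∑ i, ∑ j, MvPolynomial.X (.inr (i, j)) * (genZ m p * genW m p ^ a) i j := by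
  rw [genTrace, pow_succ', genW, Matrix.mul_assoc, ← genW, trace, Finset.sum_comm]
  simp [mul_apply, genZs]

/-- Stein's identity, applied to `tr Wᵃ⁺¹ · s = ∑ conj z_{ij} (Z Wᵃ)_{ij} s` with `W = Z* Z` and `s` a
product of traces. The term `r = 0` of the recursion carries `tr 1 = p`, whence the coefficient
`m - p` in place of `m`. -/
theorem traceRecursion_entryMoment {β : ℝ} (hβ : 0 < β) :
    TraceRecursion ((m : ℂ) - p) p β fun L => entryMoment m p β (L.map (genTrace m p)).prod where
  zero_cons L := by
    rw [Multiset.map_cons, Multiset.prod_cons, genTrace_zero, entryMoment_natCast_mul]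
  succ_cons a L := by
    set s := (L.map (genTrace m p)).prod with hs
    have h1 : entryMoment m p β (genTrace m p (a + 1) * s) = ∑ i, ∑ j,
        entryMoment m p β (MvPolynomial.X (.inr (i, j)) * ((genZ m p * genW m p ^ a) i j * s)) := by
      rw [genTrace_succ, Finset.sum_mul, entryMoment_sum hβ]
      refine Finset.sum_congr rfl fun i _ => ?_
      rw [Finset.sum_mul, entryMoment_sum hβ]
      simp only [mul_assoc]
    have h2 : ∑ i, ∑ j, entryDeriv i j ((genZ m p * genW m p ^ a) i j * s) =
        s * ∑ i, ∑ j, entryDeriv i j ((genZ m p * genW m p ^ a) i j) + powField m p a s := by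
      rw [powField_apply, Finset.mul_sum, ← Finset.sum_add_distrib]
      refine Finset.sum_congr rfl fun i _ => ?_
      rw [Finset.mul_sum, ← Finset.sum_add_distrib]
      refine Finset.sum_congr rfl fun j _ => ?_
      rw [Derivation.leibniz, smul_eq_mul, smul_eq_mul, add_comm]
    have h3 : β * entryMoment m p β (genTrace m p (a + 1) * s) =
        entryMoment m p β (s * ∑ i, ∑ j, entryDeriv i j ((genZ m p * genW m p ^ a) i j) +
          powField m p a s) := by
      rw [h1, ← h2, Finset.mul_sum, entryMoment_sum hβ]
      refine Finset.sum_congr rfl fun i _ => ?_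
      rw [Finset.mul_sum, entryMoment_sum hβ]
      exact Finset.sum_congr rfl fun j _ => stein_identity hβ _ _
    simp only [Multiset.map_cons, Multiset.prod_cons, ← hs]
    rw [h3, entryMoment_add hβ, hs, derivation_multiset_prod (powField m p a) (genTrace m p)
      (fun b => b * genTrace m p (a + b)) (powField_genTrace a), ← hs, sum_entryDeriv_mul_pow,
      entryMoment_multiset_sum hβ, Multiset.map_map]
    congr 1
    · rw [Finset.sum_range_succ', Nat.sub_zero, mul_add, entryMoment_add hβ, mul_left_comm,
        entryMoment_natCast_mul, genTrace_zero, entryMoment_natCast_mul, mul_comm s, Finset.mul_sum,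
        entryMoment_sum hβ]
      have : ∀ r ∈ Finset.range a, entryMoment m p β (s * (genTrace m p (r + 1) *
          genTrace m p (a - 1 - r))) = entryMoment m p β (genTrace m p (r + 1) *
            (genTrace m p (a - (r + 1)) * s)) := by
        intro r _
        rw [Nat.sub_sub, add_comm 1 r]
        congr 1
        ring
      rw [Finset.sum_congr rfl this]
      ring
    · congr 1
      refine Multiset.map_congr rfl fun b _ => ?_
      simp only [Function.comp]
      rw [mul_assoc, entryMoment_natCast_mul]

end Traces

/-! ### Integration by parts on the ordered cone -/

section OneDim
variable {g g' : ℝ → ℝ}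

/-- The fundamental theorem of calculus on an interval `J` of any kind that is bounded below; an
integrable primitive vanishes at infinity. -/
theorem setIntegral_deriv_of_ordConnected (hd : ∀ t, HasDerivAt g (g' t) t) (hg : Integrable g)
    (hg' : Integrable g') {J : Set ℝ} (hJ : J.OrdConnected) (hne : J.Nonempty) (hb : BddBelow J) :
    (BddAbove J → ∫ t in J, g' t = g (sSup J) - g (sInf J)) ∧
      (¬ BddAbove J → ∫ t in J, g' t = - g (sInf J)) := by
  constructor
  · intro ha
    have hle : sInf J ≤ sSup J := Real.sInf_le_sSup J hb ha
    have e : J =ᵐ[volume] Set.Ioc (sInf J) (sSup J) := by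
      refine Filter.EventuallyLE.antisymm ?_ ?_
      · have : J ≤ Set.Icc (sInf J) (sSup J) := fun x hx => ⟨csInf_le hb hx, le_csSup ha hx⟩
        exact this.eventuallyLE.trans Ioc_ae_eq_Icc.symm.le
      · have : Set.Ioo (sInf J) (sSup J) ≤ J := fun x hx => by
          obtain ⟨a, haJ, hax⟩ := exists_lt_of_csInf_lt hne hx.1
          obtain ⟨b, hbJ, hxb⟩ := exists_lt_of_lt_csSup hne hx.2
          exact hJ.out haJ hbJ ⟨hax.le, hxb.le⟩
        exact Ioo_ae_eq_Ioc.symm.le.trans this.eventuallyLE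
    rw [setIntegral_congr_set e, ← intervalIntegral.integral_of_le hle]
    exact intervalIntegral.integral_eq_sub_of_hasDerivAt (fun t _ => hd t)
      hg'.intervalIntegrable
  · intro ha
    have e : J =ᵐ[volume] Set.Ioi (sInf J) := by
      refine Filter.EventuallyLE.antisymm ?_ ?_
      · have : J ≤ Set.Ici (sInf J) := fun x hx => csInf_le hb hx
        exact this.eventuallyLE.trans Ioi_ae_eq_Ici.symm.le
      · have : Set.Ioi (sInf J) ≤ J := hJ.isPreconnected.Ioi_csInf_subset hb ha
        exact this.eventuallyLE
    have lim := tendsto_zero_of_hasDerivAt_of_integrableOn_Ioi (a := sInf J)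
      (fun t _ => hd t) hg'.integrableOn hg.integrableOn
    rw [setIntegral_congr_set e, integral_Ioi_of_hasDerivAt_of_tendsto' (fun t _ => hd t)
      hg'.integrableOn lim, zero_sub]

theorem csInf_mem_frontier {S : Set ℝ} (hSo : IsOpen S) (hne : S.Nonempty) (hb : BddBelow S) :
    sInf S ∈ frontier S := by
  refine ⟨csInf_mem_closure hne hb, fun hm => ?_⟩
  rw [hSo.interior_eq] at hm
  obtain ⟨y, hy, hyS⟩ := Filter.Eventually.exists_lt (hSo.mem_nhds hm)
  exact (csInf_le hb hyS).not_gt hy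

theorem csSup_mem_frontier {S : Set ℝ} (hSo : IsOpen S) (hne : S.Nonempty) (hb : BddAbove S) :
    sSup S ∈ frontier S := by
  refine ⟨csSup_mem_closure hne hb, fun hm => ?_⟩
  rw [hSo.interior_eq] at hm
  obtain ⟨y, hy, hyS⟩ := Filter.Eventually.exists_gt (hSo.mem_nhds hm)
  exact (le_csSup hb hyS).not_gt hy

theorem setIntegral_deriv_eq_zero (hd : ∀ t, HasDerivAt g (g' t) t) (hg : Integrable g)
    (hg' : Integrable g') {S : Set ℝ} (hS : S.OrdConnected) (hSo : IsOpen S) (hb : BddBelow S)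
    (h0 : ∀ t ∈ frontier S, g t = 0) : ∫ t in S, g' t = 0 := by
  rcases S.eq_empty_or_nonempty with rfl | hne
  · simp
  have h := setIntegral_deriv_of_ordConnected hd hg hg' hS hne hb
  have hinf : g (sInf S) = 0 := h0 _ (csInf_mem_frontier hSo hne hb)
  by_cases ha : BddAbove S
  · rw [h.1 ha, hinf, h0 _ (csSup_mem_frontier hSo hne ha), sub_zero]
  · rw [h.2 ha, hinf, neg_zero]

/-- The set `J` is an interval with the same right end as `S`, so the integral is `- g` at its left
end. -/
theorem setIntegral_deriv_upper_nonpos (hd : ∀ t, HasDerivAt g (g' t) t) (hg : Integrable g)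
    (hg' : Integrable g') {S : Set ℝ} (hS : S.OrdConnected) (hSo : IsOpen S) (hb : BddBelow S)
    (h0 : ∀ t ∈ frontier S, g t = 0) (hpos : ∀ t ∈ S, 0 ≤ g t) {J : Set ℝ} (hJS : J ⊆ S)
    (hJ : ∀ x ∈ J, ∀ y ∈ S, x ≤ y → y ∈ J) : ∫ t in J, g' t ≤ 0 := by
  rcases J.eq_empty_or_nonempty with rfl | hne
  · simp
  have hJc : J.OrdConnected := ⟨fun x hx y hy z hz =>
    hJ x hx z (hS.out (hJS hx) (hJS hy) hz) hz.1⟩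
  have hc : Continuous g := continuous_iff_continuousAt.2 fun t => (hd t).continuousAt
  have hbJ : BddBelow J := hb.mono hJS
  have h := setIntegral_deriv_of_ordConnected hd hg hg' hJc hne hbJ
  have hinf : 0 ≤ g (sInf J) := by
    have : closure S ⊆ {t | 0 ≤ g t} :=
      closure_minimal hpos (isClosed_le continuous_const hc)
    exact this (closure_mono hJS (csInf_mem_closure hne hbJ))
  obtain ⟨x, hx⟩ := hne
  by_cases ha : BddAbove J
  · have haS : BddAbove S := by
      obtain ⟨b, hbd⟩ := ha
      refine ⟨b, fun y hy => ?_⟩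
      rcases le_total x y with hxy | hxy
      · exact hbd (hJ x hx y hy hxy)
      · exact hxy.trans (hbd hx)
    have e : sSup J = sSup S := by
      refine le_antisymm (csSup_le_csSup haS ⟨x, hx⟩ hJS) (csSup_le ⟨x, hJS hx⟩ fun y hy => ?_)
      rcases le_total x y with hxy | hxy
      · exact le_csSup ha (hJ x hx y hy hxy)
      · exact hxy.trans (le_csSup ha hx)
    rw [h.1 ha, e, h0 _ (csSup_mem_frontier hSo ⟨x, hJS hx⟩ haS)]
    linarith
  · rw [h.2 ha]
    linarith

/-- If `g ≥ 0` vanishes at both ends of an interval `S` and `γ` is bounded and nondecreasing on `S`,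
then `∫_S γ g' ≤ 0`. By the layer-cake formula it suffices to treat indicators of up-closed
subintervals. -/
theorem setIntegral_mul_deriv_nonpos (hd : ∀ t, HasDerivAt g (g' t) t) (hg : Integrable g)
    (hg' : Integrable g') {S : Set ℝ} (hS : S.OrdConnected) (hSo : IsOpen S) (hb : BddBelow S)
    (h0 : ∀ t ∈ frontier S, g t = 0) (hpos : ∀ t ∈ S, 0 ≤ g t) {γ : ℝ → ℝ} {C : ℝ}
    (hγm : Measurable γ) (hγ : ∀ t ∈ S, 0 ≤ γ t ∧ γ t ≤ C) (hmono : MonotoneOn γ S) :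
    ∫ t in S, γ t * g' t ≤ 0 := by
  have hA : MeasurableSet {x : ℝ × ℝ | x.2 < γ x.1} :=
    measurableSet_lt measurable_snd (hγm.comp measurable_fst)
  -- the layer-cake formula `γ t = ∫ 1_{u < γ t} du` over `0 < u ≤ C`
  have e1 : ∀ t ∈ S, γ t * g' t = ∫ u in Set.Ioc 0 C,
      {x : ℝ × ℝ | x.2 < γ x.1}.indicator (fun x => g' x.1) (t, u) := by
    intro t ht
    have e : (fun u => {x : ℝ × ℝ | x.2 < γ x.1}.indicator (fun x => g' x.1) (t, u)) =
        (Set.Iio (γ t)).indicator fun _ => g' t := by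
      ext u
      simp only [Set.indicator, Set.mem_ofPred_eq, Set.mem_Iio]
    have e2 : Set.Iio (γ t) ∩ Set.Ioc 0 C = Set.Ioo 0 (γ t) := by
      ext u
      simp only [Set.mem_inter_iff, Set.mem_Iio, Set.mem_Ioc, Set.mem_Ioo]
      exact ⟨fun h => ⟨h.2.1, h.1⟩, fun h => ⟨h.2, h.1, h.2.le.trans (hγ t ht).2⟩⟩
    rw [e, integral_indicator measurableSet_Iio, Measure.restrict_restrict measurableSet_Iio, e2,
      setIntegral_const]
    simp [(hγ t ht).1]
  rw [setIntegral_congr_fun hSo.measurableSet e1]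
  have hint : Integrable (fun x : ℝ × ℝ =>
      {x : ℝ × ℝ | x.2 < γ x.1}.indicator (fun x => g' x.1) x)
      ((volume.restrict S).prod (volume.restrict (Set.Ioc 0 C))) :=
    ((hg'.integrableOn (s := S)).comp_fst (volume.restrict (Set.Ioc 0 C))).indicator hA
  rw [integral_integral_swap hint]
  refine setIntegral_nonpos measurableSet_Ioc fun u hu => ?_
  have hBu : MeasurableSet {t | u < γ t} := measurableSet_lt measurable_const hγm
  have e : (fun t => {x : ℝ × ℝ | x.2 < γ x.1}.indicator (fun x => g' x.1) (t, u)) =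
      {t | u < γ t}.indicator g' := by
    ext t
    simp only [Set.indicator, Set.mem_ofPred_eq]
  rw [e, integral_indicator hBu, Measure.restrict_restrict hBu]
  refine setIntegral_deriv_upper_nonpos hd hg hg' hS hSo hb h0 hpos Set.inter_subset_right ?_
  exact fun x hx y hy hxy => ⟨hx.1.trans_le (hmono hx.2 hy hxy), hy⟩

end OneDim

theorem isOpen_orderedCone (p : ℕ) : IsOpen (orderedCone p) := by
  have : orderedCone p = (⋂ i : Fin p, ⋂ j : Fin p, {l | i < j → l j < l i}) ∩
      ⋂ k : Fin p, {l | 0 < l k} := by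
    ext l
    simp [orderedCone, StrictAnti]
  rw [this]
  refine (isOpen_iInter_of_finite fun i => isOpen_iInter_of_finite fun j => ?_).inter
    (isOpen_iInter_of_finite fun k => isOpen_lt continuous_const (continuous_apply k))
  by_cases h : i < j
  · simpa [h] using isOpen_lt (continuous_apply j) (continuous_apply i)
  · simp [h]

theorem ordConnected_update_orderedCone {p : ℕ} (x : Fin p → ℝ) (k : Fin p) :
    {t | Function.update x k t ∈ orderedCone p}.OrdConnected := by
  refine ⟨fun s hs u hu t ht => ⟨fun i j hij => ?_, fun j => ?_⟩⟩
  · have h1 := hs.1 hij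
    have h2 := hu.1 hij
    by_cases hi : i = k <;> by_cases hj : j = k
    · subst hi; subst hj; exact absurd hij (lt_irrefl _)
    · subst hi; simp [hj] at h1 h2 ⊢; exact h1.trans_le ht.1
    · subst hj; simp [hi] at h1 h2 ⊢; exact ht.2.trans_lt h2
    · simpa [hi, hj] using h1
  · have h1 := hs.2 j
    by_cases hj : j = k
    · subst hj; simp at h1 ⊢; exact h1.trans_le ht.1
    · simpa [hj] using h1

/-- An integral over the cone, computed along lines in direction `k`. -/
theorem setIntegral_orderedCone_eq {n : ℕ} (k : Fin (n + 1)) {F : (Fin (n + 1) → ℝ) → ℝ}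
    (hF : IntegrableOn F (orderedCone (n + 1))) :
    ∫ x in orderedCone (n + 1), F x = ∫ y : Fin n → ℝ,
      ∫ t in {t | k.insertNth t y ∈ orderedCone (n + 1)}, F (k.insertNth t y) := by
  have hc := (isOpen_orderedCone (n + 1)).measurableSet
  have hmp := (volume_preserving_piFinSuccAbove (fun _ : Fin (n + 1) => ℝ) k).symm
  have hF' := (integrable_indicator_iff hc).2 hF
  rw [← integral_indicator hc, ← hmp.integral_comp' (f := (MeasurableEquiv.piFinSuccAbove
    (fun _ : Fin (n + 1) => ℝ) k).symm)]
  have hF'' := hmp.integrable_comp_of_integrable hF'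
  refine (integral_prod_symm _ hF'').trans ?_
  refine integral_congr_ae (.of_forall fun y => ?_)
  have hm : Measurable fun t : ℝ => (k.insertNth t y : Fin (n + 1) → ℝ) :=
    (MeasurableEquiv.piFinSuccAbove (fun _ : Fin (n + 1) => ℝ) k).symm.measurable.comp
      measurable_prodMk_right
  exact integral_indicator (μ := volume) (f := fun t : ℝ => F (k.insertNth t y)) (hm hc)

section Cone

theorem measurable_insertNth {n : ℕ} (k : Fin (n + 1)) (y : Fin n → ℝ) :
    Measurable fun t : ℝ => (k.insertNth t y : Fin (n + 1) → ℝ) :=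
  (MeasurableEquiv.piFinSuccAbove (fun _ : Fin (n + 1) => ℝ) k).symm.measurable.comp
      measurable_prodMk_right

theorem ae_integrable_insertNth {n : ℕ} (k : Fin (n + 1)) {F : (Fin (n + 1) → ℝ) → ℝ}
    (hF : Integrable F) : ∀ᵐ y : Fin n → ℝ, Integrable fun t : ℝ => F (k.insertNth t y) :=
  ((volume_preserving_piFinSuccAbove (fun _ : Fin (n + 1) => ℝ)
    k).symm.integrable_comp_of_integrable hF).prod_left_ae

/-- The facts about a line in direction `k` that one-dimensional integration by parts requires: `g` is
differentiable along it, and it meets the cone in an open interval, bounded below, at whose ends `g`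
vanishes. -/
theorem slice_facts {n : ℕ} {g g' : (Fin (n + 1) → ℝ) → ℝ} {k : Fin (n + 1)}
    (hd : ∀ x, HasDerivAt (fun t => g (Function.update x k t)) (g' x) (x k))
    (h0 : ∀ x ∈ frontier (orderedCone (n + 1)), g x = 0) (y : Fin n → ℝ) :
    (∀ t, HasDerivAt (fun t : ℝ => g (k.insertNth t y)) (g' (k.insertNth t y)) t) ∧
    {t : ℝ | (k.insertNth t y : Fin (n + 1) → ℝ) ∈ orderedCone (n + 1)}.OrdConnected ∧
    IsOpen {t : ℝ | (k.insertNth t y : Fin (n + 1) → ℝ) ∈ orderedCone (n + 1)} ∧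
    BddBelow {t : ℝ | (k.insertNth t y : Fin (n + 1) → ℝ) ∈ orderedCone (n + 1)} ∧
    ∀ t ∈ frontier {t : ℝ | (k.insertNth t y : Fin (n + 1) → ℝ) ∈ orderedCone (n + 1)},
      g (k.insertNth t y) = 0 := by
  have hu : ∀ s t : ℝ, Function.update (k.insertNth s y : Fin (n + 1) → ℝ) k t = k.insertNth t y :=
    fun s t => Fin.update_insertNth ..
  have hc : Continuous fun t : ℝ => (k.insertNth t y : Fin (n + 1) → ℝ) := by
    have : Continuous fun t : ℝ => Function.update (k.insertNth 0 y : Fin (n + 1) → ℝ) k t := by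
      fun_prop
    simpa only [hu] using this
  refine ⟨fun t => ?_, ?_, (isOpen_orderedCone _).preimage hc, ⟨0, fun t ht => ?_⟩, fun t ht => ?_⟩
  · have h := hd (k.insertNth t y)
    rw [Fin.insertNth_apply_same] at h
    simpa only [hu] using h
  · have h := ordConnected_update_orderedCone (k.insertNth 0 y : Fin (n + 1) → ℝ) k
    simpa only [hu] using h
  · have h := ht.2 k
    rw [Fin.insertNth_apply_same] at h
    exact h.le
  · exact h0 _ (hc.frontier_preimage_subset _ ht)

variable {p : ℕ} {g g' : (Fin p → ℝ) → ℝ} {k : Fin p}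

/-- Integration by parts in the direction `k` against a function that is nondecreasing in that
direction. -/
theorem setIntegral_orderedCone_mul_deriv_nonpos
    (hd : ∀ x, HasDerivAt (fun t => g (Function.update x k t)) (g' x) (x k))
    (hg : Integrable g) (hg' : Integrable g') (h0 : ∀ x ∈ frontier (orderedCone p), g x = 0)
    (hpos : ∀ x ∈ orderedCone p, 0 ≤ g x) {γ : (Fin p → ℝ) → ℝ} {C : ℝ}
    (hγm : Measurable γ) (hγ : ∀ x ∈ orderedCone p, 0 ≤ γ x ∧ γ x ≤ C)
    (hmono : ∀ x ∈ orderedCone p, ∀ t, x k ≤ t → Function.update x k t ∈ orderedCone p →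
      γ x ≤ γ (Function.update x k t)) :
    IntegrableOn (fun x => γ x * g' x) (orderedCone p) ∧
      ∫ x in orderedCone p, γ x * g' x ≤ 0 := by
  obtain _ | n := p
  · exact k.elim0
  have hi : IntegrableOn (fun x => γ x * g' x) (orderedCone (n + 1)) := by
    refine Integrable.bdd_mul (c := C) hg'.integrableOn hγm.aestronglyMeasurable ?_
    refine (ae_restrict_mem (isOpen_orderedCone _).measurableSet).mono fun x hx => ?_
    rw [Real.norm_of_nonneg (hγ x hx).1]
    exact (hγ x hx).2
  refine ⟨hi, ?_⟩
  rw [setIntegral_orderedCone_eq k hi]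
  refine integral_nonpos_of_ae ?_
  filter_upwards [ae_integrable_insertNth k hg, ae_integrable_insertNth k hg'] with y h1 h2
  obtain ⟨f1, f2, f3, f4, f5⟩ := slice_facts hd h0 y
  refine setIntegral_mul_deriv_nonpos f1 h1 h2 f2 f3 f4 f5 (fun t ht => hpos _ ht)
    (γ := fun t => γ (k.insertNth t y)) (C := C) (hγm.comp (measurable_insertNth k y))
    (fun t ht => hγ _ ht) fun s hs t ht hst => ?_
  have e : Function.update (k.insertNth s y : Fin (n + 1) → ℝ) k t = k.insertNth t y :=
    Fin.update_insertNth ..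
  have h := hmono _ hs t (by rwa [Fin.insertNth_apply_same]) (by rw [e]; exact ht)
  rwa [e] at h

theorem setIntegral_orderedCone_deriv_eq_zero
    (hd : ∀ x, HasDerivAt (fun t => g (Function.update x k t)) (g' x) (x k))
    (hg : Integrable g) (hg' : Integrable g') (h0 : ∀ x ∈ frontier (orderedCone p), g x = 0) :
    ∫ x in orderedCone p, g' x = 0 := by
  obtain _ | n := p
  · exact k.elim0
  rw [setIntegral_orderedCone_eq k hg'.integrableOn]
  refine integral_eq_zero_of_ae ?_
  filter_upwards [ae_integrable_insertNth k hg, ae_integrable_insertNth k hg'] with y h1 h2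
  obtain ⟨f1, f2, f3, f4, f5⟩ := slice_facts hd h0 y
  exact setIntegral_deriv_eq_zero f1 h1 h2 f2 f3 f4 f5

/-- On the boundary of the cone two coordinates agree or one of them vanishes. -/
theorem of_mem_frontier_orderedCone {x : Fin p → ℝ} (hx : x ∈ frontier (orderedCone p)) :
    (∃ i j, i < j ∧ x i = x j) ∨ ∃ j, x j = 0 := by
  have hcl : closure (orderedCone p) ⊆ {l | (∀ i j, i < j → l j ≤ l i) ∧ ∀ j, 0 ≤ l j} := by
    refine closure_minimal (fun l hl => ⟨fun i j hij => (hl.1 hij).le, fun j => (hl.2 j).le⟩) ?_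
    simp only [Set.ofPred_and, Set.ofPred_forall]
    refine (isClosed_iInter fun i => isClosed_iInter fun j => isClosed_iInter fun _ =>
      isClosed_le (continuous_apply j) (continuous_apply i)).inter
      (isClosed_iInter fun j => isClosed_le continuous_const (continuous_apply j))
  obtain ⟨h1, h2⟩ := hcl hx.1
  have h3 := hx.2
  rw [(isOpen_orderedCone p).interior_eq] at h3
  by_contra hcon
  push Not at hcon
  exact h3 ⟨fun i j hij => lt_of_le_of_ne (h1 i j hij) (hcon.1 i j hij).symm,
    fun j => lt_of_le_of_ne (h2 j) (hcon.2 j).symm⟩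

end Cone

/-! ### Polynomials times Gaussian weights -/

section PolyGauss
variable {p : ℕ}

/-- The weight `exp (∑ₖ (bₖ xₖ - β xₖ²))`. -/
def expWeight (b : Fin p → ℝ) (β : ℝ) (x : Fin p → ℝ) : ℝ :=
  Real.exp (∑ k, (b k * x k - β * x k ^ 2))

theorem expWeight_pos (b : Fin p → ℝ) (β : ℝ) (x : Fin p → ℝ) : 0 < expWeight b β x :=
  Real.exp_pos _

theorem integrable_pow_mul_exp {β : ℝ} (hβ : 0 < β) (b : ℝ) (n : ℕ) :
    Integrable fun t : ℝ => t ^ n * Real.exp (b * t - β * t ^ 2) := by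
  have h := (integrable_rpow_mul_exp_neg_mul_sq (b := β / 2) (by positivity) (s := n)
    (by linarith [n.cast_nonneg (α := ℝ)])).norm.const_mul (Real.exp (b ^ 2 / (2 * β)))
  refine h.mono' (by fun_prop) (.of_forall fun t => ?_)
  rw [Real.rpow_natCast, norm_mul, norm_mul, mul_left_comm, Real.norm_of_nonneg (Real.exp_pos _).le,
    Real.norm_of_nonneg (Real.exp_pos _).le, ← Real.exp_add]
  refine mul_le_mul_of_nonneg_left (Real.exp_le_exp.2 ?_) (norm_nonneg _)
  have : b ^ 2 / (2 * β) + -(β / 2) * t ^ 2 - (b * t - β * t ^ 2) =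
      (b - β * t) ^ 2 / (2 * β) := by
    field_simp
    ring
  have h2 : 0 ≤ (b - β * t) ^ 2 / (2 * β) := by positivity
  linarith

theorem integrable_eval_mul_expWeight (b : Fin p → ℝ) {β : ℝ} (hβ : 0 < β)
    (P : MvPolynomial (Fin p) ℝ) :
    Integrable fun x : Fin p → ℝ => MvPolynomial.eval x P * expWeight b β x := by
  induction P using MvPolynomial.induction_on' with
  | monomial s c =>
    have e : ∀ x : Fin p → ℝ, MvPolynomial.eval x (MvPolynomial.monomial s c) * expWeight b β x =
        c * ∏ k, (x k ^ s k * Real.exp (b k * x k - β * x k ^ 2)) := by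
      intro x
      rw [MvPolynomial.eval_monomial, Finsupp.prod_fintype _ _ (by simp), expWeight, Real.exp_sum,
        mul_assoc, Finset.prod_mul_distrib]
    simp_rw [e]
    exact (Integrable.fintype_prod fun k => integrable_pow_mul_exp hβ (b k) (s k)).const_mul c
  | add P Q hP hQ =>
    refine (hP.add hQ).congr (.of_forall fun x => ?_)
    simp [add_mul]

theorem hasDerivAt_eval_update (P : MvPolynomial (Fin p) ℝ) (x : Fin p → ℝ) (k : Fin p) :
    HasDerivAt (fun t => MvPolynomial.eval (Function.update x k t) P)
      (MvPolynomial.eval x (MvPolynomial.pderiv k P)) (x k) := by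
  induction P using MvPolynomial.induction_on with
  | C c => simpa using hasDerivAt_const (x k) c
  | add P Q hP hQ => simpa using hP.fun_add hQ
  | mul_X P i hP =>
    have hX : HasDerivAt (fun t => Function.update x k t i) (if i = k then 1 else 0) (x k) := by
      by_cases h : i = k
      · subst h; simpa using hasDerivAt_id' (x i)
      · simpa [h] using hasDerivAt_const (x k) (x i)
    have h := hP.mul hX
    simp only [Function.update_eq_self] at h
    simp only [map_mul, MvPolynomial.eval_X]
    refine h.congr_deriv ?_
    rw [Derivation.leibniz, MvPolynomial.pderiv_X]
    simp only [smul_eq_mul, map_add, map_mul, MvPolynomial.eval_X]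
    by_cases hik : i = k
    · subst hik; simp; ring
    · simp [hik]; ring

theorem hasDerivAt_expWeight_update (b : Fin p → ℝ) (β : ℝ) (x : Fin p → ℝ) (k : Fin p) :
    HasDerivAt (fun t => expWeight b β (Function.update x k t))
      (expWeight b β x * (b k - 2 * β * x k)) (x k) := by
  have h : HasDerivAt (fun t => ∑ i, (b i * Function.update x k t i -
      β * Function.update x k t i ^ 2)) (b k - 2 * β * x k) (x k) := by
    have h1 : ∀ i ∈ Finset.univ, HasDerivAt (fun t => b i * Function.update x k t i -
        β * Function.update x k t i ^ 2) (if i = k then b k - 2 * β * x k else 0) (x k) := by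
      intro i _
      by_cases h : i = k
      · subst h
        simp only [Function.update_self, if_true]
        refine (((hasDerivAt_id (x i)).const_mul (b i)).sub
          (((hasDerivAt_id (x i)).pow 2).const_mul β)).congr_deriv ?_
        simp
        ring
      · simp only [Function.update_of_ne h, if_neg h]
        exact hasDerivAt_const _ _
    simpa using HasDerivAt.fun_sum h1
  have h2 := h.exp
  simp only [Function.update_eq_self] at h2
  exact h2

/-- The polynomial factor of the derivative of `P · expWeight b β` in direction `k`. -/
def polyDeriv (b : Fin p → ℝ) (β : ℝ) (k : Fin p) (P : MvPolynomial (Fin p) ℝ) :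
    MvPolynomial (Fin p) ℝ :=
  MvPolynomial.pderiv k P +
    P * (MvPolynomial.C (b k) - MvPolynomial.C (2 * β) * MvPolynomial.X k)

theorem hasDerivAt_eval_mul_expWeight (b : Fin p → ℝ) (β : ℝ) (P : MvPolynomial (Fin p) ℝ)
    (x : Fin p → ℝ) (k : Fin p) :
    HasDerivAt (fun t => MvPolynomial.eval (Function.update x k t) P *
        expWeight b β (Function.update x k t))
      (MvPolynomial.eval x (polyDeriv b β k P) * expWeight b β x) (x k) := by
  have h := (hasDerivAt_eval_update P x k).mul (hasDerivAt_expWeight_update b β x k)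
  simp only [Function.update_eq_self] at h
  refine h.congr_deriv ?_
  simp [polyDeriv]
  ring

/-- The logarithmic derivative `∂ₖP / P` at the point `x`. -/
def logPderiv (x : Fin p → ℝ) (k : Fin p) (P : MvPolynomial (Fin p) ℝ) : ℝ :=
  MvPolynomial.eval x (MvPolynomial.pderiv k P) / MvPolynomial.eval x P

theorem logPderiv_mul {x : Fin p → ℝ} {k : Fin p} {P Q : MvPolynomial (Fin p) ℝ}
    (hP : MvPolynomial.eval x P ≠ 0) (hQ : MvPolynomial.eval x Q ≠ 0) :
    logPderiv x k (P * Q) = logPderiv x k P + logPderiv x k Q := by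
  unfold logPderiv
  rw [Derivation.leibniz]
  simp only [smul_eq_mul, map_add, map_mul]
  field_simp
  ring

theorem logPderiv_pow {x : Fin p → ℝ} {k : Fin p} {P : MvPolynomial (Fin p) ℝ}
    (hP : MvPolynomial.eval x P ≠ 0) (n : ℕ) :
    logPderiv x k (P ^ n) = n * logPderiv x k P := by
  induction n with
  | zero => simp [logPderiv]
  | succ n ih =>
    rw [pow_succ, logPderiv_mul (by rw [map_pow]; exact pow_ne_zero _ hP) hP, ih]
    push_cast
    ring

theorem logPderiv_prod {ι : Type*} {x : Fin p → ℝ} {k : Fin p} {s : Finset ι}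
    {f : ι → MvPolynomial (Fin p) ℝ} (hf : ∀ i ∈ s, MvPolynomial.eval x (f i) ≠ 0) :
    logPderiv x k (∏ i ∈ s, f i) = ∑ i ∈ s, logPderiv x k (f i) := by
  classical
  induction s using Finset.induction_on with
  | empty => simp [logPderiv]
  | insert a s ha ih =>
    rw [Finset.prod_insert ha, Finset.sum_insert ha, logPderiv_mul (hf a (by simp)),
      ih fun i hi => hf i (by simp [hi])]
    rw [map_prod]
    exact Finset.prod_ne_zero_iff.2 fun i hi => hf i (by simp [hi])

theorem logPderiv_X (x : Fin p → ℝ) (k j : Fin p) :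
    logPderiv x k (MvPolynomial.X j) = if j = k then 1 / x k else 0 := by
  unfold logPderiv
  by_cases h : j = k
  · subst h; simp
  · simp [MvPolynomial.pderiv_X, h]

end PolyGauss

/-! ### The density of the singular values -/

section JointDensity
variable {p : ℕ}

/-- The pairs `i < j`. -/
def ltPairs (p : ℕ) : Finset (Fin p × Fin p) := Finset.univ.filter fun q => q.1 < q.2

theorem mem_ltPairs {q : Fin p × Fin p} : q ∈ ltPairs p ↔ q.1 < q.2 := by simp [ltPairs]

theorem sum_eq_sum_diag_add_two_mul_sum_ltPairs (f : Fin p → Fin p → ℝ) (hf : ∀ i j, f i j = f j i) :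
    ∑ i, ∑ j, f i j = ∑ i, f i i + 2 * ∑ q ∈ ltPairs p, f q.1 q.2 := by
  rw [← Fintype.sum_prod_type' (f := f)]
  have h1 := Finset.sum_filter_add_sum_filter_not Finset.univ (fun q : Fin p × Fin p => q.1 < q.2)
    (fun q => f q.1 q.2)
  have h2 := Finset.sum_filter_add_sum_filter_not
    (Finset.univ.filter fun q : Fin p × Fin p => ¬ q.1 < q.2) (fun q => q.2 < q.1)
    (fun q => f q.1 q.2)
  have h3 : ∑ q ∈ (Finset.univ.filter fun q : Fin p × Fin p => ¬ q.1 < q.2).filter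
      (fun q => q.2 < q.1), f q.1 q.2 = ∑ q ∈ ltPairs p, f q.1 q.2 := by
    refine Finset.sum_bij' (fun q _ => q.swap) (fun q _ => q.swap) ?_ ?_ ?_ ?_ ?_
    · intro q hq; simpa [ltPairs] using (Finset.mem_filter.1 hq).2
    · intro q hq; have := mem_ltPairs.1 hq; simp [this, this.le]
    · simp
    · simp
    · intro q _; exact hf _ _
  have h4 : ∑ q ∈ (Finset.univ.filter fun q : Fin p × Fin p => ¬ q.1 < q.2).filter
      (fun q => ¬ q.2 < q.1), f q.1 q.2 = ∑ i, f i i := by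
    refine Finset.sum_bij' (fun q _ => q.1) (fun i _ => (i, i)) ?_ ?_ ?_ ?_ ?_
    · simp
    · simp
    · rintro ⟨i, j⟩ hq
      simp only [Finset.mem_filter, Finset.mem_univ, true_and, not_lt] at hq
      rw [le_antisymm hq.1 hq.2]
    · simp
    · rintro ⟨i, j⟩ hq
      simp only [Finset.mem_filter, Finset.mem_univ, true_and, not_lt] at hq
      rw [le_antisymm hq.1 hq.2]
  rw [← h1, ← h2, h3, h4, ltPairs]
  ring

/-- The squared Vandermonde determinant of the squares, `∏_{i<j} (xᵢ² - xⱼ²)²`. -/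
def vandermondeSq (p : ℕ) : MvPolynomial (Fin p) ℝ :=
  ∏ q ∈ ltPairs p, (MvPolynomial.X q.1 ^ 2 - MvPolynomial.X q.2 ^ 2) ^ 2

/-- The polynomial factor `∏ⱼ xⱼ^{2d+1} ∏_{i<j} (xᵢ² - xⱼ²)²` of the joint density of the singular
values of a Gaussian matrix of size `(p + d) × p`. -/
def svPoly (d p : ℕ) : MvPolynomial (Fin p) ℝ :=
  (∏ j, MvPolynomial.X j ^ (2 * d + 1)) * vandermondeSq p

/-- The quotient `svPoly / xₖ`. -/
def svPolyDiv (d : ℕ) (k : Fin p) : MvPolynomial (Fin p) ℝ :=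
  MvPolynomial.X k ^ (2 * d) *
    (∏ j ∈ Finset.univ.erase k, MvPolynomial.X j ^ (2 * d + 1)) * vandermondeSq p

theorem X_mul_svPolyDiv (d : ℕ) (k : Fin p) :
    MvPolynomial.X k * svPolyDiv d k = svPoly d p := by
  rw [svPoly, svPolyDiv, ← Finset.mul_prod_erase _ _ (Finset.mem_univ k)]
  ring

theorem eval_svPoly (d : ℕ) (k : Fin p) (x : Fin p → ℝ) :
    MvPolynomial.eval x (svPoly d p) = x k * MvPolynomial.eval x (svPolyDiv d k) := by
  rw [← X_mul_svPolyDiv d k]; simp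

theorem sub_sq_pos {x : Fin p → ℝ} (hx : x ∈ orderedCone p) {i j : Fin p} (h : i < j) :
    0 < x i ^ 2 - x j ^ 2 := by
  have h1 := hx.1 h
  have h2 := hx.2 j
  nlinarith

theorem eval_vandermondeSq_pos {x : Fin p → ℝ} (hx : x ∈ orderedCone p) :
    0 < MvPolynomial.eval x (vandermondeSq p) := by
  rw [vandermondeSq, map_prod]
  refine Finset.prod_pos fun q hq => ?_
  have := sub_sq_pos hx (mem_ltPairs.1 hq)
  simp only [map_pow, map_sub, MvPolynomial.eval_X]
  positivity

theorem eval_svPoly_pos (d : ℕ) {x : Fin p → ℝ} (hx : x ∈ orderedCone p) :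
    0 < MvPolynomial.eval x (svPoly d p) := by
  rw [svPoly, map_mul, map_prod]
  refine mul_pos (Finset.prod_pos fun j _ => ?_) (eval_vandermondeSq_pos hx)
  simpa using pow_pos (hx.2 j) _

theorem eval_svPolyDiv_pos (d : ℕ) (k : Fin p) {x : Fin p → ℝ} (hx : x ∈ orderedCone p) :
    0 < MvPolynomial.eval x (svPolyDiv d k) := by
  have h := eval_svPoly_pos d hx
  rw [eval_svPoly d k] at h
  exact pos_of_mul_pos_right h (hx.2 k).le

/-- For `d ≠ 0` the factor `xₖ^{2d}` of `svPoly / xₖ` still vanishes at `xₖ = 0`; hence the assumption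
`m > p`. -/
theorem eval_svPolyDiv_frontier {d : ℕ} (hd : d ≠ 0) (k : Fin p) {x : Fin p → ℝ}
    (hx : x ∈ frontier (orderedCone p)) : MvPolynomial.eval x (svPolyDiv d k) = 0 := by
  rw [svPolyDiv, map_mul, map_mul]
  rcases of_mem_frontier_orderedCone hx with ⟨i, j, hij, h⟩ | ⟨j, h⟩
  · have : MvPolynomial.eval x (vandermondeSq p) = 0 := by
      rw [vandermondeSq, map_prod]
      refine Finset.prod_eq_zero (mem_ltPairs.2 hij : (i, j) ∈ ltPairs p) ?_
      simp [h]
    rw [this, mul_zero]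
  · by_cases hjk : j = k
    · subst hjk
      simp [h, hd]
    · have : MvPolynomial.eval x (∏ j ∈ Finset.univ.erase k,
          (MvPolynomial.X j : MvPolynomial (Fin p) ℝ) ^ (2 * d + 1)) = 0 := by
        rw [map_prod]
        exact Finset.prod_eq_zero (Finset.mem_erase.2 ⟨hjk, Finset.mem_univ j⟩) (by simp [h])
      rw [this, mul_zero, zero_mul]

theorem logPderiv_svPolyDiv (d : ℕ) (k : Fin p) {x : Fin p → ℝ} (hx : x ∈ orderedCone p) :
    logPderiv x k (svPolyDiv d k) = 2 * d / x k + ∑ q ∈ ltPairs p,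
      4 * x k * ((if q.1 = k then 1 else 0) - (if q.2 = k then 1 else 0)) /
        (x q.1 ^ 2 - x q.2 ^ 2) := by
  have hX : ∀ j, MvPolynomial.eval x (MvPolynomial.X j) ≠ 0 := fun j => by
    simpa using (hx.2 j).ne'
  have hXn : ∀ j n, MvPolynomial.eval x (MvPolynomial.X j ^ n) ≠ 0 := fun j n => by
    rw [map_pow]; exact pow_ne_zero _ (hX j)
  have hP : MvPolynomial.eval x (∏ j ∈ Finset.univ.erase k,
      (MvPolynomial.X j : MvPolynomial (Fin p) ℝ) ^ (2 * d + 1)) ≠ 0 := by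
    rw [map_prod]
    exact Finset.prod_ne_zero_iff.2 fun j _ => hXn j _
  have hq : ∀ q ∈ ltPairs p, MvPolynomial.eval x
      ((MvPolynomial.X q.1 : MvPolynomial (Fin p) ℝ) ^ 2 - MvPolynomial.X q.2 ^ 2) ≠ 0 :=
    fun q hq => by simpa using (sub_sq_pos hx (mem_ltPairs.1 hq)).ne'
  rw [svPolyDiv, logPderiv_mul (by rw [map_mul]; exact mul_ne_zero (hXn _ _) hP)
    (eval_vandermondeSq_pos hx).ne', logPderiv_mul (hXn _ _) hP, logPderiv_pow (hX k), logPderiv_X,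
    if_pos rfl, logPderiv_prod fun j _ => hXn j _]
  have h0 : ∑ j ∈ Finset.univ.erase k, logPderiv x k
      ((MvPolynomial.X j : MvPolynomial (Fin p) ℝ) ^ (2 * d + 1)) = 0 := by
    refine Finset.sum_eq_zero fun j hj => ?_
    rw [logPderiv_pow (hX j), logPderiv_X, if_neg (Finset.ne_of_mem_erase hj), mul_zero]
  rw [h0, add_zero, vandermondeSq, logPderiv_prod fun q hq' => by
    rw [map_pow]; exact pow_ne_zero _ (hq q hq')]
  congr 1
  · push_cast; ring
  · refine Finset.sum_congr rfl fun q hq' => ?_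
    rw [logPderiv_pow (hq q hq'), logPderiv]
    have hne : x q.1 ^ 2 - x q.2 ^ 2 ≠ 0 := (sub_sq_pos hx (mem_ltPairs.1 hq')).ne'
    simp only [map_sub, Derivation.leibniz_pow, MvPolynomial.pderiv_X, map_pow, MvPolynomial.eval_X,
      Pi.single_apply]
    simp only [smul_eq_mul, nsmul_eq_mul, map_mul, map_natCast, map_pow, MvPolynomial.eval_X]
    split_ifs <;> simp_all <;> field_simp <;> ring

/-- The derivative in direction `k` of `½ x_k^{2e} (svPoly / x_k) S · expWeight`, on the cone. -/
theorem eval_polyDeriv_svPolyDiv (d e : ℕ) (k : Fin p) (b : Fin p → ℝ) (β : ℝ)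
    (S : MvPolynomial (Fin p) ℝ) {x : Fin p → ℝ} (hx : x ∈ orderedCone p) :
    MvPolynomial.eval x (polyDeriv b β k
      (MvPolynomial.C (1 / 2) * (MvPolynomial.X k ^ (2 * e) * svPolyDiv d k * S))) =
    MvPolynomial.eval x (svPoly d p) *
      ((x k ^ 2) ^ e * (((e + d) / x k ^ 2 + b k / (2 * x k) - β + ∑ q ∈ ltPairs p,
        2 * ((if q.1 = k then 1 else 0) - (if q.2 = k then 1 else 0)) / (x q.1 ^ 2 - x q.2 ^ 2)) *
          MvPolynomial.eval x S) +
      (x k ^ 2) ^ e * (MvPolynomial.eval x (MvPolynomial.pderiv k S) / (2 * x k))) := by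
  have hk := (hx.2 k).ne'
  have hR := (eval_svPolyDiv_pos d k hx).ne'
  have hXn : MvPolynomial.eval x ((MvPolynomial.X k : MvPolynomial (Fin p) ℝ) ^ (2 * e)) ≠ 0 := by
    simpa using fun h => absurd h hk
  set Q : MvPolynomial (Fin p) ℝ := MvPolynomial.X k ^ (2 * e) * svPolyDiv d k with hQ
  have hQ0 : MvPolynomial.eval x Q ≠ 0 := by rw [hQ, map_mul]; exact mul_ne_zero hXn hR
  have h1 : MvPolynomial.eval x (MvPolynomial.pderiv k Q) =
      MvPolynomial.eval x Q * (2 * e / x k + (2 * d / x k + ∑ q ∈ ltPairs p,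
      4 * x k * ((if q.1 = k then 1 else 0) - (if q.2 = k then 1 else 0)) /
        (x q.1 ^ 2 - x q.2 ^ 2))) := by
    have h := logPderiv_mul (k := k) hXn hR
    rw [logPderiv_svPolyDiv d k hx, logPderiv_pow (by simpa using hk), logPderiv_X, if_pos rfl,
      ← hQ, logPderiv, div_eq_iff hQ0] at h
    rw [h]
    push_cast
    ring
  have h2 : MvPolynomial.eval x Q = (x k ^ 2) ^ e * MvPolynomial.eval x (svPolyDiv d k) := by
    rw [hQ]; simp [pow_mul]
  have h3 : ∑ q ∈ ltPairs p, 4 * x k * ((if q.1 = k then 1 else 0) - (if q.2 = k then 1 else 0)) /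
        (x q.1 ^ 2 - x q.2 ^ 2) = 2 * x k * ∑ q ∈ ltPairs p,
      2 * ((if q.1 = k then (1 : ℝ) else 0) - (if q.2 = k then 1 else 0)) /
        (x q.1 ^ 2 - x q.2 ^ 2) := by
    rw [Finset.mul_sum]
    exact Finset.sum_congr rfl fun q _ => by ring
  rw [polyDeriv, MvPolynomial.pderiv_C_mul, Derivation.leibniz, eval_svPoly d k]
  simp only [smul_eq_mul, map_add, map_mul, map_sub, MvPolynomial.eval_C, MvPolynomial.eval_X,
    h1, h3]
  rw [h2]
  field_simp
  ring

end JointDensity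

/-! ### The recursion for the moments of the density -/

section Density
variable {p : ℕ}

/-- The power sum `∑ⱼ xⱼ^{2a}` of the squares. -/
def psumSq (p a : ℕ) : MvPolynomial (Fin p) ℝ := ∑ j, MvPolynomial.X j ^ (2 * a)

theorem eval_psumSq (a : ℕ) (x : Fin p → ℝ) :
    MvPolynomial.eval x (psumSq p a) = ∑ j, (x j ^ 2) ^ a := by
  simp [psumSq, pow_mul]

/-- The integral of a polynomial against the (unnormalised) density of the singular values. -/
def svIntegral (d : ℕ) (β : ℝ) (P : MvPolynomial (Fin p) ℝ) : ℝ :=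
  ∫ x in orderedCone p, MvPolynomial.eval x (svPoly d p * P) * expWeight 0 β x

theorem svIntegral_add {d : ℕ} {β : ℝ} (hβ : 0 < β) (P Q : MvPolynomial (Fin p) ℝ) :
    svIntegral d β (P + Q) = svIntegral d β P + svIntegral d β Q := by
  unfold svIntegral
  rw [← integral_add (integrable_eval_mul_expWeight 0 hβ _).integrableOn
    (integrable_eval_mul_expWeight 0 hβ _).integrableOn]
  simp only [mul_add, map_add, add_mul]

theorem svIntegral_C_mul {d : ℕ} {β : ℝ} (c : ℝ) (P : MvPolynomial (Fin p) ℝ) :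
    svIntegral d β (MvPolynomial.C c * P) = c * svIntegral d β P := by
  unfold svIntegral
  rw [← integral_const_mul]
  congr 1 with x
  simp only [map_mul, MvPolynomial.eval_C]
  ring

theorem svIntegral_natCast_mul {d : ℕ} {β : ℝ} (c : ℕ) (P : MvPolynomial (Fin p) ℝ) :
    svIntegral d β ((c : MvPolynomial (Fin p) ℝ) * P) = c * svIntegral d β P := by
  rw [← svIntegral_C_mul]; simp

/-- `svIntegral` as an additive homomorphism. -/
def svIntegralHom (d : ℕ) {β : ℝ} (hβ : 0 < β) : MvPolynomial (Fin p) ℝ →+ ℝ :=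
  ⟨⟨svIntegral d β, by simp [svIntegral]⟩, svIntegral_add hβ⟩

/-- The divided difference of `t ^ (a + 1)` is `∑ᵣ lᵢʳ lⱼᵃ⁻ʳ`; summed over all ordered pairs it gives
products of power sums, from which the diagonal terms are removed. -/
theorem sum_ltPairs_divided_difference (a : ℕ) {l : Fin p → ℝ}
    (hl : ∀ q ∈ ltPairs p, l q.1 - l q.2 ≠ 0) :
    ∑ q ∈ ltPairs p, 2 * (l q.1 ^ (a + 1) - l q.2 ^ (a + 1)) / (l q.1 - l q.2) =
      ∑ r ∈ Finset.range (a + 1), (∑ i, l i ^ r) * (∑ j, l j ^ (a - r)) -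
        (a + 1) * ∑ i, l i ^ a := by
  have h := sum_eq_sum_diag_add_two_mul_sum_ltPairs (p := p)
    (fun i j => ∑ r ∈ Finset.range (a + 1), l i ^ r * l j ^ (a - r)) (by
      intro i j
      rw [← Finset.sum_range_reflect]
      refine Finset.sum_congr rfl fun r hr => ?_
      have := Finset.mem_range.1 hr
      rw [show a + 1 - 1 - r = a - r by omega, show a - (a - r) = r by omega, mul_comm])
  have e1 : ∑ i, ∑ j, ∑ r ∈ Finset.range (a + 1), l i ^ r * l j ^ (a - r) =
      ∑ r ∈ Finset.range (a + 1), (∑ i, l i ^ r) * (∑ j, l j ^ (a - r)) := by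
    simp_rw [Finset.sum_mul_sum]
    simp_rw [Finset.sum_comm (t := Finset.range (a + 1))]
  have e2 : ∀ i, ∑ r ∈ Finset.range (a + 1), l i ^ r * l i ^ (a - r) = (a + 1) * l i ^ a := by
    intro i
    rw [Finset.sum_congr rfl fun r hr => by
      rw [← pow_add, Nat.add_sub_cancel' (Nat.lt_succ_iff.1 (Finset.mem_range.1 hr))]]
    simp
  have e3 : ∀ q ∈ ltPairs p, 2 * (l q.1 ^ (a + 1) - l q.2 ^ (a + 1)) / (l q.1 - l q.2) =
      2 * ∑ r ∈ Finset.range (a + 1), l q.1 ^ r * l q.2 ^ (a - r) := by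
    intro q hq
    rw [← (Commute.all (l q.1) (l q.2)).geom_sum₂_mul (a + 1), div_eq_iff (hl q hq)]
    simp only [Nat.add_sub_cancel]
    ring
  rw [Finset.sum_congr rfl e3, ← Finset.mul_sum, ← e1, h, Finset.mul_sum]
  simp only [e2, ← Finset.mul_sum]
  ring

/-- Summation over `k` first: the pair `q` is seen by `k = q.1` and `k = q.2` only. -/
theorem sum_mul_sum_ltPairs_delta (c : Fin p → ℝ) (w : Fin p × Fin p → ℝ) :
    ∑ k, c k * ∑ q ∈ ltPairs p,
      2 * ((if q.1 = k then (1 : ℝ) else 0) - (if q.2 = k then 1 else 0)) / w q =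
      ∑ q ∈ ltPairs p, 2 * (c q.1 - c q.2) / w q := by
  simp_rw [Finset.mul_sum]
  rw [Finset.sum_comm]
  refine Finset.sum_congr rfl fun q _ => ?_
  have : ∀ k, c k * (2 * ((if q.1 = k then (1 : ℝ) else 0) - (if q.2 = k then 1 else 0)) / w q) =
      2 / w q * (if q.1 = k then c k else 0) - 2 / w q * (if q.2 = k then c k else 0) := by
    intro k
    split_ifs <;> ring
  simp_rw [this, Finset.sum_sub_distrib, ← Finset.mul_sum]
  simp only [Finset.sum_ite_eq, Finset.mem_univ, if_true]
  ring

theorem eval_pderiv_psumSq (x : Fin p → ℝ) (k : Fin p) (b : ℕ) :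
    MvPolynomial.eval x (MvPolynomial.pderiv k (psumSq p b)) = 2 * b * x k ^ (2 * b - 1) := by
  rw [psumSq, map_sum, map_sum, Finset.sum_eq_single k]
  · simp [Derivation.leibniz_pow]
  · intro j _ hj
    simp [Derivation.leibniz_pow, MvPolynomial.pderiv_X, hj]
  · simp

theorem multiset_sum_map_sum {ι κ : Type*} (L : Multiset ι) (s : Finset κ) (f : ι → κ → ℝ) :
    (L.map fun b => ∑ k ∈ s, f b k).sum = ∑ k ∈ s, (L.map fun b => f b k).sum :=
  Multiset.sum_map_sum_map L s.val

/-- The polynomial factor of the divergence of the vector field `½ xₖ^{2a+1} (∏_{b ∈ L} p_b) w`, where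
`p_b = ∑ⱼ xⱼ^{2b}` and `w` is `svPoly` times the Gaussian weight. -/
theorem sum_polyDeriv_moment (d a : ℕ) (β : ℝ) (L : Multiset ℕ) {x : Fin p → ℝ}
    (hx : x ∈ orderedCone p) :
    ∑ k, MvPolynomial.eval x (polyDeriv 0 β k (MvPolynomial.C (1 / 2) *
      (MvPolynomial.X k ^ (2 * (a + 1)) * svPolyDiv d k * (L.map (psumSq p)).prod))) =
    MvPolynomial.eval x (svPoly d p * (MvPolynomial.C (d : ℝ) * (psumSq p a * (L.map (psumSq p)).prod) +
      ∑ r ∈ Finset.range (a + 1), psumSq p r * (psumSq p (a - r) * (L.map (psumSq p)).prod) +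
      (L.map fun b : ℕ => MvPolynomial.C (b : ℝ) *
        (psumSq p (a + b) * ((L.erase b).map (psumSq p)).prod)).sum +
      MvPolynomial.C (-β) * (psumSq p (a + 1) * (L.map (psumSq p)).prod))) := by
  set S := (L.map (psumSq p)).prod with hS
  have hS' : ∑ k, (x k ^ 2) ^ (a + 1) * (MvPolynomial.eval x (MvPolynomial.pderiv k S) / (2 * x k)) =
      MvPolynomial.eval x (L.map fun b : ℕ => MvPolynomial.C (b : ℝ) *
        (psumSq p (a + b) * ((L.erase b).map (psumSq p)).prod)).sum := by
    have h1 : ∀ k, (x k ^ 2) ^ (a + 1) *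
        (MvPolynomial.eval x (MvPolynomial.pderiv k S) / (2 * x k)) =
        (L.map fun b : ℕ => (b : ℝ) * ((x k ^ 2) ^ (a + b) *
          MvPolynomial.eval x ((L.erase b).map (psumSq p)).prod)).sum := by
      intro k
      have hk := (hx.2 k).ne'
      rw [hS, derivation_multiset_prod (MvPolynomial.pderiv k) (psumSq p)
        (fun b => MvPolynomial.pderiv k (psumSq p b)) (fun b => rfl), map_multiset_sum,
        Multiset.map_map, mul_div_assoc', ← Multiset.sum_map_mul_left, ← Multiset.sum_map_div]
      congr 1
      refine Multiset.map_congr rfl fun b _ => ?_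
      simp only [Function.comp, map_mul, eval_pderiv_psumSq]
      rcases b with _ | b
      · simp
      · rw [show 2 * (b + 1) - 1 = 2 * b + 1 by omega]
        field_simp
        ring
    simp_rw [h1]
    rw [map_multiset_sum, Multiset.map_map, ← multiset_sum_map_sum]
    congr 1
    refine Multiset.map_congr rfl fun b _ => ?_
    simp only [Function.comp, map_mul, MvPolynomial.eval_C, eval_psumSq]
    rw [← Finset.mul_sum, Finset.sum_mul]
  simp_rw [eval_polyDeriv_svPolyDiv d (a + 1) _ 0 β _ hx]
  rw [← Finset.mul_sum, Finset.sum_add_distrib, hS', map_mul]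
  congr 1
  rw [map_add, map_add, map_add, add_right_comm (_ + _)]
  congr 1
  have e : ∀ k, (x k ^ 2) ^ (a + 1) * (((((a + 1 : ℕ) : ℝ) + d) / x k ^ 2 +
        (0 : Fin p → ℝ) k / (2 * x k) - β +
      ∑ q ∈ ltPairs p, 2 * ((if q.1 = k then 1 else 0) - (if q.2 = k then 1 else 0)) /
        (x q.1 ^ 2 - x q.2 ^ 2)) * MvPolynomial.eval x S) =
      ((a + 1 + d) * (x k ^ 2) ^ a - β * (x k ^ 2) ^ (a + 1) + (x k ^ 2) ^ (a + 1) *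
        ∑ q ∈ ltPairs p, 2 * ((if q.1 = k then 1 else 0) - (if q.2 = k then 1 else 0)) /
        (x q.1 ^ 2 - x q.2 ^ 2)) * MvPolynomial.eval x S := by
    intro k
    have hk := (hx.2 k).ne'
    have : (x k ^ 2) ^ (a + 1) * ((((a + 1 : ℕ) : ℝ) + d) / x k ^ 2) =
        (a + 1 + d) * (x k ^ 2) ^ a := by
      push_cast
      field_simp
      ring
    rw [Pi.zero_apply, zero_div, add_zero, ← mul_assoc, mul_add, mul_sub, this]
    ring
  simp_rw [e]
  rw [← Finset.sum_mul, Finset.sum_add_distrib, Finset.sum_sub_distrib, sum_mul_sum_ltPairs_delta,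
    sum_ltPairs_divided_difference a (l := fun i => x i ^ 2)
      fun q hq => (sub_sq_pos hx (mem_ltPairs.1 hq)).ne', ← Finset.mul_sum, ← Finset.mul_sum]
  simp only [map_mul, map_sum, MvPolynomial.eval_C, eval_psumSq, ← mul_assoc, ← Finset.sum_mul]
  ring

/-- The integral over the cone of the divergence computed in `sum_polyDeriv_moment` is zero. -/
theorem traceRecursion_svIntegral {d : ℕ} (hd : d ≠ 0) {β : ℝ} (hβ : 0 < β) :
    TraceRecursion d p β fun L => (svIntegral (p := p) d β (L.map (psumSq p)).prod : ℂ) where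
  zero_cons L := by
    have : psumSq p 0 = (p : MvPolynomial (Fin p) ℝ) := by simp [psumSq]
    rw [Multiset.map_cons, Multiset.prod_cons, this, svIntegral_natCast_mul]
    push_cast
    rfl
  succ_cons a L := by
    have hint : ∀ k, IntegrableOn (fun x : Fin p → ℝ => MvPolynomial.eval x (polyDeriv 0 β k
        (MvPolynomial.C (1 / 2) * (MvPolynomial.X k ^ (2 * (a + 1)) * svPolyDiv d k *
          (L.map (psumSq p)).prod))) * expWeight 0 β x) (orderedCone p) := fun k =>
      (integrable_eval_mul_expWeight 0 hβ _).integrableOn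
    have h0 : ∀ k, ∫ x in orderedCone p, MvPolynomial.eval x (polyDeriv 0 β k
        (MvPolynomial.C (1 / 2) * (MvPolynomial.X k ^ (2 * (a + 1)) * svPolyDiv d k *
          (L.map (psumSq p)).prod))) * expWeight 0 β x = 0 := fun k =>
      setIntegral_orderedCone_deriv_eq_zero (k := k)
        (fun x => hasDerivAt_eval_mul_expWeight 0 β _ x k)
        (integrable_eval_mul_expWeight 0 hβ _) (integrable_eval_mul_expWeight 0 hβ _)
        fun x hx => by simp [eval_svPolyDiv_frontier hd k hx]
    have h1 := integral_finsetSum Finset.univ fun k _ => hint k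
    rw [Finset.sum_eq_zero fun k _ => h0 k] at h1
    have h3 : svIntegralHom d hβ (MvPolynomial.C (d : ℝ) * (psumSq p a * (L.map (psumSq p)).prod) +
      ∑ r ∈ Finset.range (a + 1), psumSq p r * (psumSq p (a - r) * (L.map (psumSq p)).prod) +
      (L.map fun b : ℕ => MvPolynomial.C (b : ℝ) *
        (psumSq p (a + b) * ((L.erase b).map (psumSq p)).prod)).sum +
      MvPolynomial.C (-β) * (psumSq p (a + 1) * (L.map (psumSq p)).prod)) = 0 := by
      rw [← h1]
      refine setIntegral_congr_fun (isOpen_orderedCone p).measurableSet fun x hx => ?_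
      rw [← Finset.sum_mul, sum_polyDeriv_moment d a β L hx]
    have hom : ∀ P, svIntegralHom (p := p) d hβ P = svIntegral d β P := fun _ => rfl
    rw [map_add, map_add, map_add, map_sum, map_multiset_sum, Multiset.map_map] at h3
    simp only [Function.comp_def, hom, svIntegral_C_mul] at h3
    have h4 : β * svIntegral d β (psumSq p (a + 1) * (L.map (psumSq p)).prod) =
      d * svIntegral d β (psumSq p a * (L.map (psumSq p)).prod) +
      ∑ r ∈ Finset.range (a + 1),
        svIntegral d β (psumSq p r * (psumSq p (a - r) * (L.map (psumSq p)).prod)) +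
      (L.map fun b : ℕ => (b : ℝ) *
        svIntegral d β (psumSq p (a + b) * ((L.erase b).map (psumSq p)).prod)).sum := by linarith
    simp only [Multiset.map_cons, Multiset.prod_cons]
    have h5 := congrArg (fun t : ℝ => (t : ℂ)) h4
    simp only [Complex.ofReal_add, Complex.ofReal_mul, Complex.ofReal_natCast, Complex.ofReal_sum]
      at h5
    rw [h5]
    congr 1
    refine (map_multiset_sum Complex.ofRealHom _).trans ?_
    simp [Multiset.map_map]

end Density

/-! ### The shrinkage inequality -/

section Shrinkage
variable {p : ℕ}

/-- For `d ≠ 0` the polynomial `svPoly` is divisible by `xₖ²`, which makes the terms `d / xₖ²`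
integrable. -/
theorem exists_svPolyDiv_eq {d : ℕ} (hd : d ≠ 0) (k : Fin p) :
    ∃ Q, svPolyDiv d k = MvPolynomial.X k * Q := by
  obtain ⟨e, rfl⟩ : ∃ e, d = e + 1 := Nat.exists_eq_succ_of_ne_zero hd
  refine ⟨MvPolynomial.X k ^ (2 * e + 1) * (∏ j ∈ Finset.univ.erase k,
    MvPolynomial.X j ^ (2 * (e + 1) + 1)) * vandermondeSq p, ?_⟩
  rw [svPolyDiv]
  ring

/-- The integrated divergence inequality behind minimaxity: the unbiased estimate of the excess risk
splits into the terms displayed here and the pair terms `2 (γᵢ - γⱼ) / (xᵢ² - xⱼ²) ≥ 0`. -/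
theorem setIntegral_shrinkage_nonpos {d : ℕ} (hd : d ≠ 0) (b : Fin p → ℝ)
    {γ : Fin p → (Fin p → ℝ) → ℝ} {C : ℝ} (hγm : ∀ k, Measurable (γ k))
    (hγ : ∀ k, ∀ x ∈ orderedCone p, 0 ≤ γ k x ∧ γ k x ≤ C)
    (hmono : ∀ k, ∀ x ∈ orderedCone p, ∀ t, x k ≤ t → Function.update x k t ∈ orderedCone p →
      γ k x ≤ γ k (Function.update x k t))
    (hanti : ∀ x ∈ orderedCone p, ∀ i j, i < j → γ j x ≤ γ i x) :
    IntegrableOn (fun x => (∑ k, γ k x * (d / x k ^ 2 + b k / (2 * x k) - 1)) *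
      (MvPolynomial.eval x (svPoly d p) * expWeight b 1 x)) (orderedCone p) ∧
    ∫ x in orderedCone p, (∑ k, γ k x * (d / x k ^ 2 + b k / (2 * x k) - 1)) *
      (MvPolynomial.eval x (svPoly d p) * expWeight b 1 x) ≤ 0 := by
  have hcone := (isOpen_orderedCone p).measurableSet
  have bdd : ∀ k {F : (Fin p → ℝ) → ℝ}, Integrable F →
      IntegrableOn (fun x => γ k x * F x) (orderedCone p) := by
    intro k F hF
    refine Integrable.bdd_mul (c := C) hF.integrableOn (hγm k).aestronglyMeasurable ?_
    refine (ae_restrict_mem hcone).mono fun x hx => ?_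
    rw [Real.norm_of_nonneg (hγ k x hx).1]
    exact (hγ k x hx).2
  have hint : IntegrableOn (fun x => (∑ k, γ k x * (d / x k ^ 2 + b k / (2 * x k) - 1)) *
      (MvPolynomial.eval x (svPoly d p) * expWeight b 1 x)) (orderedCone p) := by
    choose Q hQ using fun k : Fin p => exists_svPolyDiv_eq hd k
    have h : IntegrableOn (fun x => ∑ k, γ k x * (MvPolynomial.eval x (MvPolynomial.C (d : ℝ) * Q k +
        MvPolynomial.C (b k / 2) * svPolyDiv d k - svPoly d p) * expWeight b 1 x))
        (orderedCone p) :=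
      integrable_finsetSum _ fun k _ => bdd k (integrable_eval_mul_expWeight b one_pos _)
    refine h.congr_fun (fun x hx => ?_) hcone
    simp only
    rw [Finset.sum_mul]
    refine Finset.sum_congr rfl fun k _ => ?_
    have hk := (hx.2 k).ne'
    simp only [map_sub, map_add, map_mul, MvPolynomial.eval_C]
    rw [eval_svPoly d k, hQ k, map_mul, MvPolynomial.eval_X]
    field_simp
  refine ⟨hint, ?_⟩
  -- `G' k` is the derivative in direction `k` of `w / (2 xₖ)`, where `w` is the density
  set G' : Fin p → (Fin p → ℝ) → ℝ := fun k x => MvPolynomial.eval x (polyDeriv b 1 k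
    (MvPolynomial.C (1 / 2) * (MvPolynomial.X k ^ (2 * 0) * svPolyDiv d k * 1))) *
      expWeight b 1 x with hG'
  have hk : ∀ k, IntegrableOn (fun x => γ k x * G' k x) (orderedCone p) ∧
      ∫ x in orderedCone p, γ k x * G' k x ≤ 0 := fun k =>
    setIntegral_orderedCone_mul_deriv_nonpos (k := k)
      (fun x => hasDerivAt_eval_mul_expWeight b 1 _ x k)
      (integrable_eval_mul_expWeight b one_pos _) (integrable_eval_mul_expWeight b one_pos _)
      (fun x hx => by simp [eval_svPolyDiv_frontier hd k hx])
      (fun x hx => by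
        refine mul_nonneg ?_ (expWeight_pos _ _ _).le
        have := eval_svPolyDiv_pos d k hx
        simp only [mul_zero, pow_zero, one_mul, mul_one, map_mul, MvPolynomial.eval_C]
        positivity)
      (hγm k) (hγ k) (hmono k)
  calc _ ≤ ∫ x in orderedCone p, ∑ k, γ k x * G' k x := by
        refine setIntegral_mono_on hint (integrable_finsetSum _ fun k _ => (hk k).1) hcone
          fun x hx => ?_
        have e : ∀ k, γ k x * G' k x = (γ k x * (d / x k ^ 2 + b k / (2 * x k) - 1) +
            γ k x * ∑ q ∈ ltPairs p, 2 * ((if q.1 = k then 1 else 0) - (if q.2 = k then 1 else 0)) /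
              (x q.1 ^ 2 - x q.2 ^ 2)) *
            (MvPolynomial.eval x (svPoly d p) * expWeight b 1 x) := by
          intro k
          rw [hG']
          simp only
          rw [eval_polyDeriv_svPolyDiv d 0 k b 1 1 hx]
          simp
          ring
        simp_rw [e]
        rw [← Finset.sum_mul, Finset.sum_add_distrib, sum_mul_sum_ltPairs_delta]
        have hw : 0 ≤ MvPolynomial.eval x (svPoly d p) * expWeight b 1 x :=
          (mul_pos (eval_svPoly_pos d hx) (expWeight_pos _ _ _)).le
        refine mul_le_mul_of_nonneg_right (le_add_of_nonneg_right ?_) hw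
        refine Finset.sum_nonneg fun q hq => div_nonneg ?_ (sub_sq_pos hx (mem_ltPairs.1 hq)).le
        have := hanti x hx _ _ (mem_ltPairs.1 hq)
        linarith
    _ = ∑ k, ∫ x in orderedCone p, γ k x * G' k x := integral_finsetSum _ fun k _ => (hk k).1
    _ ≤ 0 := Finset.sum_nonpos fun k _ => (hk k).2

end Shrinkage

/-! ### Comparison of the moments -/

section Scaling
variable {p : ℕ}

theorem smul_mem_orderedCone {c : ℝ} (hc : 0 < c) {x : Fin p → ℝ} :
    c • x ∈ orderedCone p ↔ x ∈ orderedCone p := by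
  simp only [orderedCone, Set.mem_ofPred_eq, StrictAnti, Pi.smul_apply, smul_eq_mul,
    mul_pos_iff_of_pos_left hc, mul_lt_mul_iff_right₀ hc]

theorem two_mul_card_ltPairs (p : ℕ) : 2 * (ltPairs p).card + p = p * p := by
  have h := sum_eq_sum_diag_add_two_mul_sum_ltPairs (p := p) (fun _ _ => 1) (fun _ _ => rfl)
  simp only [Finset.sum_const, Finset.card_univ, Fintype.card_fin, nsmul_eq_mul, mul_one] at h
  have h' : ((p * p : ℕ) : ℝ) = ((2 * (ltPairs p).card + p : ℕ) : ℝ) := by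
    push_cast; linarith
  exact (Nat.cast_injective h').symm

/-- Homogeneity of the density; the factor `c ^ p` is the Jacobian of the dilation. -/
theorem eval_smul_svPoly (d : ℕ) (c : ℝ) (x : Fin p → ℝ) :
    c ^ p * MvPolynomial.eval (c • x) (svPoly d p) =
      c ^ (2 * (p + d) * p) * MvPolynomial.eval x (svPoly d p) := by
  have h : ∀ q : Fin p × Fin p, ((c * x q.1) ^ 2 - (c * x q.2) ^ 2) ^ 2 =
      c ^ 4 * (x q.1 ^ 2 - x q.2 ^ 2) ^ 2 := fun q => by ring
  simp only [svPoly, vandermondeSq, map_mul, map_prod, map_pow, map_sub, MvPolynomial.eval_X,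
    Pi.smul_apply, smul_eq_mul, h]
  simp only [mul_pow, Finset.prod_mul_distrib, Finset.prod_const, Finset.card_univ, Fintype.card_fin]
  have h1 : c ^ p * (c ^ (2 * d + 1)) ^ p * (c ^ 4) ^ (ltPairs p).card = c ^ (2 * (p + d) * p) := by
    rw [← pow_mul, ← pow_mul, ← pow_add, ← pow_add]
    congr 1
    have := two_mul_card_ltPairs p
    calc p + (2 * d + 1) * p + 4 * (ltPairs p).card
        = 2 * (2 * (ltPairs p).card + p) + 2 * d * p := by ring
      _ = _ := by rw [this]; ring
  rw [← h1]
  ring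

/-- The total mass scales with `β` in the same way as that of the Gaussian measure on matrices of size
`(p + d) × p`, so that the constant relating the two does not depend on `β`. -/
theorem svIntegral_one_scaling (d : ℕ) {β : ℝ} (hβ : 0 < β) :
    svIntegral (p := p) d 1 1 = β ^ ((p + d) * p) * svIntegral (p := p) d β 1 := by
  set c := Real.sqrt β with hc
  have hc0 : 0 < c := Real.sqrt_pos.2 hβ
  have hcone := (isOpen_orderedCone p).measurableSet
  unfold svIntegral
  rw [← integral_indicator hcone, ← integral_indicator hcone]
  have h := Measure.integral_comp_smul (volume : Measure (Fin p → ℝ))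
    ((orderedCone p).indicator fun x => MvPolynomial.eval x (svPoly d p * 1) * expWeight 0 1 x) c
  rw [Module.finrank_fin_fun, abs_of_pos (by positivity), smul_eq_mul,
    eq_inv_mul_iff_mul_eq₀ (by positivity)] at h
  rw [← h, ← integral_const_mul, ← integral_const_mul]
  congr 1 with x
  by_cases hx : x ∈ orderedCone p
  · rw [Set.indicator_of_mem ((smul_mem_orderedCone hc0).2 hx), Set.indicator_of_mem hx, mul_one,
      ← mul_assoc, eval_smul_svPoly, mul_assoc 2, pow_mul, Real.sq_sqrt hβ.le, mul_assoc]
    congr 2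
    unfold expWeight
    congr 1
    refine Finset.sum_congr rfl fun k _ => ?_
    simp only [Pi.zero_apply, Pi.smul_apply, smul_eq_mul, mul_pow, hc, Real.sq_sqrt hβ.le]
    ring
  · rw [Set.indicator_of_notMem (mt (smul_mem_orderedCone hc0).1 hx), Set.indicator_of_notMem hx]
    simp

theorem entryMoment_one {m p : ℕ} {β : ℝ} (hβ : 0 < β) :
    entryMoment m p β 1 = (Real.pi / β : ℂ) ^ (m * p) := by
  have h := entryMoment_monomial (m := m) (p := p) β 0
  rw [MvPolynomial.monomial_zero', map_one] at h
  rw [h]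
  have : ∀ q : Fin m × Fin p, ∫ z : ℂ, z ^ (0 : EntryVar m p →₀ ℕ) (.inl q) *
      (starRingEnd ℂ z) ^ (0 : EntryVar m p →₀ ℕ) (.inr q) * (Real.exp (-β * ‖z‖ ^ 2) : ℂ) =
      Real.pi / β := fun q => by
    simpa [div_eq_mul_inv] using integral_pow_mul_conj_pow_gaussian hβ 0 0
  rw [Finset.prod_congr rfl fun q _ => this q]
  simp [div_pow]

/-- All moments of the squared singular values of a Gaussian matrix agree, up to one constant, with
those of the density `svPoly`. -/
theorem exists_entryMoment_eq_svIntegral (m p : ℕ) (hmp : p < m) : ∃ c : ℝ, 0 < c ∧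
    ∀ β : ℝ, 0 < β → ∀ L : Multiset ℕ, entryMoment m p β (L.map (genTrace m p)).prod =
      c * (svIntegral (p := p) (m - p) β (L.map (psumSq p)).prod : ℂ) := by
  have hd : m - p ≠ 0 := by omega
  have hI : 0 < svIntegral (p := p) (m - p) 1 1 := by
    unfold svIntegral
    have hcone := (isOpen_orderedCone p).measurableSet
    rw [setIntegral_pos_iff_support_of_nonneg_ae]
    · have : (Function.support fun x => MvPolynomial.eval x (svPoly (m - p) p * 1) *
          expWeight 0 1 x) ∩ orderedCone p = orderedCone p := by
        refine Set.inter_eq_right.2 fun x hx => ?_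
        rw [mul_one]
        exact (mul_pos (eval_svPoly_pos _ hx) (expWeight_pos _ _ _)).ne'
      rw [this]
      -- the cone contains the point `(p, p - 1, …, 1)`
      refine (isOpen_orderedCone p).measure_pos _ ⟨fun k => p - k, fun i j hij => ?_, fun k => ?_⟩
      · have : ((i : ℕ) : ℝ) < (j : ℕ) := by exact_mod_cast hij
        linarith
      · have : ((k : ℕ) : ℝ) < p := by exact_mod_cast k.2
        linarith
    · refine (ae_restrict_mem hcone).mono fun x hx => ?_
      rw [mul_one]
      exact (mul_pos (eval_svPoly_pos _ hx) (expWeight_pos _ _ _)).le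
    · exact (integrable_eval_mul_expWeight 0 one_pos _).integrableOn
  refine ⟨Real.pi ^ (m * p) / svIntegral (p := p) (m - p) 1 1, by positivity, fun β hβ L => ?_⟩
  have h1 := traceRecursion_entryMoment (m := m) (p := p) hβ
  have h2 := traceRecursion_svIntegral (p := p) hd hβ
  rw [Nat.cast_sub hmp.le] at h2
  refine h1.eq_mul (by exact_mod_cast hβ.ne') h2 ?_ L
  simp only [Multiset.map_zero, Multiset.prod_zero]
  rw [entryMoment_one hβ]
  have h3 := svIntegral_one_scaling (p := p) (m - p) hβ
  rw [Nat.add_sub_cancel' hmp.le] at h3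
  have h4 : (Real.pi / β) ^ (m * p) = Real.pi ^ (m * p) / svIntegral (p := p) (m - p) 1 1 *
      svIntegral (p := p) (m - p) β 1 := by
    rw [div_mul_eq_mul_div, eq_div_iff hI.ne', h3, div_pow]
    field_simp
  exact_mod_cast congrArg (fun t : ℝ => (t : ℂ)) h4

end Scaling

/-! ### Singular values -/

section Chamber
variable {m p : ℕ}

/-- Power sums determine the multiset of values, since interpolation polynomials count
multiplicities. -/
theorem eq_of_antitone_of_powerSums {n : ℕ} {l l' : Fin n → ℝ} (hl : Antitone l) (hl' : Antitone l')
    (h : ∀ a : ℕ, ∑ k, l k ^ a = ∑ k, l' k ^ a) : l = l' := by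
  classical
  have hpoly : ∀ q : Polynomial ℝ, ∑ k, q.eval (l k) = ∑ k, q.eval (l' k) := by
    intro q
    simp_rw [Polynomial.eval_eq_sum_range]
    rw [Finset.sum_comm, Finset.sum_comm (s := Finset.univ)]
    refine Finset.sum_congr rfl fun a _ => ?_
    rw [← Finset.mul_sum, ← Finset.mul_sum, h]
  -- a polynomial vanishing at all values but `t` counts the multiplicity of `t`
  have hcount : ∀ t : ℝ, (Finset.univ.filter fun k => l k = t).card =
      (Finset.univ.filter fun k => l' k = t).card := by
    intro t
    set S : Finset ℝ := (Finset.univ.image l ∪ Finset.univ.image l').erase t with hS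
    set q : Polynomial ℝ := ∏ s ∈ S, (Polynomial.X - Polynomial.C s) with hq
    have hqe : ∀ y, q.eval y = ∏ s ∈ S, (y - s) := fun y => by
      rw [hq, Polynomial.eval_prod]; simp
    have hqt : q.eval t ≠ 0 := by
      rw [hqe]
      refine Finset.prod_ne_zero_iff.2 fun s hs => sub_ne_zero.2 (Finset.ne_of_mem_erase hs).symm
    have key : ∀ f : Fin n → ℝ, (∀ k, f k ∈ Finset.univ.image l ∪ Finset.univ.image l') →
        ∑ k, q.eval (f k) = (Finset.univ.filter fun k => f k = t).card * q.eval t := by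
      intro f hf
      have e : ∀ k, q.eval (f k) = if f k = t then q.eval t else 0 := by
        intro k
        split_ifs with hk
        · rw [hk]
        · rw [hqe]
          exact Finset.prod_eq_zero (Finset.mem_erase.2 ⟨hk, hf k⟩) (sub_self _)
      simp_rw [e]
      rw [← Finset.sum_filter, Finset.sum_const, nsmul_eq_mul]
    have h1 := hpoly q
    rw [key l fun k => by simp, key l' fun k => by simp] at h1
    exact_mod_cast mul_right_cancel₀ hqt h1
  have hperm : (List.ofFn l).Perm (List.ofFn l') := by
    rw [List.perm_iff_count]
    intro t
    have hc : ∀ f : Fin n → ℝ, (List.ofFn f).count t =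
        (Finset.univ.filter fun k => f k = t).card := by
      intro f
      have e : ((List.ofFn f : List ℝ) : Multiset ℝ) = Finset.univ.val.map f := by
        rw [List.ofFn_eq_map, ← Multiset.map_coe]
        rfl
      rw [← Multiset.coe_count, e, Multiset.count_map, Finset.card, Finset.filter_val]
      congr 1
      exact Multiset.filter_congr fun k _ => eq_comm
    rw [hc, hc, hcount]
  exact List.ofFn_injective (hperm.eq_of_sortedGE hl.sortedGE_ofFn hl'.sortedGE_ofFn)

/-- The closed chamber `x₁ ≥ ⋯ ≥ xₚ ≥ 0`. -/
def chamberSet (p : ℕ) : Set (Fin p → ℝ) := {x | Antitone x ∧ ∀ k, 0 ≤ x k}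

/-- The closed chamber as a type, in which singular values take their values. -/
abbrev Chamber (p : ℕ) : Type := chamberSet p

theorem isClosed_chamberSet (p : ℕ) : IsClosed (chamberSet p) := by
  have : chamberSet p = (⋂ i : Fin p, ⋂ j : Fin p, ⋂ _ : i ≤ j, {l | l j ≤ l i}) ∩
      ⋂ k : Fin p, {l | 0 ≤ l k} := by
    ext l
    simp [chamberSet, Antitone]
  rw [this]
  exact (isClosed_iInter fun i => isClosed_iInter fun j => isClosed_iInter fun _ =>
    isClosed_le (continuous_apply j) (continuous_apply i)).inter
    (isClosed_iInter fun k => isClosed_le continuous_const (continuous_apply k))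

instance : PolishSpace (Chamber p) := (isClosed_chamberSet p).polishSpace

theorem orderedCone_subset_chamberSet (p : ℕ) : orderedCone p ⊆ chamberSet p :=
  fun _ hx => ⟨hx.1.antitone, fun k => (hx.2 k).le⟩

/-- The power sums of the squares of a point of the chamber. -/
def powerSums (x : Chamber p) (a : ℕ) : ℝ := ∑ k, (x.1 k ^ 2) ^ a

/-- A point of the chamber is determined by the power sums of its squares. -/
theorem powerSums_injective : Function.Injective (powerSums (p := p)) := by
  intro x y h
  have hsq : ∀ z : Chamber p, Antitone fun k => z.1 k ^ 2 := fun z i j hij =>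
    pow_le_pow_left₀ (z.2.2 j) (z.2.1 hij) 2
  have h1 := eq_of_antitone_of_powerSums (hsq x) (hsq y) fun a => congrFun h a
  refine Subtype.ext (funext fun k => ?_)
  have h2 := congrFun h1 k
  exact (pow_left_inj₀ (x.2.2 k) (y.2.2 k) two_ne_zero).1 h2

theorem continuous_powerSums : Continuous (powerSums (p := p)) := by
  refine continuous_pi fun a => ?_
  change Continuous fun x : Chamber p => ∑ k, (x.1 k ^ 2) ^ a
  exact continuous_finsetSum _ fun k _ =>
    (((continuous_apply k).comp continuous_subtype_val).pow 2).pow a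

theorem conj_diagonal_pow {U : Matrix (Fin p) (Fin p) ℂ} (hU : U ∈ unitaryGroup (Fin p) ℂ)
    (d : Fin p → ℂ) (a : ℕ) :
    (U * diagonal d * Uᴴ) ^ a = U * diagonal (fun k => d k ^ a) * Uᴴ := by
  have hU1 : Uᴴ * U = 1 := (mem_unitaryGroup_iff').1 hU
  have hU2 : U * Uᴴ = 1 := (mem_unitaryGroup_iff).1 hU
  induction a with
  | zero => simp [hU2]
  | succ a ih =>
    rw [pow_succ, ih]
    calc U * diagonal (fun k => d k ^ a) * Uᴴ * (U * diagonal d * Uᴴ)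
        = U * diagonal (fun k => d k ^ a) * (Uᴴ * U) * diagonal d * Uᴴ := by
          simp only [Matrix.mul_assoc]
      _ = _ := by
          rw [hU1, Matrix.mul_one, Matrix.mul_assoc U, diagonal_mul_diagonal]
          simp only [pow_succ]

theorem IsSpectralDecomp.trace_pow {Z : Matrix (Fin m) (Fin p) ℂ} {U : Matrix (Fin p) (Fin p) ℂ}
    {l : Fin p → ℝ} (h : IsSpectralDecomp Z U l) (a : ℕ) :
    ((Zᴴ * Z) ^ a).trace = ((∑ k, l k ^ a : ℝ) : ℂ) := by
  have hU1 : Uᴴ * U = 1 := (mem_unitaryGroup_iff').1 h.1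
  rw [h.2, conj_diagonal_pow h.1, trace_mul_cycle, hU1, Matrix.one_mul, trace_diagonal]
  push_cast
  rfl

open scoped ComplexOrder in
/-- The spectral theorem for `Z* Z`, with the square roots of the eigenvalues sorted. -/
theorem exists_chamber_decomp (Z : Matrix (Fin m) (Fin p) ℂ) :
    ∃ x : Chamber p, ∃ U, IsSpectralDecomp Z U fun k => x.1 k ^ 2 := by
  have hpsd := posSemidef_conjTranspose_mul_self Z
  have hA := hpsd.isHermitian
  set U : Matrix (Fin p) (Fin p) ℂ := hA.eigenvectorUnitary.1 with hU
  have hUm : U ∈ unitaryGroup (Fin p) ℂ := hA.eigenvectorUnitary.2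
  set μ := hA.eigenvalues with hμ
  have hμ0 : ∀ k, 0 ≤ μ k := hpsd.eigenvalues_nonneg
  set σ : Equiv.Perm (Fin p) := Tuple.sort fun k => - μ k with hσ
  have hs : Antitone fun k => μ (σ k) := fun i j hij => by
    have := Tuple.monotone_sort (fun k => - μ k) hij
    simpa using this
  have hperm : ∀ d : Fin p → ℂ, U.submatrix id σ * diagonal (fun k => d (σ k)) *
      (U.submatrix id σ)ᴴ = U * diagonal d * Uᴴ := by
    intro d
    ext i j
    simp only [mul_apply (M := _ * diagonal _), mul_diagonal, submatrix_apply, id,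
      conjTranspose_apply]
    exact Equiv.sum_comp σ fun k => U i k * d k * star (U j k)
  refine ⟨⟨fun k => Real.sqrt (μ (σ k)), fun i j hij => Real.sqrt_le_sqrt (hs hij),
    fun k => Real.sqrt_nonneg _⟩, U.submatrix id σ, ?_, ?_⟩
  · rw [mem_unitaryGroup_iff]
    have h := hperm 1
    simp only [Pi.one_apply] at h
    have e : (diagonal fun _ : Fin p => (1 : ℂ)) = 1 := diagonal_one
    have e' : (diagonal (1 : Fin p → ℂ)) = 1 := diagonal_one
    rw [e, e', Matrix.mul_one, Matrix.mul_one] at h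
    exact h.trans ((mem_unitaryGroup_iff).1 hUm)
  · have h := hA.spectral_theorem
    rw [Unitary.conjStarAlgAut_apply] at h
    refine h.trans ((hperm _).symm.trans ?_)
    simp only [Real.sq_sqrt (hμ0 _)]
    rfl

/-- The singular values of `Z`, in decreasing order. -/
def sv (Z : Matrix (Fin m) (Fin p) ℂ) : Chamber p := (exists_chamber_decomp Z).choose

theorem exists_isSpectralDecomp_sv (Z : Matrix (Fin m) (Fin p) ℂ) :
    ∃ U, IsSpectralDecomp Z U fun k => (sv Z).1 k ^ 2 := (exists_chamber_decomp Z).choose_spec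

theorem powerSums_sv (Z : Matrix (Fin m) (Fin p) ℂ) (a : ℕ) :
    ((Zᴴ * Z) ^ a).trace = (powerSums (sv Z) a : ℂ) := by
  obtain ⟨U, hU⟩ := exists_isSpectralDecomp_sv Z
  exact hU.trace_pow a

theorem sv_eq_of_isSpectralDecomp {Z : Matrix (Fin m) (Fin p) ℂ} {U : Matrix (Fin p) (Fin p) ℂ}
    {x : Chamber p} (h : IsSpectralDecomp Z U fun k => x.1 k ^ 2) : sv Z = x := by
  refine powerSums_injective (funext fun a => ?_)
  have h1 := (powerSums_sv Z a).symm.trans (h.trace_pow a)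
  exact_mod_cast h1

theorem sum_norm_sq_eq_powerSums (Z : Matrix (Fin m) (Fin p) ℂ) :
    ∑ i, ∑ j, ‖Z i j‖ ^ 2 = powerSums (sv Z) 1 := by
  have h := powerSums_sv Z 1
  rw [pow_one] at h
  have h2 : loss Z 0 = powerSums (sv Z) 1 := by
    rw [loss, sub_zero, h, Complex.ofReal_re]
  rw [← h2, loss_eq_sum]
  simp

theorem measurable_matrix_mul {α : Type*} [MeasurableSpace α] {l n k : ℕ}
    {f : α → Matrix (Fin l) (Fin n) ℂ} {g : α → Matrix (Fin n) (Fin k) ℂ}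
    (hf : Measurable f) (hg : Measurable g) : Measurable fun x => f x * g x := by
  refine measurable_matrix fun i j => ?_
  simp only [mul_apply]
  refine Finset.measurable_sum _ fun r _ => ?_
  have h1 : Measurable fun x => f x i r := (measurable_entry i r).comp hf
  have h2 : Measurable fun x => g x r j := (measurable_entry r j).comp hg
  exact h1.mul h2

theorem measurable_conjTranspose :
    Measurable fun Z : Matrix (Fin m) (Fin p) ℂ => Zᴴ :=
  measurable_matrix fun i j => Complex.continuous_conj.measurable.comp (measurable_entry j i)

theorem measurable_gram_pow (a : ℕ) :
    Measurable fun Z : Matrix (Fin m) (Fin p) ℂ => (Zᴴ * Z) ^ a := by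
  induction a with
  | zero => simp
  | succ a ih =>
    simp only [pow_succ]
    exact measurable_matrix_mul ih (measurable_matrix_mul measurable_conjTranspose measurable_id)

/-- The power sums of the squared singular values are traces, hence measurable, and they determine the
singular values; an injective continuous map on a Polish space has a measurable inverse on its image. -/
theorem measurable_sv : Measurable (sv (m := m) (p := p)) := by
  have hemb := continuous_powerSums (p := p).measurableEmbedding powerSums_injective
  rw [← hemb.measurable_comp_iff]
  refine measurable_pi_iff.2 fun a => ?_
  have e : ∀ Z : Matrix (Fin m) (Fin p) ℂ, powerSums (sv Z) a = (((Zᴴ * Z) ^ a).trace).re := by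
    intro Z
    rw [powerSums_sv, Complex.ofReal_re]
  simp only [Function.comp, e, trace, diag_apply]
  refine Complex.measurable_re.comp (Finset.measurable_sum _ fun i _ => ?_)
  exact (measurable_entry i i).comp (measurable_gram_pow a)

end Chamber

/-! ### The law of the singular values -/

section Law
variable {m p : ℕ}

open scoped BoundedContinuousFunction in
/-- A finite measure on a Polish space is determined by the integrals of all finite products of a
point-separating family of bounded continuous functions. -/
theorem ext_of_forall_integral_multiset_prod {E ι : Type*} [TopologicalSpace E] [PolishSpace E]
    [MeasurableSpace E] [BorelSpace E] {P P' : Measure E} [IsFiniteMeasure P] [IsFiniteMeasure P']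
    (e : ι → E →ᵇ ℝ) (hsep : ∀ x y, (∀ i, e i x = e i y) → x = y)
    (h : ∀ L : Multiset ι, ∫ x, (L.map e).prod x ∂P = ∫ x, (L.map e).prod x ∂P') : P = P' := by
  let A : StarSubalgebra ℝ (E →ᵇ ℝ) :=
    { Algebra.adjoin ℝ (Set.range e) with
      star_mem' := fun {a} ha => by
        have : star a = a := by ext x; simp
        rw [this]; exact ha }
  have hAe : ∀ i, e i ∈ A := fun i => Algebra.subset_adjoin ⟨i, rfl⟩
  refine ext_of_forall_mem_subalgebra_integral_eq_of_polish (𝕜 := ℝ) (A := A) ?_ ?_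
  · intro x y hxy
    by_contra hc
    refine hxy (hsep x y fun i => ?_)
    by_contra hi
    exact hc ⟨e i, ⟨(e i).toContinuousMap, ⟨e i, hAe i, rfl⟩, rfl⟩, hi⟩
  · intro g hg
    have hg' : g ∈ Subalgebra.toSubmodule (Algebra.adjoin ℝ (Set.range e)) := hg
    rw [Algebra.adjoin_eq_span] at hg'
    induction hg' using Submodule.span_induction with
    | mem x hx =>
      obtain ⟨M, hM, rfl⟩ := Submonoid.exists_multiset_of_mem_closure hx
      obtain ⟨L, rfl⟩ : ∃ L : Multiset ι, L.map e = M := by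
        clear hx hg
        induction M using Multiset.induction_on with
        | empty => exact ⟨0, rfl⟩
        | cons a s ih =>
          obtain ⟨L, rfl⟩ := ih fun y hy => hM y (Multiset.mem_cons_of_mem hy)
          obtain ⟨i, rfl⟩ := hM a (Multiset.mem_cons_self _ _)
          exact ⟨i ::ₘ L, Multiset.map_cons _ _ _⟩
      exact h L
    | zero => simp
    | add x y hx hy ihx ihy =>
      have ex := ihx (by
        change x ∈ Subalgebra.toSubmodule (Algebra.adjoin ℝ (Set.range e))
        rwa [Algebra.adjoin_eq_span])
      have ey := ihy (by
        change y ∈ Subalgebra.toSubmodule (Algebra.adjoin ℝ (Set.range e))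
        rwa [Algebra.adjoin_eq_span])
      simp only [BoundedContinuousFunction.add_apply]
      rw [integral_add (x.integrable _) (y.integrable _),
        integral_add (x.integrable _) (y.integrable _), ex, ey]
    | smul c x hx ihx =>
      have ex := ihx (by
        change x ∈ Subalgebra.toSubmodule (Algebra.adjoin ℝ (Set.range e))
        rwa [Algebra.adjoin_eq_span])
      simp only [BoundedContinuousFunction.smul_apply, integral_smul, ex]

theorem evalEntries_genTrace (z : Fin m → Fin p → ℂ) (a : ℕ) :
    evalEntries z (genTrace m p a) = (powerSums (sv (of z)) a : ℂ) := by
  rw [← powerSums_sv]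
  have hZ : (genZ m p).map (evalEntries z) = of z := by
    ext i j; simp [genZ, evalEntries]
  have hZs : (genZs m p).map (evalEntries z) = (of z)ᴴ := by
    ext i j; simp [genZs, evalEntries]
  have hW : (evalEntries z).mapMatrix (genW m p) = (of z)ᴴ * of z := by
    rw [genW, RingHom.mapMatrix_apply, Matrix.map_mul, hZ, hZs]
  rw [← hW, ← map_pow]
  simp [genTrace, trace, map_sum]

theorem entryWeight_eq (β : ℝ) (z : Fin m → Fin p → ℂ) :
    entryWeight β z = (Real.exp (-β * powerSums (sv (of z)) 1) : ℂ) := by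
  rw [← sum_norm_sq_eq_powerSums, entryWeight, Finset.mul_sum, Real.exp_sum]
  push_cast
  refine Finset.prod_congr rfl fun i _ => ?_
  rw [Finset.mul_sum, Complex.exp_sum]
  rfl

theorem powerSums_nonneg (x : Chamber p) (a : ℕ) : 0 ≤ powerSums x a :=
  Finset.sum_nonneg fun _ _ => by positivity

theorem powerSums_mul_exp_le (x : Chamber p) (a : ℕ) :
    powerSums x a * Real.exp (-powerSums x 1) ≤ p * a.factorial := by
  have h1 : ∀ k, (x.1 k ^ 2) ^ a * Real.exp (-powerSums x 1) ≤ a.factorial := by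
    intro k
    have h2 : x.1 k ^ 2 ≤ powerSums x 1 := by
      have := Finset.single_le_sum (f := fun k => (x.1 k ^ 2) ^ 1)
        (fun k _ => by positivity) (Finset.mem_univ k)
      simpa [powerSums] using this
    have h3 := Real.pow_div_factorial_le_exp (powerSums x 1) (powerSums_nonneg x 1) a
    rw [div_le_iff₀ (by positivity)] at h3
    calc (x.1 k ^ 2) ^ a * Real.exp (-powerSums x 1)
        ≤ (Real.exp (powerSums x 1) * a.factorial) * Real.exp (-powerSums x 1) := by
          gcongr
          exact (pow_le_pow_left₀ (by positivity) h2 a).trans h3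
      _ = a.factorial := by
          rw [mul_right_comm, ← Real.exp_add, add_neg_cancel, Real.exp_zero, one_mul]
  rw [powerSums, Finset.sum_mul]
  refine (Finset.sum_le_sum fun k _ => h1 k).trans ?_
  simp

theorem continuous_powerSums_apply (a : ℕ) : Continuous fun x : Chamber p => powerSums x a :=
  (continuous_apply a).comp continuous_powerSums

open scoped BoundedContinuousFunction in
/-- The power sums, damped by a Gaussian factor so as to be bounded. -/
def dampedPowerSum (p a : ℕ) : Chamber p →ᵇ ℝ :=
  BoundedContinuousFunction.ofNormedAddCommGroup
    (fun x => powerSums x a * Real.exp (-powerSums x 1))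
    ((continuous_powerSums_apply a).mul
      (Real.continuous_exp.comp (continuous_powerSums_apply 1).neg)) (p * a.factorial) fun x => by
      rw [Real.norm_of_nonneg (mul_nonneg (powerSums_nonneg x a) (Real.exp_pos _).le)]
      exact powerSums_mul_exp_le x a

theorem dampedPowerSum_apply (a : ℕ) (x : Chamber p) :
    dampedPowerSum p a x = powerSums x a * Real.exp (-powerSums x 1) := rfl

/-- The damped power sums separate the points of the chamber. -/
theorem dampedPowerSum_separates (x y : Chamber p)
    (h : ∀ a, dampedPowerSum p a x = dampedPowerSum p a y) : x = y := by
  rcases p.eq_zero_or_pos with rfl | hp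
  · exact Subtype.ext (Subsingleton.elim _ _)
  have h0 := h 0
  simp only [dampedPowerSum_apply] at h0 h
  -- the function with index zero is `p exp (-∑ xₖ²)`
  have e0 : ∀ z : Chamber p, powerSums z 0 = p := fun z => by simp [powerSums]
  rw [e0, e0] at h0
  have h1 := mul_left_cancel₀ (by exact_mod_cast hp.ne') h0
  refine powerSums_injective (funext fun a => ?_)
  have ha := h a
  rw [h1] at ha
  exact mul_right_cancel₀ (Real.exp_pos _).ne' ha

theorem prod_dampedPowerSum_apply (L : Multiset ℕ) (x : Chamber p) :
    (L.map (dampedPowerSum p)).prod x =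
      (L.map (powerSums x)).prod * Real.exp (-(L.card : ℝ) * powerSums x 1) := by
  induction L using Multiset.induction_on with
  | empty => simp
  | cons a L ih =>
    simp only [Multiset.map_cons, Multiset.prod_cons, BoundedContinuousFunction.mul_apply, ih,
      dampedPowerSum_apply, Multiset.card_cons]
    rw [mul_mul_mul_comm, ← Real.exp_add]
    congr 2
    push_cast
    ring

theorem eval_prod_psumSq (L : Multiset ℕ) (x : Chamber p) :
    MvPolynomial.eval x.1 (L.map (psumSq p)).prod = (L.map (powerSums x)).prod := by
  induction L using Multiset.induction_on with
  | empty => simp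
  | cons a L ih => simp [ih, eval_psumSq, powerSums]

theorem evalEntries_prod_genTrace (L : Multiset ℕ) (z : Fin m → Fin p → ℂ) :
    evalEntries z (L.map (genTrace m p)).prod = ((L.map (powerSums (sv (of z)))).prod : ℝ) := by
  induction L using Multiset.induction_on with
  | empty => simp
  | cons a L ih => simp [ih, evalEntries_genTrace]

theorem expWeight_zero_eq (β : ℝ) (x : Chamber p) :
    expWeight 0 β x.1 = Real.exp (-β * powerSums x 1) := by
  simp [expWeight, powerSums, Finset.mul_sum]

/-- The unnormalised Gaussian measure `exp (-|Z|²) dZ` on complex matrices. -/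
def gaussMeasure (m p : ℕ) : Measure (Matrix (Fin m) (Fin p) ℂ) :=
  (matrixLebesgue m p).withDensity fun Z => ENNReal.ofReal (Real.exp (-∑ i, ∑ j, ‖Z i j‖ ^ 2))

/-- The measure on the ordered cone with density `svPoly d p` times the weight `exp (-|x|²)`. -/
def svMeasure (d p : ℕ) : Measure (Fin p → ℝ) :=
  (volume.restrict (orderedCone p)).withDensity fun x =>
    ENNReal.ofReal (MvPolynomial.eval x (svPoly d p) * expWeight 0 1 x)

theorem measurable_gaussWeight :
    Measurable fun Z : Matrix (Fin m) (Fin p) ℂ =>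
      ENNReal.ofReal (Real.exp (-∑ i, ∑ j, ‖Z i j‖ ^ 2)) := by
  refine ENNReal.measurable_ofReal.comp (Real.measurable_exp.comp (Measurable.neg ?_))
  exact Finset.measurable_sum _ fun i _ => Finset.measurable_sum _ fun j _ =>
    (measurable_norm.comp (measurable_entry i j)).pow_const 2

theorem measurable_svWeight (d : ℕ) :
    Measurable fun x : Fin p → ℝ =>
      ENNReal.ofReal (MvPolynomial.eval x (svPoly d p) * expWeight 0 1 x) := by
  refine ENNReal.measurable_ofReal.comp (Measurable.mul ?_ ?_)
  · exact (MvPolynomial.continuous_eval _).measurable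
  · unfold expWeight
    fun_prop

instance (d : ℕ) : IsFiniteMeasure (svMeasure d p) := by
  have h := (integrable_eval_mul_expWeight (p := p) 0 one_pos (svPoly d p)).integrableOn
    (s := orderedCone p)
  exact isFiniteMeasure_withDensity_ofReal h.2

theorem integral_gaussMeasure_prod (L : Multiset ℕ) :
    ((∫ Z, (L.map (dampedPowerSum p)).prod (sv Z) ∂gaussMeasure m p : ℝ) : ℂ) =
      entryMoment m p (1 + L.card) (L.map (genTrace m p)).prod := by
  rw [gaussMeasure, integral_withDensity_eq_integral_toReal_smul measurable_gaussWeight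
    (.of_forall fun _ => ENNReal.ofReal_lt_top), matrixLebesgue]
  have hemb : MeasurableEmbedding
      (Matrix.of : (Fin m → Fin p → ℂ) → Matrix (Fin m) (Fin p) ℂ) := MeasurableEmbedding.id
  rw [hemb.integral_map, entryMoment, ← integral_complex_ofReal]
  refine integral_congr_ae (.of_forall fun z => ?_)
  simp only [prod_dampedPowerSum_apply, evalEntries_prod_genTrace, entryWeight_eq,
    sum_norm_sq_eq_powerSums, ENNReal.toReal_ofReal (Real.exp_pos _).le, smul_eq_mul]
  rw [mul_left_comm, ← Real.exp_add, Complex.ofReal_mul]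
  congr 3
  ring

theorem integral_svMeasure_prod (d : ℕ) (L : Multiset ℕ) :
    ∫ x, (L.map (dampedPowerSum p)).prod x ∂((svMeasure d p).comap Subtype.val) =
      svIntegral d (1 + L.card) (L.map (psumSq p)).prod := by
  have hms := (isClosed_chamberSet p).measurableSet
  have e1 : ∀ x : Chamber p, (L.map (dampedPowerSum p)).prod x =
      (fun y : Fin p → ℝ => MvPolynomial.eval y (L.map (psumSq p)).prod *
        expWeight 0 L.card y) x.1 := fun x => by
    change _ = MvPolynomial.eval x.1 _ * expWeight 0 _ x.1
    rw [prod_dampedPowerSum_apply, eval_prod_psumSq, expWeight_zero_eq]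
  refine (integral_congr_ae (.of_forall e1)).trans ?_
  refine (integral_subtype_comap (μ := svMeasure d p) hms fun y : Fin p → ℝ =>
    MvPolynomial.eval y (L.map (psumSq p)).prod * expWeight 0 L.card y).trans ?_
  rw [svMeasure, restrict_withDensity hms,
    Measure.restrict_restrict hms, Set.inter_eq_right.2 (orderedCone_subset_chamberSet p),
    integral_withDensity_eq_integral_toReal_smul (measurable_svWeight d)
    (.of_forall fun _ => ENNReal.ofReal_lt_top), svIntegral]
  refine setIntegral_congr_fun (isOpen_orderedCone p).measurableSet fun x hx => ?_
  rw [ENNReal.toReal_ofReal (mul_pos (eval_svPoly_pos _ hx) (expWeight_pos _ _ _)).le, smul_eq_mul,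
    map_mul, mul_mul_mul_comm]
  congr 1
  rw [expWeight, expWeight, expWeight, ← Real.exp_add, ← Finset.sum_add_distrib]
  congr 1
  refine Finset.sum_congr rfl fun k _ => ?_
  simp only [Pi.zero_apply]
  ring

instance : IsFiniteMeasure (gaussMeasure m p) := by
  have h : Integrable (fun Z : Matrix (Fin m) (Fin p) ℂ => Real.exp (-∑ i, ∑ j, ‖Z i j‖ ^ 2))
      (matrixLebesgue m p) := by
    have hemb : MeasurableEmbedding
        (Matrix.of : (Fin m → Fin p → ℂ) → Matrix (Fin m) (Fin p) ℂ) := MeasurableEmbedding.id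
    rw [matrixLebesgue, hemb.integrable_map_iff]
    refine ((integrable_evalEntries (m := m) (p := p) one_pos 1).norm).congr
      (.of_forall fun z => ?_)
    simp only [map_one, one_mul, entryWeight_eq, Function.comp, sum_norm_sq_eq_powerSums]
    rw [Complex.norm_real, Real.norm_of_nonneg (Real.exp_pos _).le, neg_mul, one_mul]
  exact isFiniteMeasure_withDensity_ofReal h.2

/-- The singular values of a Gaussian matrix have, up to a constant, the density
`svPoly (m - p) p` times `exp (-|x|²)` on the ordered cone. -/
theorem exists_map_sv_gaussMeasure (m p : ℕ) (hmp : p < m) : ∃ c : ENNReal,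
    (gaussMeasure m p).map sv = c • (svMeasure (m - p) p).comap Subtype.val := by
  obtain ⟨c, hc, h⟩ := exists_entryMoment_eq_svIntegral m p hmp
  refine ⟨ENNReal.ofReal c, ?_⟩
  have : IsFiniteMeasure ((svMeasure (m - p) p).comap (Subtype.val : Chamber p → Fin p → ℝ)) := by
    infer_instance
  have : IsFiniteMeasure (ENNReal.ofReal c •
      (svMeasure (m - p) p).comap (Subtype.val : Chamber p → Fin p → ℝ)) :=
    Measure.smul_finite _ ENNReal.ofReal_ne_top
  refine ext_of_forall_integral_multiset_prod (dampedPowerSum p) dampedPowerSum_separates fun L => ?_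
  rw [integral_map measurable_sv.aemeasurable
    (BoundedContinuousFunction.continuous _).aestronglyMeasurable, integral_smul_measure,
    integral_svMeasure_prod, ENNReal.toReal_ofReal hc.le, smul_eq_mul]
  have h1 := h (1 + L.card) (by positivity) L
  rw [← integral_gaussMeasure_prod] at h1
  exact_mod_cast h1

end Law

/-! ### Unitary invariance and the singular value decomposition -/

section Unitary
variable {m p : ℕ}

theorem sum_norm_sq_eq_re_trace (Z : Matrix (Fin m) (Fin p) ℂ) :
    ∑ i, ∑ j, ‖Z i j‖ ^ 2 = ((Zᴴ * Z).trace).re := by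
  have h := loss_eq_sum Z 0
  simp only [loss, sub_zero, Matrix.zero_apply] at h
  exact h.symm

theorem sum_norm_sq_unitary_mul {A : Matrix (Fin m) (Fin m) ℂ} (hA : A ∈ unitaryGroup (Fin m) ℂ)
    {B : Matrix (Fin p) (Fin p) ℂ} (hB : B ∈ unitaryGroup (Fin p) ℂ)
    (Z : Matrix (Fin m) (Fin p) ℂ) :
    ∑ i, ∑ j, ‖(A * Z * B) i j‖ ^ 2 = ∑ i, ∑ j, ‖Z i j‖ ^ 2 := by
  have hA1 : Aᴴ * A = 1 := (mem_unitaryGroup_iff').1 hA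
  have hB2 : B * Bᴴ = 1 := (mem_unitaryGroup_iff).1 hB
  rw [sum_norm_sq_eq_re_trace, sum_norm_sq_eq_re_trace]
  have : (A * Z * B)ᴴ * (A * Z * B) = Bᴴ * (Zᴴ * Z) * B := by
    rw [conjTranspose_mul, conjTranspose_mul]
    calc Bᴴ * (Zᴴ * Aᴴ) * (A * Z * B) = Bᴴ * (Zᴴ * ((Aᴴ * A) * Z)) * B := by
          simp only [Matrix.mul_assoc]
      _ = _ := by rw [hA1, Matrix.one_mul]
  rw [this, trace_mul_cycle, hB2, Matrix.one_mul]

theorem measurable_mul_mul (A : Matrix (Fin m) (Fin m) ℂ) (B : Matrix (Fin p) (Fin p) ℂ) :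
    Measurable fun Z : Matrix (Fin m) (Fin p) ℂ => A * Z * B :=
  measurable_matrix_mul (measurable_matrix_mul measurable_const measurable_id) measurable_const

/-- Multiplication by `A` from the left and by `B` from the right, as a real linear map. -/
def mulMulLinear (A : Matrix (Fin m) (Fin m) ℂ) (B : Matrix (Fin p) (Fin p) ℂ) :
    (Fin m → Fin p → ℂ) →ₗ[ℝ] (Fin m → Fin p → ℂ) where
  toFun z := fun i j => (A * of z * B) i j
  map_add' z w := by
    have : of (z + w) = of z + of w := rfl
    ext i j
    simp only [this, Matrix.mul_add, Matrix.add_mul, Pi.add_apply, Matrix.add_apply]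
  map_smul' c z := by
    have : of (c • z) = c • of z := rfl
    ext i j
    simp only [this, Matrix.mul_smul, Matrix.smul_mul, Pi.smul_apply, Matrix.smul_apply,
       RingHom.id_apply]

instance : (volume : Measure (Fin m → Fin p → ℂ)).IsAddHaarMeasure :=
  have h : (volume : Measure (Fin p → ℂ)).IsAddHaarMeasure :=
    inferInstanceAs (Measure.pi fun _ : Fin p => (volume : Measure ℂ)).IsAddHaarMeasure
  @Measure.pi.isAddHaarMeasure (Fin m) (fun _ => Fin p → ℂ) _ _ (fun _ => volume)
    (fun _ => inferInstance) _ _ (fun _ => h) _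

theorem measure_univ_gaussMeasure_ne_zero : gaussMeasure m p Set.univ ≠ 0 := by
  rw [gaussMeasure, withDensity_apply _ MeasurableSet.univ, Measure.restrict_univ,
    ← pos_iff_ne_zero, lintegral_pos_iff_support measurable_gaussWeight]
  have : (Function.support fun Z : Matrix (Fin m) (Fin p) ℂ =>
      ENNReal.ofReal (Real.exp (-∑ i, ∑ j, ‖Z i j‖ ^ 2))) = Set.univ := by
    ext Z
    simp [Real.exp_pos]
  rw [this, matrixLebesgue, Measure.map_apply measurable_of MeasurableSet.univ, Set.preimage_univ]
  exact Measure.measure_univ_pos.2 (NeZero.ne _)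

/-- The Gaussian measure is invariant under multiplication by unitary matrices. The determinant of the
linear map is not needed: its modulus is one because the total mass is preserved. -/
theorem map_mul_mul_gaussMeasure {A : Matrix (Fin m) (Fin m) ℂ}
    (hA : A ∈ unitaryGroup (Fin m) ℂ) {B : Matrix (Fin p) (Fin p) ℂ}
    (hB : B ∈ unitaryGroup (Fin p) ℂ) :
    (gaussMeasure m p).map (fun Z => A * Z * B) = gaussMeasure m p := by
  have hA1 : Aᴴ * A = 1 := (mem_unitaryGroup_iff').1 hA
  have hB2 : B * Bᴴ = 1 := (mem_unitaryGroup_iff).1 hB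
  have hinj : Function.Injective (mulMulLinear A B) := by
    intro z w h
    have h1 : A * of z * B = A * of w * B := by
      ext i j
      exact congrFun (congrFun h i) j
    have h2 := congrArg (fun M => Aᴴ * M * Bᴴ) h1
    have e : ∀ Z : Matrix (Fin m) (Fin p) ℂ, Aᴴ * (A * Z * B) * Bᴴ = Z := by
      intro Z
      calc Aᴴ * (A * Z * B) * Bᴴ = (Aᴴ * A) * Z * (B * Bᴴ) := by simp only [Matrix.mul_assoc]
        _ = Z := by rw [hA1, hB2, Matrix.one_mul, Matrix.mul_one]
    simp only [e] at h2
    exact h2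
  have hdet : LinearMap.det (mulMulLinear A B) ≠ 0 := by
    have := LinearEquiv.isUnit_det' (LinearEquiv.ofInjectiveEndo _ hinj)
    exact this.ne_zero
  -- Lebesgue measure is scaled by a constant, and so is the Gaussian measure
  have hleb : (matrixLebesgue m p).map (fun Z => A * Z * B) =
      ENNReal.ofReal |(LinearMap.det (mulMulLinear A B))⁻¹| • matrixLebesgue m p := by
    have h := Measure.map_linearMap_addHaar_eq_smul_addHaar
      (volume : Measure (Fin m → Fin p → ℂ)) hdet
    have hm : Measurable (mulMulLinear A B) :=
      (LinearMap.continuous_of_finiteDimensional _).measurable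
    rw [matrixLebesgue, Measure.map_map (measurable_mul_mul A B) measurable_of,
      ← Measure.map_smul, ← h, Measure.map_map measurable_of hm]
    rfl
  set κ := ENNReal.ofReal |(LinearMap.det (mulMulLinear A B))⁻¹| with hκ
  have hG : (gaussMeasure m p).map (fun Z => A * Z * B) = κ • gaussMeasure m p := by
    ext s hs
    rw [Measure.map_apply (measurable_mul_mul A B) hs, gaussMeasure,
      withDensity_apply _ (measurable_mul_mul A B hs), Measure.smul_apply, withDensity_apply _ hs,
      ← lintegral_smul_measure, ← Measure.restrict_smul, ← hleb,
      setLIntegral_map hs measurable_gaussWeight (measurable_mul_mul A B)]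
    simp only [sum_norm_sq_unitary_mul hA hB]
  have hmass := congrArg (fun μ : Measure _ => μ Set.univ) hG
  simp only [Measure.map_apply (measurable_mul_mul A B) MeasurableSet.univ, Set.preimage_univ,
    Measure.smul_apply, smul_eq_mul] at hmass
  have hκ1 : κ = 1 := by
    have := (ENNReal.mul_left_inj measure_univ_gaussMeasure_ne_zero
      (measure_ne_top (gaussMeasure m p) Set.univ) (a := 1) (b := κ)).1 (by rw [one_mul]; exact hmass)
    exact this.symm
  rw [hG, hκ1, one_smul]

/-- The rectangular `m × p` matrix with diagonal `x`. -/
def rectDiag (m : ℕ) {p : ℕ} (x : Fin p → ℝ) : Matrix (Fin m) (Fin p) ℂ :=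
  of fun i k => if (i : ℕ) = k then (x k : ℂ) else 0

/-- Singular value decomposition of a matrix of full column rank. -/
theorem exists_eq_mul_rectDiag_mul (hmp : p ≤ m) {Z : Matrix (Fin m) (Fin p) ℂ}
    {U : Matrix (Fin p) (Fin p) ℂ} {x : Fin p → ℝ} (hx : ∀ k, 0 < x k)
    (h : IsSpectralDecomp Z U fun k => x k ^ 2) :
    ∃ V ∈ unitaryGroup (Fin m) ℂ, Z = V * rectDiag m x * Uᴴ := by
  have hU1 : Uᴴ * U = 1 := (mem_unitaryGroup_iff').1 h.1
  have hU2 : U * Uᴴ = 1 := (mem_unitaryGroup_iff).1 h.1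
  have hgram : (Z * U)ᴴ * (Z * U) = diagonal fun k => ((x k ^ 2 : ℝ) : ℂ) := by
    rw [conjTranspose_mul]
    calc Uᴴ * Zᴴ * (Z * U) = Uᴴ * (Zᴴ * Z) * U := by simp only [Matrix.mul_assoc]
      _ = (Uᴴ * U) * diagonal (fun k => ((x k ^ 2 : ℝ) : ℂ)) * (Uᴴ * U) := by
          rw [h.2]; simp only [Matrix.mul_assoc]
      _ = _ := by rw [hU1, Matrix.one_mul, Matrix.mul_one]
  -- the normalised columns of `Z U` are orthonormal
  let v : Fin m → EuclideanSpace ℂ (Fin m) := fun i =>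
    if hi : (i : ℕ) < p then WithLp.toLp 2 fun r => ((x ⟨i, hi⟩ : ℂ))⁻¹ * (Z * U) r ⟨i, hi⟩ else 0
  let s : Set (Fin m) := {i | (i : ℕ) < p}
  have hv : Orthonormal ℂ (s.domRestrict v) := by
    rw [orthonormal_iff_ite]
    rintro ⟨i, hi⟩ ⟨j, hj⟩
    have hi' : (i : ℕ) < p := hi
    have hj' : (j : ℕ) < p := hj
    have e := congrFun (congrFun hgram ⟨i, hi'⟩) ⟨j, hj'⟩
    simp only [mul_apply (M := (Z * U)ᴴ), conjTranspose_apply, diagonal_apply] at e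
    have hvi : s.domRestrict v ⟨i, hi⟩ =
        WithLp.toLp 2 fun r => ((x ⟨i, hi'⟩ : ℂ))⁻¹ * (Z * U) r ⟨i, hi'⟩ := dif_pos hi'
    have hvj : s.domRestrict v ⟨j, hj⟩ =
        WithLp.toLp 2 fun r => ((x ⟨j, hj'⟩ : ℂ))⁻¹ * (Z * U) r ⟨j, hj'⟩ := dif_pos hj'
    rw [hvi, hvj]
    simp only [PiLp.inner_apply, RCLike.inner_apply, map_mul, map_inv₀, Complex.conj_ofReal,
      Subtype.mk.injEq]
    have e2 : ∀ r, (x ⟨j, hj'⟩ : ℂ)⁻¹ * (Z * U) r ⟨j, hj'⟩ *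
        ((x ⟨i, hi'⟩ : ℂ)⁻¹ * (starRingEnd ℂ) ((Z * U) r ⟨i, hi'⟩)) =
        (x ⟨j, hj'⟩ : ℂ)⁻¹ * (x ⟨i, hi'⟩ : ℂ)⁻¹ *
          (star ((Z * U) r ⟨i, hi'⟩) * (Z * U) r ⟨j, hj'⟩) := by
      intro r
      rw [starRingEnd_apply]
      ring
    rw [Finset.sum_congr rfl fun r _ => e2 r, ← Finset.mul_sum, e]
    by_cases hij : i = j
    · subst hij
      have : (x ⟨i, hi'⟩ : ℂ) ≠ 0 := by exact_mod_cast (hx _).ne'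
      simp only [if_true]
      push_cast
      field_simp
    · have : (⟨i, hi'⟩ : Fin p) ≠ ⟨j, hj'⟩ := fun hc => hij (Fin.ext (Fin.mk.inj_iff.1 hc))
      simp [hij, this]
  obtain ⟨b, hb⟩ := hv.exists_orthonormalBasis_extension_of_card_eq (by simp)
  refine ⟨of fun r i => b i r, ?_, ?_⟩
  · rw [mem_unitaryGroup_iff']
    ext i j
    have := b.inner_eq_ite i j
    rw [PiLp.inner_apply] at this
    simp only [star_eq_conjTranspose, mul_apply, conjTranspose_apply, of_apply, one_apply]
    rw [← this]
    refine Finset.sum_congr rfl fun r _ => ?_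
    rw [RCLike.inner_apply, starRingEnd_apply, mul_comm]
  · have e : Z * U = (of fun r i => b i r) * rectDiag m x := by
      ext r k
      have hk : ((Fin.castLE hmp k : Fin m) : ℕ) < p := k.2
      rw [mul_apply (M := of _), Finset.sum_eq_single (Fin.castLE hmp k)]
      · rw [of_apply, hb _ hk]
        have : (x k : ℂ) ≠ 0 := by exact_mod_cast (hx _).ne'
        simp only [v, dif_pos hk, rectDiag, of_apply, Fin.val_castLE, if_true, Fin.eta]
        field_simp
      · intro i _ hi
        have : (i : ℕ) ≠ k := fun hc => hi (Fin.ext hc)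
        simp [rectDiag, this]
      · simp
    rw [← e, Matrix.mul_assoc, hU2, Matrix.mul_one]

end Unitary

/-! ### Disintegration over the unitary groups -/

section Haar
variable {m p n : ℕ}

instance : BorelSpace (Matrix (Fin m) (Fin p) ℂ) :=
  inferInstanceAs (BorelSpace (Fin m → Fin p → ℂ))

theorem isCompact_unitaryGroup (n : ℕ) :
    IsCompact (unitaryGroup (Fin n) ℂ : Set (Matrix (Fin n) (Fin n) ℂ)) := by
  have hc : IsCompact (Set.pi Set.univ fun _ : Fin n => Set.pi Set.univ fun _ : Fin n =>
      Metric.closedBall (0 : ℂ) 1) :=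
    isCompact_univ_pi fun _ => isCompact_univ_pi fun _ => isCompact_closedBall _ _
  refine IsCompact.of_isClosed_subset (X := Matrix (Fin n) (Fin n) ℂ) hc isClosed_unitary
    fun U hU i _ j _ => ?_
  rw [mem_closedBall_zero_iff]
  exact entry_norm_bound_of_unitary hU i j

instance : CompactSpace (unitaryGroup (Fin n) ℂ) :=
  isCompact_iff_compactSpace.1 (isCompact_unitaryGroup n)

theorem conjTranspose_mem_unitaryGroup (V : unitaryGroup (Fin n) ℂ) :
    V.1ᴴ ∈ unitaryGroup (Fin n) ℂ := (V⁻¹).2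

/-- The Haar probability measure of the unitary group. -/
def unitaryHaar (n : ℕ) : Measure (unitaryGroup (Fin n) ℂ) := Measure.haarMeasure ⊤

instance : IsProbabilityMeasure (unitaryHaar n) :=
  ⟨by
    have := Measure.haarMeasure_self (K₀ := (⊤ : TopologicalSpace.PositiveCompacts
      (unitaryGroup (Fin n) ℂ)))
    exact this⟩

theorem measurable_unitary_coe :
    Measurable fun U : unitaryGroup (Fin n) ℂ => (U : Matrix (Fin n) (Fin n) ℂ) :=
  measurable_subtype_coe

theorem lintegral_unitaryHaar_mul_left (V : unitaryGroup (Fin n) ℂ)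
    (f : unitaryGroup (Fin n) ℂ → ENNReal) :
    ∫⁻ U, f (V * U) ∂unitaryHaar n = ∫⁻ U, f U ∂unitaryHaar n := by
  have : (unitaryHaar n).IsMulLeftInvariant := by
    unfold unitaryHaar; infer_instance
  exact lintegral_mul_left_eq_self f V

theorem measurable_rectDiag : Measurable (rectDiag m (p := p)) := by
  refine measurable_matrix fun i k => ?_
  unfold rectDiag
  simp only [of_apply]
  split_ifs
  · exact Complex.measurable_ofReal.comp (measurable_pi_apply k)
  · exact measurable_const

/-- The average of a function over the orbit of a matrix under both unitary groups. -/
def orbitAverage (φ : Matrix (Fin m) (Fin p) ℂ → ENNReal) (Z : Matrix (Fin m) (Fin p) ℂ) :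
    ENNReal :=
  ∫⁻ V, ∫⁻ U, φ (V.1ᴴ * Z * U.1) ∂unitaryHaar p ∂unitaryHaar m

/-- Invariance of the Haar measures makes the average depend only on the orbit. -/
theorem orbitAverage_mul_mul (φ : Matrix (Fin m) (Fin p) ℂ → ENNReal)
    (Z : Matrix (Fin m) (Fin p) ℂ) {A : Matrix (Fin m) (Fin m) ℂ}
    (hA : A ∈ unitaryGroup (Fin m) ℂ) {B : Matrix (Fin p) (Fin p) ℂ}
    (hB : B ∈ unitaryGroup (Fin p) ℂ) :
    orbitAverage φ (A * Z * Bᴴ) = orbitAverage φ Z := by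
  have h1 : ∀ V : unitaryGroup (Fin m) ℂ,
      ∫⁻ U : unitaryGroup (Fin p) ℂ, φ (V.1ᴴ * (A * Z * Bᴴ) * U.1)
        ∂unitaryHaar p =
      ∫⁻ U : unitaryGroup (Fin p) ℂ,
        φ ((⟨A, hA⟩⁻¹ * V : unitaryGroup (Fin m) ℂ).1ᴴ * Z * U.1)
        ∂unitaryHaar p := by
    intro V
    refine Eq.trans ?_ (lintegral_unitaryHaar_mul_left ⟨B, hB⟩⁻¹
      fun U => φ ((⟨A, hA⟩⁻¹ * V : unitaryGroup (Fin m) ℂ).1ᴴ * Z * U.1))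
    refine lintegral_congr fun U => ?_
    congr 1
    change V.1ᴴ * (A * Z * Bᴴ) * U.1 =
      (Aᴴ * V.1)ᴴ * Z * (Bᴴ * U.1)
    rw [conjTranspose_mul, conjTranspose_conjTranspose]
    simp only [Matrix.mul_assoc]
  unfold orbitAverage
  simp_rw [h1]
  exact lintegral_unitaryHaar_mul_left ⟨A, hA⟩⁻¹ fun V => ∫⁻ U : unitaryGroup (Fin p) ℂ,
        φ (V.1ᴴ * Z * U.1) ∂unitaryHaar p

theorem measurable_orbit {φ : Matrix (Fin m) (Fin p) ℂ → ENNReal} (hφ : Measurable φ)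
    {α : Type*} [MeasurableSpace α] {f : α → unitaryGroup (Fin m) ℂ}
    {g : α → Matrix (Fin m) (Fin p) ℂ} {h : α → unitaryGroup (Fin p) ℂ}
    (hf : Measurable f) (hg : Measurable g) (hh : Measurable h) :
    Measurable fun x => φ ((f x).1ᴴ * g x * (h x).1) := by
  refine hφ.comp (measurable_matrix_mul (measurable_matrix_mul ?_ hg) ?_)
  · have := measurable_conjTranspose.comp (measurable_unitary_coe.comp hf)
    exact this
  · have := measurable_unitary_coe.comp hh
    exact this

/-- By unitary invariance of the Gaussian measure `G`, a function may be averaged over orbits. -/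
theorem lintegral_orbitAverage {φ : Matrix (Fin m) (Fin p) ℂ → ENNReal} (hφ : Measurable φ) :
    ∫⁻ Z, orbitAverage φ Z ∂gaussMeasure m p = ∫⁻ Z, φ Z ∂gaussMeasure m p := by
  unfold orbitAverage
  rw [lintegral_lintegral_swap]
  · have h : ∀ V : unitaryGroup (Fin m) ℂ, ∫⁻ Z, ∫⁻ U : unitaryGroup (Fin p) ℂ,
        φ (V.1ᴴ * Z * U.1) ∂unitaryHaar p ∂gaussMeasure m p =
        ∫⁻ Z, φ Z ∂gaussMeasure m p := by
      intro V
      rw [lintegral_lintegral_swap]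
      · have h2 : ∀ U : unitaryGroup (Fin p) ℂ,
            ∫⁻ Z, φ (V.1ᴴ * Z * U.1) ∂gaussMeasure m p =
            ∫⁻ Z, φ Z ∂gaussMeasure m p := by
          intro U
          rw [← lintegral_map hφ (measurable_mul_mul _ _),
            map_mul_mul_gaussMeasure (conjTranspose_mem_unitaryGroup V) U.2]
        simp_rw [h2]
        simp
      · exact (measurable_orbit hφ measurable_const measurable_fst measurable_snd).aemeasurable
    simp_rw [h]
    simp
  · exact (Measurable.lintegral_prod_right (measurable_orbit hφ
      (measurable_snd.comp measurable_fst) (measurable_fst.comp measurable_fst)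
      measurable_snd)).aemeasurable

theorem measurable_orbitAverage {φ : Matrix (Fin m) (Fin p) ℂ → ENNReal} (hφ : Measurable φ) :
    Measurable (orbitAverage φ) := by
  unfold orbitAverage
  refine Measurable.lintegral_prod_right ?_
  exact Measurable.lintegral_prod_right (measurable_orbit hφ
      (measurable_snd.comp measurable_fst) (measurable_fst.comp measurable_fst)
      measurable_snd)

theorem ae_sv_mem_orderedCone (hmp : p < m) :
    ∀ᵐ Z ∂gaussMeasure m p, (sv Z).1 ∈ orderedCone p := by
  obtain ⟨c, hc⟩ := exists_map_sv_gaussMeasure m p hmp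
  have hcone := (isOpen_orderedCone p).measurableSet
  have h : ∀ᵐ x ∂(gaussMeasure m p).map sv, x.1 ∈ orderedCone p := by
    rw [hc]
    refine Measure.ae_smul_measure ?_ c
    have h1 : ∀ᵐ x ∂svMeasure (m - p) p, x ∈ orderedCone p :=
      (withDensity_absolutelyContinuous _ _).ae_le (ae_restrict_mem hcone)
    refine ae_of_ae_map measurable_subtype_coe.aemeasurable ?_
    rw [map_comap_subtype_coe (isClosed_chamberSet p).measurableSet]
    exact ae_restrict_of_ae h1
  exact ae_of_ae_map measurable_sv.aemeasurable h

/-- A Gaussian integral is, up to a constant, the integral over the ordered cone of the orbit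
averages at the rectangular diagonal matrices. -/
theorem exists_lintegral_gaussMeasure_eq (m p : ℕ) (hmp : p < m) : ∃ c : ENNReal,
    ∀ φ : Matrix (Fin m) (Fin p) ℂ → ENNReal, Measurable φ →
      ∫⁻ Z, φ Z ∂gaussMeasure m p =
        c * ∫⁻ x, orbitAverage φ (rectDiag m x) ∂svMeasure (m - p) p := by
  obtain ⟨c, hc⟩ := exists_map_sv_gaussMeasure m p hmp
  refine ⟨c, fun φ hφ => ?_⟩
  have hms := (isClosed_chamberSet p).measurableSet
  have hΨ : Measurable fun x : Fin p → ℝ => orbitAverage φ (rectDiag m x) :=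
    (measurable_orbitAverage hφ).comp measurable_rectDiag
  have h1 : ∀ᵐ Z ∂gaussMeasure m p, orbitAverage φ Z = orbitAverage φ (rectDiag m (sv Z).1) := by
    filter_upwards [ae_sv_mem_orderedCone hmp] with Z hZ
    obtain ⟨U, hU⟩ := exists_isSpectralDecomp_sv Z
    obtain ⟨V, hV, e⟩ := exists_eq_mul_rectDiag_mul hmp.le hZ.2 hU
    conv_lhs => rw [e]
    exact orbitAverage_mul_mul φ _ hV hU.1
  have h2 := lintegral_map (μ := gaussMeasure m p)
    (f := fun x : Chamber p => orbitAverage φ (rectDiag m x.1))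
    (hΨ.comp measurable_subtype_coe) measurable_sv
  have h3 : (svMeasure (m - p) p).restrict (chamberSet p) = svMeasure (m - p) p := by
    rw [svMeasure, restrict_withDensity hms, Measure.restrict_restrict hms,
      Set.inter_eq_right.2 (orderedCone_subset_chamberSet p)]
  rw [← lintegral_orbitAverage hφ, lintegral_congr_ae h1, ← h2, hc, lintegral_smul_measure,
    smul_eq_mul]
  congr 1
  refine (lintegral_subtype_comap hms
    fun x : Fin p → ℝ => orbitAverage φ (rectDiag m x)).trans ?_
  rw [h3]

/-- Gaussian integrals may be compared one pair `(V, U)` of singular frames at a time. -/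
theorem lintegral_gaussMeasure_mono (hmp : p < m) {φ ψ : Matrix (Fin m) (Fin p) ℂ → ENNReal}
    (hφ : Measurable φ) (hψ : Measurable ψ)
    (h : ∀ V ∈ unitaryGroup (Fin m) ℂ, ∀ U ∈ unitaryGroup (Fin p) ℂ,
      ∫⁻ x, φ (V * rectDiag m x * U) ∂svMeasure (m - p) p ≤
        ∫⁻ x, ψ (V * rectDiag m x * U) ∂svMeasure (m - p) p) :
    ∫⁻ Z, φ Z ∂gaussMeasure m p ≤ ∫⁻ Z, ψ Z ∂gaussMeasure m p := by
  obtain ⟨c, hc⟩ := exists_lintegral_gaussMeasure_eq m p hmp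
  have hswap : ∀ f : Matrix (Fin m) (Fin p) ℂ → ENNReal, Measurable f →
      ∫⁻ x, orbitAverage f (rectDiag m x) ∂svMeasure (m - p) p =
      ∫⁻ V : unitaryGroup (Fin m) ℂ, ∫⁻ U : unitaryGroup (Fin p) ℂ,
        ∫⁻ x, f (V.1ᴴ * rectDiag m x * U.1)
          ∂svMeasure (m - p) p ∂unitaryHaar p ∂unitaryHaar m := by
    intro f hf
    unfold orbitAverage
    rw [lintegral_lintegral_swap]
    · refine lintegral_congr fun V => ?_
      rw [lintegral_lintegral_swap]
      exact (measurable_orbit hf measurable_const (measurable_rectDiag.comp measurable_fst)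
        measurable_snd).aemeasurable
    · exact (Measurable.lintegral_prod_right (measurable_orbit hf
        (measurable_snd.comp measurable_fst)
        (measurable_rectDiag.comp (measurable_fst.comp measurable_fst))
        measurable_snd)).aemeasurable
  rw [hc φ hφ, hc ψ hψ, hswap φ hφ, hswap ψ hψ]
  refine mul_le_mul_right (lintegral_mono fun V => lintegral_mono fun U => ?_) c
  exact
    h _ (conjTranspose_mem_unitaryGroup V) _ U.2

end Haar

/-! ### Shrinking singular values does not increase the risk -/

section Risk
variable {m p : ℕ}

/-- The density of the normal distribution with mean `Ξ` with respect to `gaussMeasure`. -/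
def tilt (Ξ Z : Matrix (Fin m) (Fin p) ℂ) : ℝ :=
  (Real.pi⁻¹) ^ (m * p) * Real.exp (∑ i, ∑ j, ‖Z i j‖ ^ 2 - loss Z Ξ)

theorem measurable_tilt (Ξ : Matrix (Fin m) (Fin p) ℂ) :
    Measurable fun Z => ENNReal.ofReal (tilt Ξ Z) := by
  simp only [tilt, loss_eq_sum]
  refine ENNReal.measurable_ofReal.comp ((Real.measurable_exp.comp
    (Measurable.sub ?_ ?_)).const_mul _)
  · exact Finset.measurable_sum _ fun i _ => Finset.measurable_sum _ fun j _ =>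
      (measurable_norm.comp (measurable_entry i j)).pow_const 2
  · exact Finset.measurable_sum _ fun i _ => Finset.measurable_sum _ fun j _ =>
      (((measurable_entry i j).sub_const _).norm).pow_const 2

theorem matrixDensity_one_eq (Ξ Z : Matrix (Fin m) (Fin p) ℂ) :
    matrixDensity 1 Ξ Z =
      ENNReal.ofReal (Real.exp (-∑ i, ∑ j, ‖Z i j‖ ^ 2)) * ENNReal.ofReal (tilt Ξ Z) := by
  rw [← ENNReal.ofReal_mul (Real.exp_pos _).le, tilt, mul_left_comm, ← Real.exp_add,
    loss_eq_sum]
  have e : -∑ i, ∑ j, ‖Z i j‖ ^ 2 + (∑ i, ∑ j, ‖Z i j‖ ^ 2 - ∑ i, ∑ j, ‖Z i j - Ξ i j‖ ^ 2) =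
      ∑ i, ∑ j, -‖Z i j - Ξ i j‖ ^ 2 := by
    simp only [Finset.sum_neg_distrib]
    ring
  have hpi : (Real.pi⁻¹) ^ (m * p) = ∏ _i : Fin m, ∏ _j : Fin p, Real.pi⁻¹ := by
    simp [pow_mul']
  rw [e, Real.exp_sum, hpi, ← Finset.prod_mul_distrib,
    ENNReal.ofReal_prod_of_nonneg fun i _ => by positivity, matrixDensity]
  refine Finset.prod_congr rfl fun i _ => ?_
  rw [Real.exp_sum, ← Finset.prod_mul_distrib,
    ENNReal.ofReal_prod_of_nonneg fun j _ => by positivity]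
  refine Finset.prod_congr rfl fun j _ => ?_
  simp [gaussDensity]

theorem risk_eq_lintegral_gaussMeasure {δ : Matrix (Fin m) (Fin p) ℂ → Matrix (Fin m) (Fin p) ℂ}
    (hδ : Measurable δ) (Ξ : Matrix (Fin m) (Fin p) ℂ) :
    risk δ Ξ =
      ∫⁻ Z, ENNReal.ofReal (loss (δ Z) Ξ) * ENNReal.ofReal (tilt Ξ Z) ∂gaussMeasure m p := by
  have hl := measurable_loss hδ (measurable_const (a := Ξ))
  have ht := measurable_tilt Ξ
  have e : (matrixLebesgue m p).withDensity (matrixDensity 1 Ξ) =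
      (gaussMeasure m p).withDensity fun Z => ENNReal.ofReal (tilt Ξ Z) := by
    rw [gaussMeasure, ← withDensity_mul _ measurable_gaussWeight ht]
    congr 1
    exact funext fun Z => matrixDensity_one_eq Ξ Z
  rw [risk, matrixNormal_eq, matrixNormalVar_eq_withDensity, e,
    lintegral_withDensity_eq_lintegral_mul _ ht hl]
  exact lintegral_congr fun Z => mul_comm (ENNReal.ofReal (tilt Ξ Z)) _

theorem loss_mul_mul {V : Matrix (Fin m) (Fin m) ℂ} (hV : V ∈ unitaryGroup (Fin m) ℂ)
    {U : Matrix (Fin p) (Fin p) ℂ} (hU : U ∈ unitaryGroup (Fin p) ℂ)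
    (Z Ξ : Matrix (Fin m) (Fin p) ℂ) : loss (V * Z * U) Ξ = loss Z (Vᴴ * Ξ * Uᴴ) := by
  have hV2 : V * Vᴴ = 1 := (mem_unitaryGroup_iff).1 hV
  have hU1 : Uᴴ * U = 1 := (mem_unitaryGroup_iff').1 hU
  have e : V * Z * U - Ξ = V * (Z - Vᴴ * Ξ * Uᴴ) * U := by
    rw [Matrix.mul_sub, Matrix.sub_mul]
    congr 1
    calc Ξ = (V * Vᴴ) * Ξ * (Uᴴ * U) := by rw [hV2, hU1, Matrix.one_mul, Matrix.mul_one]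
      _ = _ := by simp only [Matrix.mul_assoc]
  rw [loss, loss, e, ← sum_norm_sq_eq_re_trace, ← sum_norm_sq_eq_re_trace,
    sum_norm_sq_unitary_mul hV hU]

/-- Twice the real parts of the diagonal entries of a rectangular matrix. -/
def diagRe (hmp : p ≤ m) (Ξ : Matrix (Fin m) (Fin p) ℂ) (k : Fin p) : ℝ :=
  2 * (Ξ (Fin.castLE hmp k) k).re

/-- The loss of a rectangular diagonal matrix depends on `Ξ` only through the real parts of its diagonal
and a constant. -/
theorem loss_rectDiag (hmp : p ≤ m) (x : Fin p → ℝ) (Ξ : Matrix (Fin m) (Fin p) ℂ) :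
    loss (rectDiag m x) Ξ =
      ∑ k, (x k ^ 2 - diagRe hmp Ξ k * x k) + ∑ i, ∑ j, ‖Ξ i j‖ ^ 2 := by
  rw [loss_eq_sum, Finset.sum_comm, Finset.sum_comm (f := fun i j => ‖Ξ i j‖ ^ 2),
    ← Finset.sum_add_distrib]
  refine Finset.sum_congr rfl fun k _ => ?_
  have h1 : ∀ f : Fin m → ℝ, ∑ i, f i = f (Fin.castLE hmp k) +
      ∑ i ∈ Finset.univ.erase (Fin.castLE hmp k), f i := fun f =>
    (Finset.add_sum_erase _ f (Finset.mem_univ _)).symm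
  rw [h1, h1 fun i => ‖Ξ i k‖ ^ 2, ← add_assoc]
  congr 1
  · simp only [rectDiag, of_apply, Fin.val_castLE, if_true, diagRe, ← Complex.normSq_eq_norm_sq,
      Complex.normSq_apply, Complex.sub_re, Complex.sub_im, Complex.ofReal_re, Complex.ofReal_im]
    ring
  · refine Finset.sum_congr rfl fun i hi => ?_
    have : (i : ℕ) ≠ k := fun hc => Finset.ne_of_mem_erase hi (Fin.ext hc)
    simp [rectDiag, this]

theorem sum_norm_sq_rectDiag (hmp : p ≤ m) (x : Fin p → ℝ) :
    ∑ i, ∑ j, ‖rectDiag m x i j‖ ^ 2 = ∑ k, x k ^ 2 := by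
  have h := loss_rectDiag hmp x 0
  rw [loss_eq_sum] at h
  simpa [diagRe] using h

/-- The comparison of the risks along one pair of singular frames: the excess loss of the shrinkage
estimator is bounded by the integrand of `setIntegral_shrinkage_nonpos`. -/
theorem lintegral_svMeasure_loss_le (hmp : p < m) {g : Fin p → (Fin p → ℝ) → ℝ}
    (hgm : ∀ k, Measurable (g k))
    (hg : ∀ k, ∀ x ∈ orderedCone p, 0 ≤ g k x ∧ g k x ≤ 2 * ((m : ℝ) - p))
    (hmono : ∀ k, ∀ x ∈ orderedCone p, ∀ t, x k ≤ t → Function.update x k t ∈ orderedCone p →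
      g k x ≤ g k (Function.update x k t))
    (hanti : ∀ x ∈ orderedCone p, ∀ i j, i < j → g j x ≤ g i x)
    (Ξ : Matrix (Fin m) (Fin p) ℂ) :
    ∫⁻ x, ENNReal.ofReal (loss (rectDiag m fun k => x k - g k x / x k) Ξ) *
        ENNReal.ofReal (tilt Ξ (rectDiag m x)) ∂svMeasure (m - p) p ≤
      ∫⁻ x, ENNReal.ofReal (loss (rectDiag m x) Ξ) *
        ENNReal.ofReal (tilt Ξ (rectDiag m x)) ∂svMeasure (m - p) p := by
  have hcone := (isOpen_orderedCone p).measurableSet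
  set b := diagRe hmp.le Ξ with hb
  set N := ∑ i, ∑ j, ‖Ξ i j‖ ^ 2 with hN
  set K : ℝ := (Real.pi⁻¹) ^ (m * p) * Real.exp (-N) with hK
  have hK0 : 0 < K := by positivity
  set w : (Fin p → ℝ) → ℝ := fun x =>
    MvPolynomial.eval x (svPoly (m - p) p) * expWeight b 1 x with hw
  have hw0 : ∀ x ∈ orderedCone p, 0 ≤ w x := fun x hx =>
    (mul_pos (eval_svPoly_pos _ hx) (expWeight_pos _ _ _)).le
  -- the weight of the tilted measure
  have htilt : ∀ x, expWeight 0 1 x * tilt Ξ (rectDiag m x) = K * expWeight b 1 x := by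
    intro x
    rw [tilt, sum_norm_sq_rectDiag hmp.le, loss_rectDiag hmp.le, hK, expWeight, expWeight,
      mul_left_comm, ← Real.exp_add, mul_assoc, ← Real.exp_add, ← hb, ← hN]
    congr 2
    simp only [Finset.sum_sub_distrib, Pi.zero_apply, zero_mul, one_mul, Finset.sum_const_zero]
    ring
  have hconv : ∀ L : (Fin p → ℝ) → Matrix (Fin m) (Fin p) ℂ,
      (Measurable fun x => ENNReal.ofReal (loss (L x) Ξ)) →
      ∫⁻ x, ENNReal.ofReal (loss (L x) Ξ) * ENNReal.ofReal (tilt Ξ (rectDiag m x))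
        ∂svMeasure (m - p) p =
      ∫⁻ x in orderedCone p, ENNReal.ofReal (loss (L x) Ξ * (K * w x)) := by
    intro L hL
    have ht : Measurable fun x : Fin p → ℝ => ENNReal.ofReal (tilt Ξ (rectDiag m x)) :=
      (measurable_tilt Ξ).comp measurable_rectDiag
    have hLt : Measurable fun x : Fin p → ℝ =>
      ENNReal.ofReal (loss (L x) Ξ) * ENNReal.ofReal (tilt Ξ (rectDiag m x)) := hL.mul ht
    rw [svMeasure, lintegral_withDensity_eq_lintegral_mul _ (measurable_svWeight _) hLt]
    refine setLIntegral_congr_fun hcone fun x hx => ?_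
    simp only [Pi.mul_apply]
    have h0 : 0 ≤ loss (L x) Ξ := by
      rw [loss_eq_sum]; positivity
    rw [mul_left_comm, ← ENNReal.ofReal_mul
      (mul_pos (eval_svPoly_pos _ hx) (expWeight_pos _ _ _)).le, ← ENNReal.ofReal_mul h0]
    congr 2
    rw [mul_assoc, htilt, hw]
    ring
  have hd : m - p ≠ 0 := by omega
  obtain ⟨hDi, hD⟩ := setIntegral_shrinkage_nonpos hd b hgm hg hmono hanti
  set D : (Fin p → ℝ) → ℝ := fun x =>
    (∑ k, g k x * (((m - p : ℕ) : ℝ) / x k ^ 2 + b k / (2 * x k) - 1)) * w x with hDdef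
  have hm1 : Measurable fun x : Fin p → ℝ => rectDiag m fun k => x k - g k x / x k :=
    measurable_rectDiag.comp (measurable_pi_iff.2 fun k =>
      (measurable_pi_apply k).sub ((hgm k).div (measurable_pi_apply k)))
  rw [hconv _ (measurable_loss hm1 measurable_const),
    hconv _ (measurable_loss measurable_rectDiag measurable_const)]
  -- the loss of the identity estimator is a polynomial in the singular values
  set F : (Fin p → ℝ) → ℝ := fun x => loss (rectDiag m x) Ξ * (K * w x) with hF
  have hFi : IntegrableOn F (orderedCone p) := by
    have h := ((integrable_eval_mul_expWeight b one_pos ((∑ k, (MvPolynomial.X k ^ 2 -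
      MvPolynomial.C (b k) * MvPolynomial.X k) + MvPolynomial.C N) *
        svPoly (m - p) p)).const_mul K).integrableOn (s := orderedCone p)
    refine h.congr (.of_forall fun x => ?_)
    simp only [hF, hw, loss_rectDiag hmp.le, map_mul, map_add, map_sum, map_sub, map_pow,
      MvPolynomial.eval_X, MvPolynomial.eval_C, ← hb, ← hN]
    ring
  have hpt : ∀ x ∈ orderedCone p, loss (rectDiag m fun k => x k - g k x / x k) Ξ * (K * w x) ≤
      F x + 2 * K * D x := by
    intro x hx
    -- the difference of both sides is `∑ₖ gₖ (2 (m - p) - gₖ) / xₖ²`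
    have h1 : loss (rectDiag m fun k => x k - g k x / x k) Ξ ≤ loss (rectDiag m x) Ξ +
        2 * ∑ k, g k x * (((m - p : ℕ) : ℝ) / x k ^ 2 + b k / (2 * x k) - 1) := by
      rw [loss_rectDiag hmp.le, loss_rectDiag hmp.le, ← hb, Finset.mul_sum, add_right_comm,
        ← Finset.sum_add_distrib]
      gcongr with k
      have hxk := hx.2 k
      obtain ⟨hg0, hg1⟩ := hg k x hx
      rw [Nat.cast_sub hmp.le]
      have e : x k ^ 2 - b k * x k + 2 * (g k x * (((m : ℝ) - p) / x k ^ 2 +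
          b k / (2 * x k) - 1)) -
          ((x k - g k x / x k) ^ 2 - b k * (x k - g k x / x k)) =
          g k x * (2 * ((m : ℝ) - p) - g k x) / x k ^ 2 := by
        field_simp
        ring
      have : 0 ≤ g k x * (2 * ((m : ℝ) - p) - g k x) / x k ^ 2 :=
        div_nonneg (mul_nonneg hg0 (by linarith)) (by positivity)
      linarith
    have h2 := mul_le_mul_of_nonneg_right h1 (mul_nonneg hK0.le (hw0 x hx))
    refine h2.trans_eq ?_
    simp only [hF, hDdef]
    ring
  have hsum : IntegrableOn (fun x => F x + 2 * K * D x) (orderedCone p) :=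
    Integrable.add hFi (hDi.const_mul (2 * K))
  have hloss : ∀ A : Matrix (Fin m) (Fin p) ℂ, 0 ≤ loss A Ξ := fun A => by
    rw [loss_eq_sum]; positivity
  calc ∫⁻ x in orderedCone p,
        ENNReal.ofReal (loss (rectDiag m fun k => x k - g k x / x k) Ξ * (K * w x))
      ≤ ∫⁻ x in orderedCone p, ENNReal.ofReal (F x + 2 * K * D x) :=
        setLIntegral_mono' hcone fun x hx => ENNReal.ofReal_le_ofReal (hpt x hx)
    _ = ENNReal.ofReal (∫ x in orderedCone p, (F x + 2 * K * D x)) := by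
        refine (ofReal_integral_eq_lintegral_ofReal hsum ?_).symm
        refine (ae_restrict_mem hcone).mono fun x hx => ?_
        exact (mul_nonneg (hloss _) (mul_nonneg hK0.le (hw0 x hx))).trans (hpt x hx)
    _ ≤ ENNReal.ofReal (∫ x in orderedCone p, F x) := by
        refine ENNReal.ofReal_le_ofReal ?_
        rw [integral_add hFi (hDi.const_mul (2 * K)), integral_const_mul]
        have := mul_nonpos_of_nonneg_of_nonpos (by positivity : (0 : ℝ) ≤ 2 * K) hD
        linarith
    _ = _ := by
        refine ofReal_integral_eq_lintegral_ofReal hFi ?_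
        exact (ae_restrict_mem hcone).mono fun x hx =>
          mul_nonneg (hloss _) (mul_nonneg hK0.le (hw0 x hx))

/-- An estimator that shrinks the singular values `xₖ` to `xₖ - gₖ / xₖ`, for `g` as in
`setIntegral_shrinkage_nonpos`, is minimax. -/
theorem isMinimax_of_shrinks (hmp : p < m)
    {δ : Matrix (Fin m) (Fin p) ℂ → Matrix (Fin m) (Fin p) ℂ} (hδ : Measurable δ)
    {g : Fin p → (Fin p → ℝ) → ℝ} (hgm : ∀ k, Measurable (g k))
    (hg : ∀ k, ∀ x ∈ orderedCone p, 0 ≤ g k x ∧ g k x ≤ 2 * ((m : ℝ) - p))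
    (hmono : ∀ k, ∀ x ∈ orderedCone p, ∀ t, x k ≤ t → Function.update x k t ∈ orderedCone p →
      g k x ≤ g k (Function.update x k t))
    (hanti : ∀ x ∈ orderedCone p, ∀ i j, i < j → g j x ≤ g i x)
    (hδg : ∀ V ∈ unitaryGroup (Fin m) ℂ, ∀ U ∈ unitaryGroup (Fin p) ℂ, ∀ x ∈ orderedCone p,
      δ (V * rectDiag m x * U) = V * rectDiag m (fun k => x k - g k x / x k) * U) :
    IsMinimax δ := by
  refine isMinimax_of_risk_le hδ fun Ξ => ?_
  rw [← risk_id Ξ, risk_eq_lintegral_gaussMeasure hδ, risk_eq_lintegral_gaussMeasure measurable_id]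
  refine lintegral_gaussMeasure_mono hmp
    ((measurable_loss hδ measurable_const).mul (measurable_tilt Ξ))
    ((measurable_loss measurable_id measurable_const).mul (measurable_tilt Ξ)) fun V hV U hU => ?_
  have htilt : ∀ x : Fin p → ℝ, tilt Ξ (V * rectDiag m x * U) =
      tilt (Vᴴ * Ξ * Uᴴ) (rectDiag m x) := fun x => by
    rw [tilt, tilt, loss_mul_mul hV hU, sum_norm_sq_unitary_mul hV hU]
  have h := lintegral_svMeasure_loss_le hmp hgm hg hmono hanti (Vᴴ * Ξ * Uᴴ)
  simp only [id, htilt, loss_mul_mul hV hU]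
  refine (lintegral_congr_ae ?_).trans_le h
  have hae : ∀ᵐ x ∂svMeasure (m - p) p, x ∈ orderedCone p :=
    (withDensity_absolutelyContinuous _ _).ae_le
      (ae_restrict_mem (isOpen_orderedCone p).measurableSet)
  filter_upwards [hae] with x hx
  rw [hδg V hV U hU x hx, loss_mul_mul hV hU]

end Risk

/-! ### The spectral and Efron–Morris estimators -/

section Estimators
variable {m p : ℕ}

theorem rectDiag_mul_diagonal (x d : Fin p → ℝ) :
    rectDiag m x * diagonal (fun k => (d k : ℂ)) = rectDiag m fun k => x k * d k := by
  ext i k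
  rw [mul_diagonal]
  simp [rectDiag]

theorem conjTranspose_rectDiag_mul_self (hmp : p ≤ m) (x : Fin p → ℝ) :
    (rectDiag m x)ᴴ * rectDiag m x = diagonal fun k => ((x k ^ 2 : ℝ) : ℂ) := by
  ext k l
  rw [mul_apply, Finset.sum_eq_single (Fin.castLE hmp k), diagonal_apply]
  · by_cases h : k = l
    · subst h
      simp [rectDiag, sq]
    · have : (k : ℕ) ≠ l := fun hc => h (Fin.ext hc)
      simp [rectDiag, h, this]
  · intro i _ hi
    have : (i : ℕ) ≠ k := fun hc => hi (Fin.ext hc)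
    simp [rectDiag, this]
  · simp

theorem isSpectralDecomp_mul_rectDiag_mul (hmp : p ≤ m) {V : Matrix (Fin m) (Fin m) ℂ}
    (hV : V ∈ unitaryGroup (Fin m) ℂ) {U : Matrix (Fin p) (Fin p) ℂ}
    (hU : U ∈ unitaryGroup (Fin p) ℂ) (x : Fin p → ℝ) :
    IsSpectralDecomp (V * rectDiag m x * U) Uᴴ fun k => x k ^ 2 := by
  have hV1 : Vᴴ * V = 1 := (mem_unitaryGroup_iff').1 hV
  refine ⟨conjTranspose_mem_unitaryGroup ⟨U, hU⟩, ?_⟩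
  rw [← conjTranspose_rectDiag_mul_self hmp, conjTranspose_mul, conjTranspose_mul,
    conjTranspose_conjTranspose]
  calc Uᴴ * ((rectDiag m x)ᴴ * Vᴴ) * (V * rectDiag m x * U)
      = Uᴴ * ((rectDiag m x)ᴴ * ((Vᴴ * V) * rectDiag m x)) * U := by simp only [Matrix.mul_assoc]
    _ = _ := by rw [hV1, Matrix.one_mul]

theorem sq_mem_orderedCone {x : Fin p → ℝ} (hx : x ∈ orderedCone p) :
    (fun k => x k ^ 2) ∈ orderedCone p :=
  ⟨fun _ _ hij => pow_lt_pow_left₀ (hx.1 hij) (hx.2 _).le two_ne_zero, fun k => pow_pos (hx.2 k) 2⟩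

/-- On the orbit of a rectangular diagonal matrix the estimator acts on the singular values. -/
theorem spectralEstimator_mul_rectDiag_mul (hmp : p ≤ m) (γ : Fin p → orderedCone p → ℝ)
    {V : Matrix (Fin m) (Fin m) ℂ} (hV : V ∈ unitaryGroup (Fin m) ℂ)
    {U : Matrix (Fin p) (Fin p) ℂ} (hU : U ∈ unitaryGroup (Fin p) ℂ) {x : Fin p → ℝ}
    (hx : x ∈ orderedCone p) :
    spectralEstimator (fun k l => -(γ k l / l.1 k)) (V * rectDiag m x * U) =
      V * rectDiag m (fun k => x k - γ k ⟨_, sq_mem_orderedCone hx⟩ / x k) * U := by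
  have hU2 : U * Uᴴ = 1 := (mem_unitaryGroup_iff).1 hU
  set l : orderedCone p := ⟨_, sq_mem_orderedCone hx⟩ with hl
  rw [spectralEstimator_eq _ (l := l) (isSpectralDecomp_mul_rectDiag_mul hmp hV hU x),
    conjTranspose_conjTranspose, Matrix.mul_add, Matrix.mul_one]
  have e : V * rectDiag m x * U * (Uᴴ * diagonal (fun k => ((-(γ k l / l.1 k) : ℝ) : ℂ)) * U) =
      V * (rectDiag m x * diagonal (fun k => ((-(γ k l / l.1 k) : ℝ) : ℂ))) * U := by
    calc _ = V * (rectDiag m x * ((U * Uᴴ) *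
          diagonal (fun k => ((-(γ k l / l.1 k) : ℝ) : ℂ)))) * U := by
            simp only [Matrix.mul_assoc]
      _ = _ := by rw [hU2, Matrix.one_mul]
  rw [e, rectDiag_mul_diagonal, ← Matrix.add_mul, ← Matrix.mul_add]
  congr 2
  ext i k
  have hk := (hx.2 k).ne'
  simp only [rectDiag, Matrix.add_apply, of_apply, hl]
  split_ifs
  · rw [← Complex.ofReal_add]
    congr 1
    field_simp
    ring
  · rw [add_zero]

/-- The coefficients of the polynomial of degree less than `p` that interpolates the values `h` at
the nodes `l`. -/
def interpCoeff (l h : Fin p → ℝ) : Fin p → ℝ := (vandermonde l)⁻¹ *ᵥ h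

theorem sum_interpCoeff_mul_pow {l : Fin p → ℝ} (hl : Function.Injective l) (h : Fin p → ℝ)
    (k : Fin p) : ∑ a : Fin p, interpCoeff l h a * l k ^ (a : ℕ) = h k := by
  have hdet : IsUnit (vandermonde l).det := (det_vandermonde_ne_zero_iff.2 hl).isUnit
  have e : vandermonde l *ᵥ interpCoeff l h = h := by
    rw [interpCoeff, mulVec_mulVec, mul_nonsing_inv _ hdet, one_mulVec]
  have := congrFun e k
  simp only [mulVec, dotProduct, vandermonde_apply] at this
  rw [← this]
  exact Finset.sum_congr rfl fun a _ => mul_comm _ _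

theorem measurable_interpCoeff (a : Fin p) {α : Type*} [MeasurableSpace α] {l h : α → Fin p → ℝ}
    (hl : Measurable l) (hh : Measurable h) : Measurable fun x => interpCoeff (l x) (h x) a := by
  have hc : Continuous fun y : Fin p → ℝ => vandermonde y :=
    continuous_matrix fun i j => (continuous_apply i).pow _
  have h1 : ∀ k, Measurable fun y : Fin p → ℝ => (vandermonde y)⁻¹ a k := by
    intro k
    simp only [inv_def, Matrix.smul_apply, Ring.inverse_eq_inv', smul_eq_mul]
    exact (hc.matrix_det.measurable.inv).mul (hc.matrix_adjugate.matrix_elem a k).measurable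
  simp only [interpCoeff, mulVec, dotProduct]
  refine Finset.measurable_sum _ fun k _ => ?_
  exact ((h1 k).comp hl).mul ((measurable_pi_apply k).comp hh)

/-- A function of `Z* Z` is a polynomial in `Z* Z` with coefficients depending measurably on the
eigenvalues; no measurable choice of eigenvectors is needed. -/
theorem sum_smul_gram_pow {Z : Matrix (Fin m) (Fin p) ℂ} {U : Matrix (Fin p) (Fin p) ℂ}
    {l : Fin p → ℝ} (hl : Function.Injective l) (hZ : IsSpectralDecomp Z U l) (h : Fin p → ℝ) :
    ∑ a : Fin p, (interpCoeff l h a : ℂ) • (Zᴴ * Z) ^ (a : ℕ) =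
      U * diagonal (fun k => (h k : ℂ)) * Uᴴ := by
  have e : diagonal (fun k => (h k : ℂ)) =
      ∑ a : Fin p, (interpCoeff l h a : ℂ) • diagonal (fun k => (l k : ℂ) ^ (a : ℕ)) := by
    ext i j
    rw [Matrix.sum_apply]
    by_cases hij : i = j
    · subst hij
      simp only [diagonal_apply_eq, Matrix.smul_apply, smul_eq_mul]
      rw [← sum_interpCoeff_mul_pow hl h i]
      push_cast
      rfl
    · simp [diagonal_apply_ne _ hij]
  rw [e, Matrix.mul_sum, Matrix.sum_mul]
  refine Finset.sum_congr rfl fun a _ => ?_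
  rw [hZ.2, conj_diagonal_pow hZ.1, Matrix.mul_smul, Matrix.smul_mul]

/-- The exceptional set in the definition of `spectralEstimator`, in terms of the singular values. -/
theorem exists_isSpectralDecomp_iff (Z : Matrix (Fin m) (Fin p) ℂ) :
    (∃ x : Matrix (Fin p) (Fin p) ℂ × orderedCone p, IsSpectralDecomp Z x.1 x.2) ↔
      (sv Z).1 ∈ orderedCone p := by
  constructor
  · rintro ⟨⟨U, l⟩, h⟩
    have hs : (fun k => √(l.1 k)) ∈ orderedCone p :=
      ⟨fun i j hij => Real.sqrt_lt_sqrt (l.2.2 j).le (l.2.1 hij), fun k => Real.sqrt_pos.2 (l.2.2 k)⟩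
    have e : sv Z = ⟨_, orderedCone_subset_chamberSet p hs⟩ := by
      refine sv_eq_of_isSpectralDecomp (U := U) ?_
      simp only [Real.sq_sqrt (l.2.2 _).le]
      exact h
    rw [e]
    exact hs
  · intro h
    obtain ⟨U, hU⟩ := exists_isSpectralDecomp_sv Z
    exact ⟨(U, ⟨_, sq_mem_orderedCone h⟩), hU⟩

/-- The extension by zero of a function on the ordered cone. -/
def coneExtend (f : orderedCone p → ℝ) : (Fin p → ℝ) → ℝ := Function.extend Subtype.val f 0

theorem coneExtend_apply (f : orderedCone p → ℝ) {l : Fin p → ℝ} (hl : l ∈ orderedCone p) :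
    coneExtend f l = f ⟨l, hl⟩ :=
  Subtype.val_injective.extend_apply f 0 ⟨l, hl⟩

theorem measurable_coneExtend {f : orderedCone p → ℝ} (hf : Measurable f) :
    Measurable (coneExtend f) :=
  (MeasurableEmbedding.subtype_coe (isOpen_orderedCone p).measurableSet).measurable_extend hf
    measurable_const

open Classical in
theorem spectralEstimator_eq_ite (h : Fin p → orderedCone p → ℝ) (Z : Matrix (Fin m) (Fin p) ℂ) :
    spectralEstimator h Z = if (sv Z).1 ∈ orderedCone p then
      Z * (1 + ∑ a : Fin p, (interpCoeff (fun k => (sv Z).1 k ^ 2)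
        (fun k => coneExtend (h k) fun k => (sv Z).1 k ^ 2) a : ℂ) • (Zᴴ * Z) ^ (a : ℕ)) else Z := by
  split_ifs with hZ
  · obtain ⟨U, hU⟩ := exists_isSpectralDecomp_sv Z
    have hl := sq_mem_orderedCone hZ
    rw [spectralEstimator_eq h (l := ⟨_, hl⟩) hU, sum_smul_gram_pow hl.1.injective hU]
    simp only [coneExtend_apply _ hl]
  · have := mt (exists_isSpectralDecomp_iff Z).1 hZ
    rw [spectralEstimator, dif_neg this]

theorem measurable_spectralEstimator {h : Fin p → orderedCone p → ℝ}
    (hh : ∀ k, Measurable (h k)) :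
    Measurable (spectralEstimator h : Matrix (Fin m) (Fin p) ℂ → Matrix (Fin m) (Fin p) ℂ) := by
  classical
  have hsv : Measurable fun Z : Matrix (Fin m) (Fin p) ℂ => (sv Z).1 :=
    measurable_subtype_coe.comp measurable_sv
  have hsq : Measurable fun Z : Matrix (Fin m) (Fin p) ℂ => fun k => (sv Z).1 k ^ 2 :=
    measurable_pi_iff.2 fun k => ((measurable_pi_apply k).comp hsv).pow_const 2
  have hS : MeasurableSet {Z : Matrix (Fin m) (Fin p) ℂ | (sv Z).1 ∈ orderedCone p} :=
    hsv (isOpen_orderedCone p).measurableSet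
  have e : (spectralEstimator h : Matrix (Fin m) (Fin p) ℂ → Matrix (Fin m) (Fin p) ℂ) = _ :=
    funext (spectralEstimator_eq_ite h)
  rw [e]
  refine Measurable.ite hS (measurable_matrix_mul measurable_id ?_) measurable_id
  refine measurable_matrix fun i j => ?_
  simp only [Matrix.add_apply, Matrix.sum_apply, Matrix.smul_apply, smul_eq_mul]
  refine measurable_const.add (Finset.measurable_sum _ fun a _ => Measurable.mul ?_ ?_)
  · refine Complex.measurable_ofReal.comp (measurable_interpCoeff a hsq ?_)
    exact measurable_pi_iff.2 fun k => (measurable_coneExtend (hh k)).comp hsq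
  · have := (measurable_entry i j).comp (measurable_gram_pow (m := m) (p := p) a)
    exact this

/-- The crude Efron–Morris estimator is the spectral estimator with constant `γ`. -/
theorem crudeEfronMorris_eq {Z : Matrix (Fin m) (Fin p) ℂ} {U : Matrix (Fin p) (Fin p) ℂ}
    {l : orderedCone p} (h : IsSpectralDecomp Z U l) :
    crudeEfronMorris Z = spectralEstimator (fun k l => -(((m : ℝ) - p) / l.1 k)) Z := by
  have hU1 : Uᴴ * U = 1 := (mem_unitaryGroup_iff').1 h.1
  have hU2 : U * Uᴴ = 1 := (mem_unitaryGroup_iff).1 h.1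
  have hinv : (Zᴴ * Z)⁻¹ = U * diagonal (fun k => ((l.1 k : ℝ) : ℂ)⁻¹) * Uᴴ := by
    refine inv_eq_right_inv ?_
    rw [h.2]
    calc U * diagonal (fun k => ((l.1 k : ℝ) : ℂ)) * Uᴴ *
          (U * diagonal (fun k => ((l.1 k : ℝ) : ℂ)⁻¹) * Uᴴ)
        = U * (diagonal (fun k => ((l.1 k : ℝ) : ℂ)) * (Uᴴ * U) *
          diagonal (fun k => ((l.1 k : ℝ) : ℂ)⁻¹)) * Uᴴ := by simp only [Matrix.mul_assoc]
      _ = 1 := by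
          have e : (fun k => ((l.1 k : ℝ) : ℂ) * ((l.1 k : ℝ) : ℂ)⁻¹) = fun _ => 1 :=
            funext fun k => mul_inv_cancel₀ (by exact_mod_cast (l.2.2 k).ne')
          rw [hU1, Matrix.mul_one, diagonal_mul_diagonal, e, diagonal_one, Matrix.mul_one, hU2]
  rw [spectralEstimator_eq _ h, crudeEfronMorris, hinv, sub_eq_add_neg]
  congr 2
  rw [← Matrix.smul_mul, ← Matrix.mul_smul, ← Matrix.neg_mul, ← Matrix.mul_neg]
  congr 2
  ext i j
  by_cases hij : i = j
  · subst hij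
    simp [div_eq_mul_inv]
  · simp [hij]

theorem measurable_crudeEfronMorris : Measurable (crudeEfronMorris (m := m) (p := p)) := by
  refine measurable_matrix_mul measurable_id ?_
  have hW : Continuous fun Z : Matrix (Fin m) (Fin p) ℂ => Zᴴ * Z :=
    continuous_id.matrix_conjTranspose.matrix_mul continuous_id
  refine measurable_matrix fun i j => ?_
  simp only [Matrix.sub_apply, Matrix.smul_apply, inv_def, Ring.inverse_eq_inv', smul_eq_mul]
  exact measurable_const.sub (measurable_const.mul ((hW.matrix_det.measurable.inv).mul
    (hW.matrix_adjugate.matrix_elem i j).measurable))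

/-- An estimator that agrees with a spectral estimator wherever the eigenvalues of `Z* Z` are distinct
and positive is minimax. On singular values it acts by `gₖ x = γₖ (x²)`, which inherits boundedness
and both monotonicity properties from `γ`. -/
theorem isMinimax_of_eq_spectralEstimator (hmp : p < m)
    {δ : Matrix (Fin m) (Fin p) ℂ → Matrix (Fin m) (Fin p) ℂ} (hδ : Measurable δ)
    {γ : Fin p → orderedCone p → ℝ} (hγm : ∀ k, Measurable (γ k))
    (hγ : ∀ k l, 0 ≤ γ k l ∧ γ k l ≤ 2 * ((m : ℝ) - p))
    (hmono : ∀ k, ∀ l l' : orderedCone p, (∀ j, j ≠ k → l.1 j = l'.1 j) → l.1 k ≤ l'.1 k →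
      γ k l ≤ γ k l')
    (hanti : ∀ l, ∀ i j : Fin p, i ≤ j → γ j l ≤ γ i l)
    (h : ∀ Z U, ∀ l : orderedCone p, IsSpectralDecomp Z U l →
      δ Z = spectralEstimator (fun k l => -(γ k l / l.1 k)) Z) : IsMinimax δ := by
  have hg : ∀ k {x : Fin p → ℝ} (hx : x ∈ orderedCone p),
      coneExtend (γ k) (fun k => x k ^ 2) = γ k ⟨_, sq_mem_orderedCone hx⟩ := fun k x hx =>
    coneExtend_apply _ _
  refine isMinimax_of_shrinks hmp hδ (g := fun k x => coneExtend (γ k) fun k => x k ^ 2)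
    (fun k => (measurable_coneExtend (hγm k)).comp
      (measurable_pi_iff.2 fun k => (measurable_pi_apply k).pow_const 2))
    (fun k x hx => ?_) (fun k x hx t ht hu => ?_) (fun x hx i j hij => ?_)
    fun V hV U hU x hx => ?_
  · rw [hg k hx]
    exact hγ k _
  · rw [hg k hx, hg k hu]
    refine hmono k _ _ (fun j hj => ?_) ?_
    · simp [Function.update_of_ne hj]
    · simpa using pow_le_pow_left₀ (hx.2 k).le ht 2
  · rw [hg i hx, hg j hx]
    exact hanti _ i j hij.le
  · rw [h _ _ ⟨_, sq_mem_orderedCone hx⟩ (isSpectralDecomp_mul_rectDiag_mul hmp.le hV hU x),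
      spectralEstimator_mul_rectDiag_mul hmp.le γ hV hU hx]
    simp only [hg _ hx]

end Estimators
end ComplexShrinkage

end

theorem mainTheorem6 (m p : ℕ) (hmp : p < m) :
    (∀ γ : Fin p → ComplexShrinkage.orderedCone p → ℝ,
      (∀ k, Measurable (γ k)) →
      (∀ k l, 0 ≤ γ k l ∧ γ k l ≤ 2 * ((m : ℝ) - (p : ℝ))) →
      (∀ k, ∀ l l' : ComplexShrinkage.orderedCone p,
        (∀ j, j ≠ k → l.1 j = l'.1 j) → l.1 k ≤ l'.1 k → γ k l ≤ γ k l') →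
      (∀ l, ∀ i j : Fin p, i ≤ j → γ j l ≤ γ i l) →
      ComplexShrinkage.IsMinimax (m := m) (p := p)
        (ComplexShrinkage.spectralEstimator fun k l => -(γ k l / l.1 k))) ∧
    ComplexShrinkage.IsMinimax (m := m) (p := p) ComplexShrinkage.crudeEfronMorris := by
  have hmp' : (0 : ℝ) ≤ (m : ℝ) - p := sub_nonneg.2 (by exact_mod_cast hmp.le)
  refine ⟨fun γ hγm hγ hmono hanti => ?_, ?_⟩
  · refine ComplexShrinkage.isMinimax_of_eq_spectralEstimator hmp
      (ComplexShrinkage.measurable_spectralEstimator fun k => ?_) hγm hγ hmono hanti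
      fun _ _ _ _ => rfl
    exact ((hγm k).div ((measurable_pi_apply k).comp measurable_subtype_coe)).neg
  · exact ComplexShrinkage.isMinimax_of_eq_spectralEstimator hmp
      ComplexShrinkage.measurable_crudeEfronMorris (γ := fun _ _ => (m : ℝ) - p)
      (fun _ => measurable_const) (fun _ _ => ⟨hmp', by linarith⟩) (fun _ _ _ _ _ => le_rfl)
      (fun _ _ _ _ => le_rfl) fun _ _ _ h => ComplexShrinkage.crudeEfronMorris_eq h
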